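/- **Conventions.** A *graph* is a locally finite (Hausdorff) CW complex of dimension at most $1$; a *subgraph* is a subcomplex. An *edge path* is either constant at a vertex or a path $[0,1]\to\Gamma$ for which $[0,1]$ can be cut into finitely many successive intervals, the interior of each being mapped homeomorphically onto an open edge. A *graph map* is a continuous map sending vertices to vertices and edges to edge paths. A *neighborhood basis for an end* of $\Gamma$ is a decreasing sequence of nonempty sets $U_1\supseteq U_2\supseteq\cdots$ such that, for some exhaustion $K_1\subseteq K_2\subseteq\cdots$ of $\Gamma$ by compact sets (whose interiors cover $\Gamma$), each $U_n$ is a connected component of $\Gamma-K_n$. Two such sequences are equivalent if every term of either one contains a term of the other, and an *end* is an equivalence class. An open set $U$ is a *neighborhood* of an end $E$ if it contains a tail of every neighborhood basis for $E$ and meets only finitely many terms of each neighborhood basis of any other end. A graph map $g:\Gamma\to\Gamma$ is *end-periodic* if each end $E$ has a neighborhood $U_E$ such that $g$, restricted to the largest subgraph contained in $\bigcup_E U_E$, is a homeomorphism onto its image sending edges to edges, and for some $p>0$ every $U_E$ satisfies either * $g^p(U_E)\subsetneq U_E$ and $(g^{pn}(U_E))_{n\ge 0}$ is a neighborhood basis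 for $E$, or * $g^{-p}(U_E)\subsetneq U_E$ and $(g^{-pn}(U_E))_{n\ge 0}$ is a neighborhood basis for $E$ (with $g^{-k}(U)$ the preimage of $U$ under $g^k$). The *mapping torus* $Z_g$ is the quotient of $\Gamma\times[0,1]$ by the equivalence relation generated by $(x,1)\sim(g(x),0)$. It carries the suspension semiflow $\psi$ induced by $((x,y),t)\mapsto(x,y+t)$, that is, $\psi^t[x,y]=[g^n(x),r]$, where $n$ and $r$ are the integer and fractional parts of $y+t$. **Theorem.** Let $\Gamma$ be an infinite connected graph with finitely many ends, and let $g:\Gamma\to\Gamma$ be an end-periodic map. Then there are a finite CW complex $W_g$ of dimension at most $2$, a continuous semiflow $\Psi:[0,\infty)\times W_g\to W_g$, disjoint subcomplexes $\partial_+W_g$ and $\partial_-W_g$ of $W_g$ of dimension at most $1$, and a map $\iota: Z_g\to W_g$ such that: 1. $\iota$ is a topological embedding and a homotopy equivalence. 2. $\iota$ is flow-preserving: $\iota(\psi^t(z))=\Psi^t(\iota(z))$ for all $z\in Z_g$ and $t\ge 0$. 3. The image of $\iota$ is $W_g-(\partial_+W_g\cup\partial_-W_g)$; in particular $Z_g$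 is homeomorphic to this complement. 4. $\partial_+W_g$ and $\partial_-W_g$ are oppositely cooriented relative to $\Psi$: there are topological embeddings $c_\pm:\partial_\pm W_g\times[0,\infty]\to W_g$ with $c_\pm(x,\infty)=x$, mapping $\partial_\pm W_g\times(0,\infty]$ onto an open set, such that for all $s\in[0,\infty]$ and $t\in[0,\infty)$ $$\Psi^t(c_+(x,s))=c_+(x,s+t),\qquad \Psi^t(c_-(x,s+t))=c_-(x,s).$$ Thus near $\partial_+W_g$ the semiflow runs toward $\partial_+W_g$, and near $\partial_-W_g$ it runs away from $\partial_-W_g$. -/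

import Mathlib

universe u

open Set Topology
open scoped NNReal ENNReal unitInterval ContinuousMap

/-! ### Graphs and graph maps

A graph is a Hausdorff space with a CW structure on the whole space whose cells have dimension
at most one, and which is locally finite. -/

section Graphs

variable {Γ : Type*} [TopologicalSpace Γ] [CWComplex (univ : Set Γ)]

/-- A CW complex is a (locally finite) graph if it has no cells of dimension at least two and its
closed cells form a locally finite family. -/
structure IsGraph (Γ : Type*) [TopologicalSpace Γ] [CWComplex (univ : Set Γ)] : Prop where
  isEmpty_cell : ∀ n, 2 ≤ n → IsEmpty (RelCWComplex.cell (univ : Set Γ) n)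
  locallyFinite : LocallyFinite fun c : Σ n, RelCWComplex.cell (univ : Set Γ) n ↦
    RelCWComplex.closedCell (C := (univ : Set Γ)) c.1 c.2

/-- The set of vertices (the union of all `0`-cells). -/
def vertexSet (Γ : Type*) [TopologicalSpace Γ] [CWComplex (univ : Set Γ)] : Set Γ :=
  ⋃ v : RelCWComplex.cell (univ : Set Γ) 0, RelCWComplex.closedCell 0 v

/-- The open edge with index `e`. -/
def openEdge (e : RelCWComplex.cell (univ : Set Γ) 1) : Set Γ := RelCWComplex.openCell 1 e

/-- The characteristic map of the edge `e`, as a path parametrized by `[0, 1]` (its values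
outside of `[0, 1]` carry no information). -/
def edgeParam (e : RelCWComplex.cell (univ : Set Γ) 1) (t : ℝ) : Γ :=
  RelCWComplex.map (C := (univ : Set Γ)) 1 e fun _ ↦ 2 * t - 1

/-- `ρ`, restricted to `[0, 1]`, is an edge path: it is either constant at a vertex (length `0`),
or it is a path and `[0, 1]` can be cut into `r ≥ 1` successive intervals, the interior of each of
which is mapped homeomorphically onto an open edge. (A continuous bijection from an open interval
onto an open edge is a homeomorphism.) -/
def IsEdgePath (ρ : ℝ → Γ) : Prop :=
  (∃ v ∈ vertexSet Γ, ∀ t ∈ Icc (0 : ℝ) 1, ρ t = v) ∨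
  (ContinuousOn ρ (Icc 0 1) ∧
    ∃ (r : ℕ) (τ : ℕ → ℝ), τ 0 = 0 ∧ τ r = 1 ∧
      ∀ i < r, τ i < τ (i + 1) ∧
        ∃ e : RelCWComplex.cell (univ : Set Γ) 1, BijOn ρ (Ioo (τ i) (τ (i + 1))) (openEdge e))

/-- A graph map: a continuous map sending vertices to vertices and edges to edge paths. -/
structure IsGraphMap (g : Γ → Γ) : Prop where
  continuous : Continuous g
  mapsTo_vertexSet : MapsTo g (vertexSet Γ) (vertexSet Γ)
  isEdgePath : ∀ e : RelCWComplex.cell (univ : Set Γ) 1, IsEdgePath fun t ↦ g (edgeParam e t)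

/-- The largest subcomplex contained in `U`: the union of all subcomplexes contained in `U`. -/
def largestSubgraph (U : Set Γ) : Set Γ :=
  ⋃ (S : RelCWComplex.Subcomplex (univ : Set Γ)) (_ : (S : Set Γ) ⊆ U), (S : Set Γ)

end Graphs

/-! ### Ends -/

section Ends

variable {X : Type*} [TopologicalSpace X]

/-- A decreasing sequence of nonempty sets `U n` is a neighborhood basis for an end if each `U n`
is a connected component of `X \ K n`, for some exhaustion `K 0 ⊆ K 1 ⊆ ⋯` of `X` by compact sets
(an exhaustion: the interiors of the `K n` cover `X`). -/
def IsEndBasis (U : ℕ → Set X) : Prop :=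
  Antitone U ∧ ∃ K : ℕ → Set X, Monotone K ∧ (∀ n, IsCompact (K n)) ∧
    (∀ x, ∃ n, x ∈ interior (K n)) ∧
    ∀ n, ∃ x ∈ (K n)ᶜ, U n = connectedComponentIn (K n)ᶜ x

/-- Two neighborhood bases represent the same end if each term of either one contains a term of
the other. -/
def endSetoid (X : Type*) [TopologicalSpace X] : Setoid {U : ℕ → Set X // IsEndBasis U} where
  r U V := ∀ n, (∃ i, U.1 i ⊆ V.1 n) ∧ ∃ j, V.1 j ⊆ U.1 n
  iseqv :=
    { refl := fun _ n ↦ ⟨⟨n, subset_rfl⟩, ⟨n, subset_rfl⟩⟩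
      symm := fun h n ↦ ⟨(h n).2, (h n).1⟩
      trans := by
        intro U V W h k n
        obtain ⟨i, hi⟩ := (k n).1
        obtain ⟨i', hi'⟩ := (h i).1
        obtain ⟨j, hj⟩ := (h n).2
        obtain ⟨j', hj'⟩ := (k j).2
        exact ⟨⟨i', hi'.trans hi⟩, ⟨j', hj'.trans hj⟩⟩ }

/-- The set of ends of `X`. -/
def SpaceEnd (X : Type*) [TopologicalSpace X] : Type _ := Quotient (endSetoid X)

/-- The sequence `U` is a neighborhood basis for the end `E`. -/
def IsEndBasisOf (U : ℕ → Set X) (E : SpaceEnd X) : Prop :=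
  ∃ h : IsEndBasis U, (Quotient.mk (endSetoid X) ⟨U, h⟩ : SpaceEnd X) = E

/-- `U` is a neighborhood of the end `E`: it is open, contains a tail of every neighborhood basis
for `E`, and meets only finitely many terms of any neighborhood basis of any other end. -/
structure IsEndNhd (U : Set X) (E : SpaceEnd X) : Prop where
  isOpen : IsOpen U
  tail_subset : ∀ B : ℕ → Set X, IsEndBasisOf B E → ∃ N, ∀ n ≥ N, B n ⊆ U
  finite_meet : ∀ (E' : SpaceEnd X), E' ≠ E → ∀ B : ℕ → Set X, IsEndBasisOf B E' →
    {n | (B n ∩ U).Nonempty}.Finite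

end Ends

/-! ### End-periodic maps -/

section EndPeriodic

variable {Γ : Type*} [TopologicalSpace Γ] [CWComplex (univ : Set Γ)]

/-- `U` is a nesting neighborhood of the attracting end `E` for the power `p` of `g`. -/
def IsAttractingNhd (g : Γ → Γ) (p : ℕ) (U : Set Γ) (E : SpaceEnd Γ) : Prop :=
  g^[p] '' U ⊂ U ∧ IsEndBasisOf (fun n ↦ g^[p * n] '' U) E

/-- `U` is a nesting neighborhood of the repelling end `E` for the power `p` of `g`. -/
def IsRepellingNhd (g : Γ → Γ) (p : ℕ) (U : Set Γ) (E : SpaceEnd Γ) : Prop :=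
  g^[p] ⁻¹' U ⊂ U ∧ IsEndBasisOf (fun n ↦ g^[p * n] ⁻¹' U) E

/-- A graph map `g` is end-periodic if every end `E` has a neighborhood `U E` such that `g`,
restricted to the largest subgraph contained in the union of the `U E`, is a homeomorphism (onto
its image) which sends edges to edges, and for some `p > 0` each `U E` is nested under `g ^ p`,
either as an attracting or as a repelling neighborhood. -/
def IsEndPeriodic (g : Γ → Γ) : Prop :=
  IsGraphMap g ∧ ∃ U : SpaceEnd Γ → Set Γ,
    (∀ E, IsEndNhd (U E) E) ∧
    IsEmbedding ((largestSubgraph (⋃ E, U E)).domRestrict g) ∧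
    (∀ e : RelCWComplex.cell (univ : Set Γ) 1, openEdge e ⊆ largestSubgraph (⋃ E, U E) →
      ∃ e' : RelCWComplex.cell (univ : Set Γ) 1, g '' openEdge e = openEdge e') ∧
    ∃ p > 0, ∀ E, IsAttractingNhd g p (U E) E ∨ IsRepellingNhd g p (U E) E

end EndPeriodic

/-! ### Mapping tori and semiflows -/

section MappingTorus

variable {X : Type*}

/-- The generating relation `(x, 1) ∼ (f x, 0)` on `X × [0, 1]`. -/
def mappingTorusRel (f : X → X) (a b : X × I) : Prop := a.2 = 1 ∧ b = (f a.1, 0)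

/-- The mapping torus of `f`: the quotient of `X × [0, 1]` by the equivalence relation generated
by `(x, 1) ∼ (f x, 0)`. -/
def MappingTorus (f : X → X) : Type _ := Quot (mappingTorusRel f)

/-- The mapping torus carries the quotient topology. -/
instance [TopologicalSpace X] (f : X → X) : TopologicalSpace (MappingTorus f) :=
  inferInstanceAs (TopologicalSpace (Quot (mappingTorusRel f)))

/-- The class of `(x, y)` in the mapping torus. -/
def MappingTorus.mk (f : X → X) (x : X) (y : I) : MappingTorus f :=
  Quot.mk (mappingTorusRel f) (x, y)

/-- The suspension semiflow, induced by `((x, y), t) ↦ (x, y + t)`: the point `(x, y)` is moved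
in time `t` to `(f^n x, r)`, where `n` and `r` are the integer and fractional part of `y + t`. -/
noncomputable def suspensionSemiflow (f : X → X) (t : ℝ≥0) : MappingTorus f → MappingTorus f :=
  Quot.lift
    (fun a ↦ MappingTorus.mk f (f^[⌊(a.2 : ℝ) + t⌋₊] a.1)
      ⟨Int.fract ((a.2 : ℝ) + t), Int.fract_nonneg _, (Int.fract_lt_one _).le⟩)
    (by
      rintro ⟨x, y⟩ ⟨x', y'⟩ ⟨h1, h2⟩
      obtain rfl : y = 1 := h1
      obtain ⟨rfl, rfl⟩ := Prod.mk.inj h2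
      have hf : ⌊((1 : I) : ℝ) + t⌋₊ = ⌊((0 : I) : ℝ) + t⌋₊ + 1 := by
        rw [Icc.coe_one, Icc.coe_zero, zero_add, add_comm (1 : ℝ), Nat.floor_add_one t.coe_nonneg]
      have hr : Int.fract (((1 : I) : ℝ) + t) = Int.fract (((0 : I) : ℝ) + t) := by
        rw [Icc.coe_one, Icc.coe_zero, zero_add, add_comm, Int.fract_add_one]
      simp only [hf, hr, Function.iterate_succ_apply])

end MappingTorus

section Coorientation

variable {W : Type*} [TopologicalSpace W]

/-- `D` is cooriented outward by the semiflow `Ψ`: it has a product neighborhood `D × [0, ∞]`, with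
`D` as the top end `D × {∞}`, on which `Ψ` is upward translation. Thus flowlines near `D` run
toward `D`. -/
def IsOutwardCooriented (Ψ : Flow ℝ≥0 W) (D : Set W) : Prop :=
  ∃ c : D × ℝ≥0∞ → W, IsEmbedding c ∧ IsOpen (c '' {q | 0 < q.2}) ∧
    (∀ x : D, c (x, ∞) = x) ∧
    ∀ (x : D) (s : ℝ≥0∞) (t : ℝ≥0), Ψ t (c (x, s)) = c (x, s + t)

/-- `D` is cooriented inward by the semiflow `Ψ`: it has a product neighborhood `D × [0, ∞]`, with
`D` as the top end `D × {∞}`, on which `Ψ` is downward translation. Thus flowlines near `D` run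
away from `D`. -/
def IsInwardCooriented (Ψ : Flow ℝ≥0 W) (D : Set W) : Prop :=
  ∃ c : D × ℝ≥0∞ → W, IsEmbedding c ∧ IsOpen (c '' {q | 0 < q.2}) ∧
    (∀ x : D, c (x, ∞) = x) ∧
    ∀ (x : D) (s : ℝ≥0∞) (t : ℝ≥0), Ψ t (c (x, s + t)) = c (x, s)

end Coorientation

/-! The mapping torus fails to be compact only along the ends of `Γ`, and there the semiflow is a
product. Far out near an attracting end `g` is an injective cellular self-map of a subgraph, so
distinct flow lines run off to infinity without merging. Near a repelling end a branch `θ` of the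
inverse of `g` has the same property, and the flow lines come in from infinity. `W` arises by adding
one point at infinity to each of these flow lines, that is, by compactifying collars `B × [0, ∞)` to
`B × [0, ∞]`. Squeezing `[0, ∞]` to `[0, 1]` identifies `W` with a truncated mapping torus inside
the original one. Interpolating between the squeezing and the identity shows that the embedding is a
homotopy equivalence. The semiflow is translation on the collars, so it extends by fixing the added
points.

The graph theory makes "far out" precise. By a König argument (`cellFinite_compl_of_isEndBasis`) the
neighborhoods of the ends leave out only finitely many cells. `exists_endDecomposition` extracts
subgraphs `Gp` and `Gm`, invariant under `g` and `θ` respectively, each with a fundamental domain of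
finitely many cells and with cell-finite complement of their union. Time near the ends is measured
by continuous heights that drop by one under the shift (`exists_isHeight`); they define `exitTime`
and `entryTime` on the mapping torus. The level `1` of either time is compact, and flowing from it
or towards it gives the collars (`exists_collar_left`, `exists_collar_right`).

For the CW structure, the region where both times are nonnegative is the union of panels (cell) ×
`[0, 1]` over the finitely many cells of `block`. The heights of vertices are integers, so the flow
lines above vertices can be cut at integral times. The sides of the panels then run along these cut
lines, their corners are among the cutting points, and the top of a panel lies in the cut level or
at the bottom of other panels. This is `sphere_pieceMap`, the core of `cellSystem`. The levels zero
of the two times are unions of tops and of bottoms of panels, hence subcomplexes. -/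

/-! ### Cells and subgraphs -/

namespace GraphCells

section Cells

variable {Γ : Type u} [TopologicalSpace Γ] [CWComplex (univ : Set Γ)]

/-- The cells of `Γ`, of all dimensions. -/
abbrev Cell (Γ : Type u) [TopologicalSpace Γ] [CWComplex (univ : Set Γ)] : Type u :=
  Σ n, RelCWComplex.cell (univ : Set Γ) n

/-- The open cell with index `c`. -/
def oc (c : Cell Γ) : Set Γ := RelCWComplex.openCell c.1 c.2

/-- The closed cell with index `c`. -/
def cc (c : Cell Γ) : Set Γ := RelCWComplex.closedCell c.1 c.2

lemma exists_mem_oc (x : Γ) : ∃ c : Cell Γ, x ∈ oc c := by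
  have h : x ∈ ⋃ (n : ℕ) (j : RelCWComplex.cell (univ : Set Γ) n),
      RelCWComplex.openCell (C := (univ : Set Γ)) n j := by
    rw [CWComplex.iUnion_openCell_eq_complex]; trivial
  simp only [mem_iUnion] at h
  obtain ⟨n, j, h⟩ := h
  exact ⟨⟨n, j⟩, h⟩

/-- The cell whose open cell contains `x`. -/
noncomputable def cellOf (x : Γ) : Cell Γ := (exists_mem_oc x).choose

lemma mem_oc_cellOf (x : Γ) : x ∈ oc (cellOf x) := (exists_mem_oc x).choose_spec

lemma oc_eq_of_mem {x : Γ} {c d : Cell Γ} (hc : x ∈ oc c) (hd : x ∈ oc d) : c = d :=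
  RelCWComplex.eq_of_not_disjoint_openCell (not_disjoint_iff.2 ⟨x, hc, hd⟩)

lemma cellOf_eq {x : Γ} {c : Cell Γ} (h : x ∈ oc c) : cellOf x = c :=
  oc_eq_of_mem (mem_oc_cellOf x) h

lemma oc_subset_cc (c : Cell Γ) : oc c ⊆ cc c := RelCWComplex.openCell_subset_closedCell _ _

lemma mem_cc_cellOf (x : Γ) : x ∈ cc (cellOf x) := oc_subset_cc _ (mem_oc_cellOf x)

lemma oc_nonempty (c : Cell Γ) : (oc c).Nonempty := RelCWComplex.openCell_nonempty _ _

lemma isCompact_cc (c : Cell Γ) : IsCompact (cc c) := RelCWComplex.isCompact_closedCell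

lemma isPreconnected_oc (c : Cell Γ) : IsPreconnected (oc c) :=
  ((convex_ball _ _).isPreconnected).image _
    ((RelCWComplex.continuousOn c.1 c.2).mono Metric.ball_subset_closedBall)

lemma eq_of_mem_cc_vertex {x y : Γ} {c : Cell Γ} (hc : c.1 = 0) (hx : x ∈ cc c) (hy : y ∈ cc c) :
    x = y := by
  obtain ⟨n, c⟩ := c
  obtain rfl : n = 0 := hc
  simp only [cc, RelCWComplex.closedCell_zero_eq_singleton, mem_singleton_iff] at hx hy
  rw [hx, hy]

lemma cc_eq_oc_of_vertex {c : Cell Γ} (hc : c.1 = 0) : cc c = oc c := by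
  obtain ⟨x, hx⟩ := oc_nonempty c
  refine subset_antisymm (fun y hy ↦ ?_) (oc_subset_cc c)
  rw [eq_of_mem_cc_vertex hc hy (oc_subset_cc c hx)]
  exact hx

lemma mem_vertexSet_iff {x : Γ} : x ∈ vertexSet Γ ↔ (cellOf x).1 = 0 := by
  simp only [vertexSet, mem_iUnion]
  constructor
  · rintro ⟨v, hv⟩
    rw [cellOf_eq (c := ⟨0, v⟩) (by rw [← cc_eq_oc_of_vertex (c := ⟨0, v⟩) rfl]; exact hv)]
  · intro h
    have := mem_cc_cellOf x
    revert this h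
    generalize cellOf x = d
    intro h h'
    obtain ⟨n, d⟩ := d
    obtain rfl : n = 0 := h
    exact ⟨d, h'⟩

lemma exists_edge {c : Cell Γ} (hc : c.1 = 1) :
    ∃ e : RelCWComplex.cell (univ : Set Γ) 1, c = ⟨1, e⟩ := by
  obtain ⟨n, c⟩ := c
  obtain rfl : n = 1 := hc
  exact ⟨c, rfl⟩

lemma IsGraph.dim (hΓ : IsGraph Γ) (c : Cell Γ) : c.1 = 0 ∨ c.1 = 1 := by
  by_contra h
  exact (hΓ.isEmpty_cell c.1 (by omega)).false c.2

lemma cellOf_of_mem_cellFrontier (hΓ : IsGraph Γ) {x : Γ} {c : Cell Γ}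
    (hx : x ∈ RelCWComplex.cellFrontier (C := (univ : Set Γ)) c.1 c.2) :
    c.1 = 1 ∧ (cellOf x).1 = 0 := by
  rcases IsGraph.dim hΓ c with hc | hc
  · obtain ⟨n, c⟩ := c
    obtain rfl : n = 0 := hc
    rw [RelCWComplex.cellFrontier_zero_eq_empty] at hx
    exact hx.elim
  · obtain ⟨e, rfl⟩ := exists_edge hc
    refine ⟨rfl, ?_⟩
    obtain ⟨a, b, hab⟩ := CWComplex.exists_cellFrontier_one_eq e
    change x ∈ RelCWComplex.cellFrontier 1 e at hx
    rw [hab] at hx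
    rw [← mem_vertexSet_iff]
    rcases hx with hx | hx
    · exact mem_iUnion.2 ⟨_, hx⟩
    · exact mem_iUnion.2 ⟨_, hx⟩

/-- A point of a closed cell lies in the open cell or is a vertex. -/
lemma mem_cc (hΓ : IsGraph Γ) {x : Γ} {c : Cell Γ} (hx : x ∈ cc c) :
    x ∈ oc c ∨ (cellOf x).1 = 0 := by
  rw [cc, ← RelCWComplex.cellFrontier_union_openCell_eq_closedCell] at hx
  exact hx.symm.imp id fun h ↦ (cellOf_of_mem_cellFrontier hΓ h).2

lemma cc_cellOf_vertex {x : Γ} (hx : (cellOf x).1 = 0) : cc (cellOf x) = {x} :=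
  subset_antisymm (fun _ hy ↦ eq_of_mem_cc_vertex hx hy (mem_cc_cellOf x))
    (singleton_subset_iff.2 (mem_cc_cellOf x))

/-- Closed cells are closed under passing to faces. -/
lemma cc_cellOf_subset (hΓ : IsGraph Γ) {x : Γ} {c : Cell Γ} (hx : x ∈ cc c) :
    cc (cellOf x) ⊆ cc c := by
  rcases mem_cc hΓ hx with h | h
  · rw [cellOf_eq h]
  · rw [cc_cellOf_vertex h]; exact singleton_subset_iff.2 hx

/-- A set containing, with each point `x`, the whole closed cell of `x`. -/
def IsSubgraph (X : Set Γ) : Prop := ∀ x ∈ X, cc (cellOf x) ⊆ X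

/-- A set which meets only finitely many open cells. -/
def CellFinite (X : Set Γ) : Prop := (cellOf '' X).Finite

lemma CellFinite.mono {X Y : Set Γ} (hY : CellFinite Y) (h : X ⊆ Y) : CellFinite X :=
  hY.subset (image_mono h)

lemma CellFinite.union {X Y : Set Γ} (hX : CellFinite X) (hY : CellFinite Y) :
    CellFinite (X ∪ Y) := by
  rw [CellFinite, image_union]; exact Finite.union hX hY

lemma CellFinite.biUnion {ι : Type*} {s : Set ι} (hs : s.Finite) {X : ι → Set Γ}
    (h : ∀ i ∈ s, CellFinite (X i)) : CellFinite (⋃ i ∈ s, X i) := by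
  rw [CellFinite, image_iUnion₂]; exact hs.biUnion h

lemma IsSubgraph.biUnion {ι : Type*} {s : Set ι} {X : ι → Set Γ}
    (h : ∀ i ∈ s, IsSubgraph (X i)) : IsSubgraph (⋃ i ∈ s, X i) := by
  intro x hx
  simp only [mem_iUnion] at hx
  obtain ⟨i, hi, hx⟩ := hx
  exact (h i hi x hx).trans (subset_biUnion_of_mem hi)

lemma isSubgraph_cc (hΓ : IsGraph Γ) (c : Cell Γ) : IsSubgraph (cc c) :=
  fun _ hx ↦ cc_cellOf_subset hΓ hx

lemma CellFinite.finite_vertices {X : Set Γ} (h : CellFinite X) (hX : ∀ x ∈ X, (cellOf x).1 = 0) :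
    X.Finite := by
  refine Finite.of_finite_image h ?_
  intro x hx y hy hxy
  exact eq_of_mem_cc_vertex (hX x hx) (mem_cc_cellOf x) (hxy ▸ mem_cc_cellOf y)

/-- The largest subgraph contained in `U`. -/
def core (U : Set Γ) : Set Γ := {x | cc (cellOf x) ⊆ U}

lemma core_subset (U : Set Γ) : core U ⊆ U := fun x hx ↦ hx (mem_cc_cellOf x)

lemma isSubgraph_core (hΓ : IsGraph Γ) (U : Set Γ) : IsSubgraph (core U) :=
  fun _ hx _ hy ↦ (cc_cellOf_subset hΓ hy).trans hx

lemma IsSubgraph.oc_subset {X : Set Γ} (hX : IsSubgraph X) {x : Γ} (hx : x ∈ X) :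
    oc (cellOf x) ⊆ X := (oc_subset_cc _).trans (hX x hx)

lemma core_mono {U V : Set Γ} (h : U ⊆ V) : core U ⊆ core V := fun _ hx ↦ hx.trans h

/-- Local finiteness of the cells enters here: a compact set meets only finitely many closed cells.
With `CellFinite.exists_compact`, the cell-finite sets are exactly the subsets of compact sets, so
continuous maps preserve them. -/
lemma CellFinite.of_meets (hΓ : IsGraph Γ) {X C : Set Γ} (hC : IsCompact C)
    (h : ∀ x ∈ X, (cc (cellOf x) ∩ C).Nonempty) : CellFinite X := by
  refine (hΓ.locallyFinite.finite_nonempty_inter_compact hC).subset ?_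
  rintro _ ⟨x, hx, rfl⟩
  exact h x hx

lemma CellFinite.exists_compact (hΓ : IsGraph Γ) {X : Set Γ} (hX : CellFinite X) :
    ∃ C, IsCompact C ∧ IsSubgraph C ∧ X ⊆ C := by
  refine ⟨⋃ c ∈ cellOf '' X, cc c, hX.isCompact_biUnion fun c _ ↦ isCompact_cc c,
    IsSubgraph.biUnion fun c _ ↦ isSubgraph_cc hΓ c, fun x hx ↦ ?_⟩
  exact mem_biUnion (mem_image_of_mem _ hx) (mem_cc_cellOf x)

lemma CellFinite.of_subset_compact (hΓ : IsGraph Γ) {X C : Set Γ} (hC : IsCompact C)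
    (h : X ⊆ C) : CellFinite X :=
  CellFinite.of_meets hΓ hC fun x hx ↦ ⟨x, mem_cc_cellOf x, h hx⟩

lemma CellFinite.image (hΓ : IsGraph Γ) {X : Set Γ} (hX : CellFinite X) {f : Γ → Γ}
    (hf : Continuous f) : CellFinite (f '' X) := by
  obtain ⟨C, hC, -, hXC⟩ := hX.exists_compact hΓ
  exact CellFinite.of_subset_compact hΓ (hC.image hf) (image_mono hXC)

variable [T2Space Γ]

lemma isClosed_cc (c : Cell Γ) : IsClosed (cc c) := (isCompact_cc c).isClosed

lemma closure_oc (c : Cell Γ) : closure (oc c) = cc c :=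
  RelCWComplex.closure_openCell_eq_closedCell

/-- A union of a locally finite family of closed cells is closed. -/
lemma IsSubgraph.isClosed {X : Set Γ} (hΓ : IsGraph Γ) (hX : IsSubgraph X) : IsClosed X := by
  have : X = ⋃ c : {c : Cell Γ // cc c ⊆ X}, cc c.1 := by
    ext x
    simp only [mem_iUnion]
    exact ⟨fun hx ↦ ⟨⟨cellOf x, hX x hx⟩, mem_cc_cellOf x⟩, fun ⟨c, hc⟩ ↦ c.2 hc⟩
  rw [this]
  exact (hΓ.locallyFinite.comp_injective Subtype.val_injective).isClosed_iUnion
    fun c ↦ isClosed_cc c.1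

/-- The frontier of an edge consists of vertices, so each closed cell is itself a subcomplex. The
largest subgraph can therefore be tested one closed cell at a time. -/
lemma largestSubgraph_eq_core (hΓ : IsGraph Γ) (U : Set Γ) : largestSubgraph U = core U := by
  ext x
  simp only [largestSubgraph, mem_iUnion, exists_prop]
  constructor
  · rintro ⟨S, hS, hx⟩
    have hi : (cellOf x).2 ∈ S.I (cellOf x).1 := by
      by_contra h
      exact (RelCWComplex.Subcomplex.disjoint_openCell_subcomplex_of_not_mem S h).notMem_of_mem_left
        (mem_oc_cellOf x) hx
    exact (RelCWComplex.Subcomplex.closedCell_subset_of_mem S hi).trans hS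
  · intro hx
    refine ⟨⟨cc (cellOf x), fun n ↦ {c | oc (⟨n, c⟩ : Cell Γ) ⊆ cc (cellOf x)},
      isClosed_cc _, ?_⟩, hx, mem_cc_cellOf x⟩
    rw [empty_union]
    apply subset_antisymm
    · exact iUnion_subset fun n ↦ iUnion_subset fun c ↦ c.2
    · intro y hy
      simp only [mem_iUnion]
      exact ⟨(cellOf y).1, ⟨(cellOf y).2, (oc_subset_cc _).trans (cc_cellOf_subset hΓ hy)⟩,
        mem_oc_cellOf y⟩

end Cells

end GraphCells

/-! ### Complements of neighborhoods of all the ends -/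

namespace GraphCells

section EndsOfGraphs

variable {Γ : Type u} [TopologicalSpace Γ] [CWComplex (univ : Set Γ)]

/-- The open star of `x`. -/
def openStar (x : Γ) : Set Γ := {y | x ∈ cc (cellOf y)}

lemma mem_openStar_self (x : Γ) : x ∈ openStar x := mem_cc_cellOf x

lemma openStar_subset_compl {K : Set Γ} (hK : IsSubgraph K) {x : Γ} (hx : x ∉ K) :
    openStar x ⊆ Kᶜ := fun _ hy hyK ↦ hx (hK _ hyK hy)

lemma oc_subset_openStar {x y : Γ} (hy : y ∈ openStar x) : oc (cellOf y) ⊆ openStar x := by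
  intro z hz
  change x ∈ cc (cellOf z)
  rwa [cellOf_eq hz]

variable [T2Space Γ]

lemma isOpen_openStar (hΓ : IsGraph Γ) (x : Γ) : IsOpen (openStar x) := by
  have : IsSubgraph (openStar x)ᶜ := fun y hy z hz hzx ↦
    hy (cc_cellOf_subset hΓ hz hzx)
  rw [← isClosed_compl_iff]
  exact this.isClosed hΓ

/-- Adding `x` to an open cell of the star gives a set between the cell and its closure, hence a
connected one, and all these sets share `x`. -/
lemma isPreconnected_openStar (x : Γ) : IsPreconnected (openStar x) := by
  have : openStar x = ⋃ y : openStar x, insert x (oc (cellOf (y : Γ))) := by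
    apply subset_antisymm
    · exact fun y hy ↦ mem_iUnion.2 ⟨⟨y, hy⟩, mem_insert_of_mem _ (mem_oc_cellOf y)⟩
    · exact iUnion_subset fun y ↦
        insert_subset (mem_openStar_self x) (oc_subset_openStar y.2)
  rw [this]
  refine isPreconnected_iUnion ⟨x, mem_iInter.2 fun y ↦ mem_insert _ _⟩ fun ⟨y, hy⟩ ↦ ?_
  refine (isPreconnected_oc (cellOf y)).subset_closure (subset_insert _ _) ?_
  rw [closure_oc]
  exact insert_subset hy (oc_subset_cc _)

lemma isOpen_connectedComponentIn_compl (hΓ : IsGraph Γ) {K : Set Γ} (hK : IsSubgraph K) (x : Γ) :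
    IsOpen (connectedComponentIn Kᶜ x) := by
  refine isOpen_iff_forall_mem_open.2 fun y hy ↦ ⟨openStar y, ?_, isOpen_openStar hΓ y,
    mem_openStar_self y⟩
  rw [connectedComponentIn_eq hy]
  exact (isPreconnected_openStar y).subset_connectedComponentIn (mem_openStar_self y)
    (openStar_subset_compl hK (connectedComponentIn_subset _ _ hy))

/-- A component of the complement of a subgraph `K` meets every neighborhood of `K`. -/
lemma connectedComponentIn_inter_nonempty [ConnectedSpace Γ] (hΓ : IsGraph Γ) {K K' : Set Γ}
    (hK : IsSubgraph K) (hKn : K.Nonempty) (hKK' : K ⊆ interior K') {x : Γ} (hx : x ∉ K) :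
    (connectedComponentIn Kᶜ x ∩ K').Nonempty := by
  by_contra h
  rw [not_nonempty_iff_eq_empty, ← disjoint_iff_inter_eq_empty] at h
  have hxC : x ∈ connectedComponentIn Kᶜ x := mem_connectedComponentIn hx
  -- A component missing `K'` would be clopen: `interior K'` is a neighborhood of the points of `K`
  -- that avoids it, and the other components of `Kᶜ` are open. Connectedness then makes it
  -- everything, contradicting `K ≠ ∅`.
  have hclosed : IsClosed (connectedComponentIn Kᶜ x) := by
    rw [← isOpen_compl_iff, isOpen_iff_forall_mem_open]
    intro y hy
    by_cases hyK : y ∈ K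
    · exact ⟨interior K', fun z hz hz' ↦ h.notMem_of_mem_left hz' (interior_subset hz),
        isOpen_interior, hKK' hyK⟩
    · refine ⟨connectedComponentIn Kᶜ y, fun z hz hz' ↦ hy ?_,
        isOpen_connectedComponentIn_compl hΓ hK y, mem_connectedComponentIn hyK⟩
      rw [connectedComponentIn_eq hz', ← connectedComponentIn_eq hz]
      exact mem_connectedComponentIn hyK
  have huniv := IsClopen.eq_univ ⟨hclosed, isOpen_connectedComponentIn_compl hΓ hK x⟩ ⟨x, hxC⟩
  obtain ⟨k, hk⟩ := hKn
  have hkC : k ∈ connectedComponentIn Kᶜ x := by rw [huniv]; trivial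
  exact connectedComponentIn_subset _ _ hkC hk

/-- A connected graph is exhausted by finite subgraphs, each of them interior to the next. -/
lemma exists_exhaustion [ConnectedSpace Γ] (hΓ : IsGraph Γ) :
    ∃ K : ℕ → Set Γ, Monotone K ∧ (∀ n, IsCompact (K n)) ∧ (∀ n, IsSubgraph (K n)) ∧
      (∀ n, (K n).Nonempty) ∧ (∀ n, K n ⊆ interior (K (n + 1))) ∧ ∀ x, ∃ n, x ∈ K n := by
  let step : Set Γ → Set Γ := fun A ↦ ⋃ c ∈ {c : Cell Γ | (cc c ∩ A).Nonempty}, cc c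
  obtain ⟨x₀⟩ : Nonempty Γ := inferInstance
  let K : ℕ → Set Γ := fun n ↦ step^[n] (cc (cellOf x₀))
  have hs : ∀ n, K (n + 1) = step (K n) := fun n ↦ Function.iterate_succ_apply' _ _ _
  have hc : ∀ n, IsCompact (K n) := by
    intro n
    induction n with
    | zero => exact isCompact_cc _
    | succ n ih =>
      rw [hs]
      exact (hΓ.locallyFinite.finite_nonempty_inter_compact ih).isCompact_biUnion
        fun c _ ↦ isCompact_cc c
  have hsub : ∀ n, IsSubgraph (K n) := by
    intro n
    cases n with
    | zero => exact isSubgraph_cc hΓ _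
    | succ n => rw [hs]; exact IsSubgraph.biUnion fun c _ ↦ isSubgraph_cc hΓ c
  have hint : ∀ n, K n ⊆ interior (K (n + 1)) := by
    intro n x hx
    refine mem_interior.2 ⟨openStar x, fun y hy ↦ ?_, isOpen_openStar hΓ x, mem_openStar_self x⟩
    rw [hs]
    exact mem_biUnion (show (cc (cellOf y) ∩ K n).Nonempty from ⟨x, hy, hx⟩) (mem_cc_cellOf y)
  have hmono : Monotone K := monotone_nat_of_le_succ fun n ↦ (hint n).trans interior_subset
  have h0 : x₀ ∈ K 0 := mem_cc_cellOf x₀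
  refine ⟨K, hmono, hc, hsub, fun n ↦ ⟨x₀, hmono (Nat.zero_le n) h0⟩, hint, ?_⟩
  have huniv : (⋃ n, K n) = univ := by
    refine IsClopen.eq_univ ⟨?_, ?_⟩ ⟨x₀, mem_iUnion.2 ⟨0, h0⟩⟩
    · refine IsSubgraph.isClosed hΓ ?_
      simpa using IsSubgraph.biUnion (s := (univ : Set ℕ)) (X := K) fun n _ ↦ hsub n
    · rw [isOpen_iff_mem_nhds]
      intro x hx
      obtain ⟨n, hn⟩ := mem_iUnion.1 hx
      exact Filter.mem_of_superset (mem_interior_iff_mem_nhds.1 (hint n hn))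
        (subset_iUnion K (n + 1))
  intro x
  exact mem_iUnion.1 (huniv ▸ mem_univ x)

/-- The complement of a finite subgraph has only finitely many components. -/
lemma finite_components [ConnectedSpace Γ] (hΓ : IsGraph Γ) {K K' : Set Γ}
    (hK : IsSubgraph K) (hKn : K.Nonempty) (hK' : IsCompact K') (hKK' : K ⊆ interior K') :
    {C | ∃ x ∉ K, C = connectedComponentIn Kᶜ x}.Finite := by
  have hfin : (cellOf '' K').Finite := CellFinite.of_subset_compact hΓ hK' subset_rfl
  -- Every component meets `K'`, hence contains an open cell meeting `K'`, and this cell determines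
  -- the component.
  refine (hfin.image fun c ↦ connectedComponentIn Kᶜ (oc_nonempty c).some).subset ?_
  rintro _ ⟨x, hx, rfl⟩
  obtain ⟨z, hzC, hzK'⟩ := connectedComponentIn_inter_nonempty hΓ hK hKn hKK' hx
  refine ⟨cellOf z, mem_image_of_mem _ hzK', ?_⟩
  have hzK : z ∉ K := connectedComponentIn_subset _ _ hzC
  have hsub : oc (cellOf z) ⊆ Kᶜ := fun y hy hyK ↦ by
    have := hK.oc_subset hyK
    rw [cellOf_eq hy] at this
    exact hzK (this (mem_oc_cellOf z))
  have h := (isPreconnected_oc (cellOf z)).subset_connectedComponentIn (mem_oc_cellOf z) hsub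
    (oc_nonempty (cellOf z)).some_mem
  change connectedComponentIn Kᶜ _ = _
  rw [← connectedComponentIn_eq h, ← connectedComponentIn_eq hzC]

/-- If `O` contains a term of every neighborhood basis of every end, then only finitely many cells
of the graph are not contained in `O`. -/
theorem cellFinite_compl_of_isEndBasis [ConnectedSpace Γ] (hΓ : IsGraph Γ) {O : Set Γ}
    (hO : ∀ B : ℕ → Set Γ, IsEndBasis B → ∃ n, B n ⊆ O) : CellFinite Oᶜ := by
  obtain ⟨K, hmono, hc, hsub, hne, hint, hcov⟩ := exists_exhaustion hΓ
  by_contra hinf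
  let comp : ℕ → Γ → Set Γ := fun n x ↦ connectedComponentIn (K n)ᶜ x
  -- Pigeonhole for König's lemma: if no `K m` contains `Y`, then the same holds for the part of `Y`
  -- in one of the finitely many components of the complement of `K n`.
  have key : ∀ (n : ℕ) (Y : Set Γ), (∀ m, ¬ Y ⊆ K m) →
      ∃ x ∈ Y, x ∉ K n ∧ ∀ m, ¬ comp n x ∩ Y ⊆ K m := by
    intro n Y hY
    by_contra! h
    choose! f hf using h
    have hfin := finite_components hΓ (hsub n) (hne n) (hc (n + 1)) (hint n)
    have hex : ∀ C ∈ {C | ∃ x ∉ K n, C = connectedComponentIn (K n)ᶜ x},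
        ∃ m, C ∩ Y ⊆ K m := by
      rintro _ ⟨x, hx, rfl⟩
      by_cases hxY : (comp n x ∩ Y).Nonempty
      · obtain ⟨y, hy, hyY⟩ := hxY
        refine ⟨f y, ?_⟩
        have := hf y hyY (connectedComponentIn_subset _ _ hy)
        rwa [show comp n y = connectedComponentIn (K n)ᶜ x from
          (connectedComponentIn_eq hy).symm] at this
      · exact ⟨0, fun y hy ↦ (hxY ⟨y, hy⟩).elim⟩
    choose! m hm using hex
    obtain ⟨M, hM⟩ := (hfin.image m).bddAbove
    refine hY (max n M) fun y hy ↦ ?_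
    by_cases hyn : y ∈ K n
    · exact hmono (le_max_left _ _) hyn
    · have hmem : comp n y ∈ {C | ∃ x ∉ K n, C = connectedComponentIn (K n)ᶜ x} := ⟨y, hyn, rfl⟩
      exact hmono ((hM (mem_image_of_mem m hmem)).trans (le_max_right _ _))
        (hm _ hmem ⟨mem_connectedComponentIn hyn, hy⟩)
  have hOc : ∀ m, ¬ Oᶜ ⊆ K m := fun m h ↦ hinf (CellFinite.of_subset_compact hΓ (hc m) h)
  let good : ℕ → Γ → Prop := fun n x ↦ x ∉ K n ∧ ∀ m, ¬ comp n x ∩ Oᶜ ⊆ K m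
  -- Iterating the choice gives nested components, each containing an unbounded part of `Oᶜ`. They
  -- form an end basis none of whose terms lies in `O`.
  have hstep : ∀ n x, good n x → ∃ y, good (n + 1) y ∧ comp (n + 1) y ⊆ comp n x := by
    intro n x hx
    obtain ⟨y, ⟨hyx, -⟩, hyK, hy⟩ := key (n + 1) (comp n x ∩ Oᶜ) hx.2
    refine ⟨y, ⟨hyK, fun m h ↦ hy m fun z hz ↦ h ⟨hz.1, hz.2.2⟩⟩, ?_⟩
    change connectedComponentIn _ y ⊆ connectedComponentIn _ x
    rw [connectedComponentIn_eq hyx]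
    exact connectedComponentIn_mono _ (compl_subset_compl.2 (hmono n.le_succ))
  obtain ⟨x₀, -, hx₀⟩ := key 0 Oᶜ hOc
  choose! next hnext using hstep
  let xs : ℕ → Γ := fun n ↦ Nat.rec x₀ (fun n x ↦ next n x) n
  have hxs : ∀ n, good n (xs n) := by
    intro n
    induction n with
    | zero => exact hx₀
    | succ n ih => exact (hnext n _ ih).1
  have hB : IsEndBasis fun n ↦ comp n (xs n) := by
    refine ⟨antitone_nat_of_succ_le fun n ↦ (hnext n _ (hxs n)).2, K, hmono, hc, fun x ↦ ?_,
      fun n ↦ ⟨xs n, (hxs n).1, rfl⟩⟩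
    obtain ⟨n, hn⟩ := hcov x
    exact ⟨n + 1, hint n hn⟩
  obtain ⟨n, hn⟩ := hO _ hB
  exact (hxs n).2 0 fun y hy ↦ (hy.2 (hn hy.1)).elim

/-- The terms of a neighborhood basis of an end eventually miss each compact set. -/
lemma _root_.IsEndBasis.eventually_disjoint {X : Type*} [TopologicalSpace X] {B : ℕ → Set X}
    (hB : IsEndBasis B) {C : Set X} (hC : IsCompact C) : ∃ N, ∀ n ≥ N, Disjoint (B n) C := by
  obtain ⟨-, K, hmono, -, hcov, hK⟩ := hB
  obtain ⟨N, hN⟩ := hC.elim_directed_cover (fun n ↦ interior (K n)) (fun _ ↦ isOpen_interior)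
    (fun x _ ↦ mem_iUnion.2 (hcov x))
    (directed_of_isDirected_le fun m n h ↦ interior_mono (hmono h))
  refine ⟨N, fun n hn ↦ disjoint_left.2 fun x hx hxC ↦ ?_⟩
  obtain ⟨y, -, hy⟩ := hK n
  rw [hy] at hx
  exact connectedComponentIn_subset _ _ hx (hmono hn (interior_subset (hN hxC)))

end EndsOfGraphs

end GraphCells

/-! ### Invariant subgraphs at the ends -/

namespace GraphCells

open Filter

section Shifts

variable {Γ : Type u} [TopologicalSpace Γ] [CWComplex (univ : Set Γ)]

/-- `θ` is an injective cellular map of the subgraph `G` into itself, whose iterated images have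
empty intersection and whose image omits only finitely many cells. -/
structure Shift (G : Set Γ) (θ : Γ → Γ) : Prop where
  subgraph : IsSubgraph G
  mapsTo : MapsTo θ G G
  injOn : InjOn θ G
  continuousOn : ContinuousOn θ G
  image_oc : ∀ x ∈ G, θ '' oc (cellOf x) = oc (cellOf (θ x))
  dim : ∀ x ∈ G, (cellOf (θ x)).1 = (cellOf x).1
  finite : CellFinite (G \ θ '' G)
  escape : ∀ x ∈ G, ∃ n, x ∉ θ^[n] '' G

/-- The map `g` carries the cells of the subgraph `L`, which contains all but finitely many cells,
homeomorphically to cells. -/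
structure CellularOn (g : Γ → Γ) (L : Set Γ) : Prop where
  continuous : Continuous g
  subgraph : IsSubgraph L
  cofinite : CellFinite Lᶜ
  isEmbedding : IsEmbedding (L.domRestrict g)
  image_oc : ∀ x ∈ L, g '' oc (cellOf x) = oc (cellOf (g x))
  dim : ∀ x ∈ L, (cellOf (g x)).1 = (cellOf x).1

lemma CellularOn.injOn {g : Γ → Γ} {L : Set Γ} (h : CellularOn g L) : InjOn g L :=
  injOn_iff_injective.2 h.isEmbedding.injective

/-- Under iteration of `g`, the set `P` escapes to infinity in forward time and `Q` in
backward time. -/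
structure Escapes (g : Γ → Γ) (P Q : Set Γ) : Prop where
  mapsTo : ∀ x ∈ P, g x ∈ P
  of_map_mem : ∀ x, g x ∈ Q → x ∈ Q
  forward : ∀ C, IsCompact C → ∀ᶠ n in atTop, Disjoint (g^[n] '' P) C
  backward : ∀ C, IsCompact C → ∀ᶠ n in atTop, Disjoint (g^[n] ⁻¹' Q) C
  disjoint : Disjoint P Q
  cofinite : ∀ n m, CellFinite (g^[n] '' P ∪ g^[m] ⁻¹' Q)ᶜ

/-- If some power of `g` nests `P` and `Q`, then subsets of them are nested by `g` itself. -/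
lemma exists_escapes_of_iterate {g : Γ → Γ} (hΓ : IsGraph Γ)
    (hg : Continuous g) {p : ℕ} (hp : 0 < p) {P Q K : Set Γ} (hK : IsCompact K)
    (hforward : ∀ C, IsCompact C → ∀ᶠ n in atTop, Disjoint (g^[p * n] '' P) C)
    (hbackward : ∀ C, IsCompact C → ∀ᶠ n in atTop, Disjoint (g^[p * n] ⁻¹' Q) C)
    (hdisj : Disjoint P Q) (hcof : ∀ n m, CellFinite (g^[p * n] '' P ∪ g^[p * m] ⁻¹' Q)ᶜ) :
    ∃ P' Q', Escapes g P' Q' ∧ Disjoint P' K ∧ Disjoint Q' K := by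
  have hfin : {i | i ≤ p}.Finite := finite_Iic p
  -- An exponent that is not a multiple of `p` is adjusted by at most `p` steps; moving `C` along by
  -- these steps keeps it compact.
  have hC' : ∀ C, IsCompact C → IsCompact (⋃ j ∈ {i | i ≤ p}, g^[j] '' C) := fun C hC ↦
    hfin.isCompact_biUnion fun j _ ↦ hC.image (hg.iterate j)
  have hF : ∀ C, IsCompact C → ∀ᶠ n in atTop, ∀ x ∈ P, g^[n] x ∉ C := by
    intro C hC
    obtain ⟨N, hN⟩ := eventually_atTop.1 (hforward _ (hC' C hC))
    refine eventually_atTop.2 ⟨p * N, fun i hi x hx hxC ↦ ?_⟩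
    have hdiv : N ≤ i / p := (Nat.le_div_iff_mul_le hp).2 (by rwa [mul_comm])
    refine (hN (i / p + 1) (by omega)).notMem_of_mem_left (mem_image_of_mem _ hx) ?_
    have hmod := Nat.mod_lt i hp
    have hi' : p * (i / p + 1) = (p - i % p) + i := by
      have := Nat.div_add_mod i p
      rw [mul_add, mul_one]; omega
    rw [hi', Function.iterate_add_apply]
    exact mem_biUnion (show p - i % p ≤ p by omega) (mem_image_of_mem _ hxC)
  have hB : ∀ C, IsCompact C → ∀ᶠ n in atTop, ∀ x ∈ C, g^[n] x ∉ Q := by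
    intro C hC
    obtain ⟨N, hN⟩ := eventually_atTop.1 (hbackward _ (hC' C hC))
    refine eventually_atTop.2 ⟨p * N, fun i hi x hx hxQ ↦ ?_⟩
    have hdiv : N ≤ i / p := (Nat.le_div_iff_mul_le hp).2 (by rwa [mul_comm])
    have hmem : g^[i % p] x ∈ ⋃ j ∈ {i | i ≤ p}, g^[j] '' C :=
      mem_biUnion (show i % p ≤ p from (Nat.mod_lt i hp).le) (mem_image_of_mem _ hx)
    refine (hN (i / p) hdiv).notMem_of_mem_left ?_ hmem
    rw [mem_preimage, ← Function.iterate_add_apply, Nat.div_add_mod]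
    exact hxQ
  -- Each `u ∈ P` is an image `g^[p * n] w` with `w` in `P \ g^[p] '' P`, which lies in a compact
  -- set. Orbits starting there avoid `Q` from a fixed time on, hence so do all orbits starting in
  -- `P`, uniformly.
  have hPQ : ∀ᶠ k in atTop, ∀ u ∈ P, g^[k] u ∉ Q := by
    have hfin : CellFinite (P \ g^[p] '' P) := by
      refine (hcof 1 0).mono fun x hx hx' ↦ ?_
      rcases hx' with h | h
      · exact hx.2 (by simpa using h)
      · exact hdisj.notMem_of_mem_left hx.1 (by simpa using h)
    obtain ⟨C, hC, -, hsub⟩ := hfin.exists_compact hΓ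
    obtain ⟨N, hN⟩ := eventually_atTop.1 (hB C hC)
    refine eventually_atTop.2 ⟨N, fun k hk u hu huQ ↦ ?_⟩
    have hex : ∃ n, u ∉ g^[p * n] '' P := by
      obtain ⟨n, hn⟩ := (hforward {u} isCompact_singleton).exists
      exact ⟨n, fun h ↦ hn.notMem_of_mem_left h rfl⟩
    classical
    obtain ⟨n, hn⟩ : ∃ n, Nat.find hex = n + 1 := Nat.exists_eq_succ_of_ne_zero fun h0 ↦ by
      have := Nat.find_spec hex
      rw [h0] at this
      exact this (by simpa using hu)
    obtain ⟨w, hw, hwu⟩ := not_not.1 (Nat.find_min hex (m := n) (by omega))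
    have hspec := Nat.find_spec hex
    rw [hn] at hspec
    have hwC : w ∈ C := hsub ⟨hw, fun ⟨v, hv, hvw⟩ ↦ hspec ⟨v, hv, by
      rw [mul_add, mul_one, Function.iterate_add_apply, hvw, hwu]⟩⟩
    refine hN (k + p * n) (by omega) w hwC ?_
    rwa [Function.iterate_add_apply, hwu]
  obtain ⟨M₁, h₁⟩ := eventually_atTop.1 (hF K hK)
  obtain ⟨M₂, h₂⟩ := eventually_atTop.1 (hB K hK)
  obtain ⟨M₃, h₃⟩ := eventually_atTop.1 hPQ
  let M := max M₁ (max M₂ M₃)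
  -- Taking all images of `P`, and all preimages of `Q`, under the iterates beyond `M` gives
  -- invariance under `g` itself. The three bounds in `M` keep the new sets away from `K` and from
  -- each other.
  refine ⟨{x | ∃ i ≥ M, ∃ u ∈ P, g^[i] u = x}, {x | ∃ i ≥ M, g^[i] x ∈ Q}, ⟨?_, ?_, ?_, ?_, ?_, ?_⟩,
    ?_, ?_⟩
  · rintro _ ⟨i, hi, u, hu, rfl⟩
    exact ⟨i + 1, by omega, u, hu, Function.iterate_succ_apply' _ _ _⟩
  · rintro x ⟨i, hi, hx⟩
    exact ⟨i + 1, by omega, hx⟩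
  · intro C hC
    obtain ⟨N, hN⟩ := eventually_atTop.1 (hF C hC)
    refine eventually_atTop.2 ⟨N, fun n hn ↦ disjoint_left.2 ?_⟩
    rintro _ ⟨_, ⟨i, hi, u, hu, rfl⟩, rfl⟩ hx
    rw [← Function.iterate_add_apply] at hx
    exact hN (n + i) (by omega) u hu hx
  · intro C hC
    obtain ⟨N, hN⟩ := eventually_atTop.1 (hB C hC)
    refine eventually_atTop.2 ⟨N, fun n hn ↦ disjoint_left.2 ?_⟩
    rintro x ⟨i, hi, hx⟩ hxC
    rw [← Function.iterate_add_apply] at hx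
    exact hN (i + n) (by omega) x hxC hx
  · refine disjoint_left.2 ?_
    rintro _ ⟨i, hi, u, hu, rfl⟩ ⟨j, hj, hx⟩
    rw [← Function.iterate_add_apply] at hx
    exact h₃ (j + i) (by have : M₃ ≤ M := by simp [M]
                         omega) u hu hx
  · intro n m
    refine (hcof (n + M) (m + M)).mono (compl_subset_compl.2 ?_)
    have hle : ∀ a, a ≤ p * a := fun a ↦ Nat.le_mul_of_pos_left a hp
    rintro x (⟨u, hu, rfl⟩ | hx)
    · left
      refine ⟨g^[p * (n + M) - n] u, ⟨_, ?_, u, hu, rfl⟩, ?_⟩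
      · have := hle (n + M); omega
      · rw [← Function.iterate_add_apply]
        have := hle (n + M)
        congr 1
        omega
    · right
      refine ⟨p * (m + M) - m, ?_, ?_⟩
      · have := hle (m + M); omega
      · rw [← Function.iterate_add_apply]
        have := hle (m + M)
        rw [show p * (m + M) - m + m = p * (m + M) by omega]
        exact hx
  · refine disjoint_left.2 ?_
    rintro _ ⟨i, hi, u, hu, rfl⟩
    exact h₁ i (by have : M₁ ≤ M := by simp [M]
                   omega) u hu
  · refine disjoint_left.2 ?_
    rintro x ⟨i, hi, hx⟩ hxK
    exact h₂ i (by have : M₂ ≤ M := by simp [M]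
                   omega) x hxK hx

lemma Escapes.iterate_mem {g : Γ → Γ} {P Q : Set Γ} (h : Escapes g P Q) {x : Γ} (hx : x ∈ P)
    (n : ℕ) : g^[n] x ∈ P := by
  induction n with
  | zero => exact hx
  | succ n ih => rw [Function.iterate_succ_apply']; exact h.mapsTo _ ih

lemma Escapes.of_iterate_mem {g : Γ → Γ} {P Q : Set Γ} (h : Escapes g P Q) {x : Γ} {n : ℕ}
    (hx : g^[n] x ∈ Q) : x ∈ Q := by
  induction n with
  | zero => exact hx
  | succ n ih => rw [Function.iterate_succ_apply'] at hx; exact ih (h.of_map_mem _ hx)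

lemma Escapes.cellFinite_diff_image {g : Γ → Γ} {P Q : Set Γ} (h : Escapes g P Q) :
    CellFinite (P \ g '' P) := by
  refine (h.cofinite 1 0).mono fun x hx hx' ↦ ?_
  rcases hx' with hx' | hx'
  · exact hx.2 hx'
  · exact h.disjoint.notMem_of_mem_left hx.1 hx'

lemma Escapes.cellFinite_diff_preimage {g : Γ → Γ} {P Q : Set Γ} (h : Escapes g P Q) (m : ℕ) :
    CellFinite (Q \ g^[m] ⁻¹' Q) := by
  refine (h.cofinite 0 m).mono fun x hx hx' ↦ ?_
  rcases hx' with hx' | hx'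
  · exact h.disjoint.notMem_of_mem_right hx.1 (by simpa using hx')
  · exact hx.2 hx'

/-- Every point of `P` is an iterated image of a point of the fundamental domain `P \ g P`. -/
lemma Escapes.exists_iterate_eq {g : Γ → Γ} {P Q : Set Γ} (h : Escapes g P Q) {y : Γ}
    (hy : y ∈ P) : ∃ n, ∃ w ∈ P \ g '' P, g^[n] w = y := by
  have hex : ∃ n, y ∉ g^[n] '' P := by
    obtain ⟨n, hn⟩ := (h.forward {y} isCompact_singleton).exists
    exact ⟨n, fun h ↦ hn.notMem_of_mem_left h rfl⟩
  classical
  obtain ⟨n, hn⟩ : ∃ n, Nat.find hex = n + 1 := Nat.exists_eq_succ_of_ne_zero fun h0 ↦ by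
    have := Nat.find_spec hex
    rw [h0] at this
    exact this (by simpa using hy)
  obtain ⟨w, hw, hwy⟩ := not_not.1 (Nat.find_min hex (m := n) (by omega))
  have hspec := Nat.find_spec hex
  rw [hn] at hspec
  exact ⟨n, w, ⟨hw, fun ⟨v, hv, hvw⟩ ↦ hspec ⟨v, hv, by
    rw [Function.iterate_add_apply, Function.iterate_one, hvw, hwy]⟩⟩, hwy⟩

/-- Every point of `Q` leaves `Q` under iteration. -/
lemma Escapes.exists_iterate_mem_diff {g : Γ → Γ} {P Q : Set Γ} (h : Escapes g P Q) {y : Γ}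
    (hy : y ∈ Q) : ∃ m, g^[m] y ∈ Q \ g ⁻¹' Q := by
  have hex : ∃ n, g^[n] y ∉ Q := by
    obtain ⟨n, hn⟩ := (h.backward {y} isCompact_singleton).exists
    exact ⟨n, fun h ↦ hn.notMem_of_mem_left h rfl⟩
  classical
  obtain ⟨n, hn⟩ : ∃ n, Nat.find hex = n + 1 := Nat.exists_eq_succ_of_ne_zero fun h0 ↦ by
    have := Nat.find_spec hex
    rw [h0] at this
    exact this (by simpa using hy)
  have hspec := Nat.find_spec hex
  rw [hn, Function.iterate_succ_apply'] at hspec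
  exact ⟨n, not_not.1 (Nat.find_min hex (m := n) (by omega)), hspec⟩

variable [T2Space Γ]

lemma CellularOn.image_cc {g : Γ → Γ} {L : Set Γ} (h : CellularOn g L) {x : Γ} (hx : x ∈ L) :
    g '' cc (cellOf x) = cc (cellOf (g x)) := by
  rw [← closure_oc (cellOf (g x)), ← h.image_oc x hx, ← closure_oc,
    image_closure_of_isCompact _ h.continuous.continuousOn]
  rw [closure_oc]
  exact isCompact_cc _

lemma CellularOn.isSubgraph_image {g : Γ → Γ} {L X : Set Γ} (h : CellularOn g L)
    (hX : IsSubgraph X) (hXL : X ⊆ L) : IsSubgraph (g '' X) := by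
  rintro _ ⟨x, hx, rfl⟩
  rw [← h.image_cc (hXL hx)]
  exact image_mono (hX x hx)

lemma CellularOn.iterate_image_cc {g : Γ → Γ} {L : Set Γ} (h : CellularOn g L) {x : Γ} (n : ℕ)
    (hx : ∀ i < n, g^[i] x ∈ L) : g^[n] '' cc (cellOf x) = cc (cellOf (g^[n] x)) := by
  induction n with
  | zero => simp
  | succ n ih =>
    rw [Function.iterate_succ', image_comp, ih fun i hi ↦ hx i (by omega),
      h.image_cc (hx n (by omega))]
    rfl

/-- Write `y = g^[n] w` with `w` in the fundamental domain. The closed cell of `w` is carried onto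
that of `y`, so if the latter meets `Q`, a point of a fixed compact set reaches `Q` in `n` steps,
which bounds `n`. -/
lemma Escapes.cellFinite_left {g : Γ → Γ} {P Q L : Set Γ} (hΓ : IsGraph Γ) (h : Escapes g P Q)
    (hg : CellularOn g L) (hP : P ⊆ L) : CellFinite {y ∈ P | (cc (cellOf y) ∩ Q).Nonempty} := by
  obtain ⟨C, hC, hCs, hsub⟩ := h.cellFinite_diff_image.exists_compact hΓ
  obtain ⟨N, hN⟩ := eventually_atTop.1 (h.backward C hC)
  refine (CellFinite.of_subset_compact hΓ ((finite_lt_nat N).isCompact_biUnion fun n _ ↦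
    hC.image (hg.continuous.iterate n)) ?_)
  rintro y ⟨hy, z, hz, hzQ⟩
  obtain ⟨n, w, hw, rfl⟩ := h.exists_iterate_eq hy
  rw [← hg.iterate_image_cc n fun i _ ↦ hP (h.iterate_mem hw.1 i)] at hz
  obtain ⟨v, hv, rfl⟩ := hz
  have hn : n < N := by
    by_contra hn
    exact (hN n (by omega)).notMem_of_mem_left hzQ (hCs _ (hsub hw) hv)
  exact mem_biUnion (show n ∈ {i | i < N} from hn) (mem_image_of_mem _ (hsub hw))

/-- Follow `y` to the last moment `m` before it leaves `Q`. Its closed cell is carried along, so a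
point of `P` in it lands in a fixed compact set after `m` steps, which bounds `m`. -/
lemma Escapes.cellFinite_right {g : Γ → Γ} {P Q L : Set Γ} (hΓ : IsGraph Γ) (h : Escapes g P Q)
    (hg : CellularOn g L) (hQ : Q ⊆ L) : CellFinite {y ∈ Q | (cc (cellOf y) ∩ P).Nonempty} := by
  have h1 := h.cellFinite_diff_preimage 1
  obtain ⟨C, hC, hCs, hsub⟩ := h1.exists_compact hΓ
  obtain ⟨N, hN⟩ := eventually_atTop.1 (h.forward C hC)
  refine (CellFinite.biUnion (finite_lt_nat N)
    fun m _ ↦ h.cellFinite_diff_preimage (m + 1)).mono ?_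
  rintro y ⟨hy, z, hz, hzP⟩
  obtain ⟨m, hm⟩ := h.exists_iterate_mem_diff hy
  have hz' : g^[m] z ∈ cc (cellOf (g^[m] y)) := by
    rw [← hg.iterate_image_cc m fun i hi ↦ hQ (h.of_iterate_mem (n := m - i) ?_)]
    · exact mem_image_of_mem _ hz
    · rw [← Function.iterate_add_apply, Nat.sub_add_cancel hi.le]
      exact hm.1
  have hn : m < N := by
    by_contra hn
    exact (hN m (by omega)).notMem_of_mem_left (mem_image_of_mem _ hzP) (hCs _ (hsub hm) hz')
  refine mem_biUnion (show m ∈ {i | i < N} from hn) ⟨hy, fun h' ↦ hm.2 ?_⟩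
  rwa [mem_preimage, Function.iterate_succ_apply'] at h'

/-- `P` need not be a subgraph. A closed cell which meets `P` but is not contained in it touches `Q`
or the cell-finite complement of `P ∪ Q`. -/
lemma Escapes.cellFinite_diff_core {g : Γ → Γ} {P Q L : Set Γ} (hΓ : IsGraph Γ)
    (h : Escapes g P Q) (hg : CellularOn g L) (hP : P ⊆ L) : CellFinite (P \ core P) := by
  obtain ⟨C, hC, -, hsub⟩ := (h.cofinite 0 0).exists_compact hΓ
  refine ((h.cellFinite_left hΓ hg hP).union (CellFinite.of_meets hΓ (X := {x ∈ P |
    (cc (cellOf x) ∩ C).Nonempty}) hC fun x hx ↦ hx.2)).mono ?_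
  rintro y ⟨hy, hyc⟩
  obtain ⟨z, hz, hzP⟩ := not_subset.1 hyc
  by_cases hzQ : z ∈ Q
  · exact Or.inl ⟨hy, z, hz, hzQ⟩
  · refine Or.inr ⟨hy, z, hz, hsub ?_⟩
    rintro (h' | h')
    · exact hzP (by simpa using h')
    · exact hzQ h'

/-- The part of the graph near the attracting ends. -/
theorem Escapes.exists_shift_left {g : Γ → Γ} {P Q L : Set Γ} (hΓ : IsGraph Γ) (h : Escapes g P Q)
    (hg : CellularOn g L) (hP : P ⊆ L) :
    ∃ G ⊆ P, Shift G g ∧ (∀ x ∉ G, g x ∉ g '' G) ∧ CellFinite (P \ G) := by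
  set S := core P with hS
  have hSP : S ⊆ P := core_subset P
  have hgS : MapsTo g S S := by
    intro x hx
    change cc (cellOf (g x)) ⊆ P
    rw [← hg.image_cc (hP (hSP hx))]
    rintro _ ⟨y, hy, rfl⟩
    exact h.mapsTo _ (hx hy)
  have hPS : CellFinite (P \ S) := h.cellFinite_diff_core hΓ hg hP
  have hSgS : CellFinite (S \ g '' S) := by
    refine (h.cellFinite_diff_image.union (hPS.image hΓ hg.continuous)).mono ?_
    rintro x ⟨hx, hx'⟩
    by_cases hxP : x ∈ g '' P
    · obtain ⟨y, hy, rfl⟩ := hxP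
      exact Or.inr ⟨y, ⟨hy, fun hyS ↦ hx' ⟨y, hyS, rfl⟩⟩, rfl⟩
    · exact Or.inl ⟨hSP hx, hxP⟩
  -- Points that enter `S` from outside are not controlled by injectivity on `L`. They come from `P
  -- \ S`, from `Q \ g ⁻¹' Q` or from outside of `P ∪ Q`, and all three sets are cell-finite.
  have hH : CellFinite (S ∩ g '' Sᶜ) := by
    refine (((hPS.union (h.cofinite 0 0)).union (h.cellFinite_diff_preimage 1)).image hΓ
      hg.continuous).mono ?_
    rintro _ ⟨hyS, y, hy, rfl⟩
    refine mem_image_of_mem _ ?_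
    by_cases hyP : y ∈ P
    · exact Or.inl (Or.inl ⟨hyP, hy⟩)
    · by_cases hyQ : y ∈ Q
      · exact Or.inr ⟨hyQ, fun h' ↦ h.disjoint.notMem_of_mem_left (hSP hyS) h'⟩
      · refine Or.inl (Or.inr ?_)
        rintro (h' | h')
        · exact hyP (by simpa using h')
        · exact hyQ h'
  obtain ⟨C, hC, -, hHC⟩ := hH.exists_compact hΓ
  -- Pushing `S` forward until it misses `C` gets rid of these entries: nothing outside of `g^[k] ''
  -- S` is then mapped into its image under `g`.
  obtain ⟨k, hk⟩ := (h.forward C hC).exists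
  have hsub : ∀ n, g^[n] '' S ⊆ S := fun n ↦ (hgS.iterate n).image_subset
  have hsubgraph : ∀ n, IsSubgraph (g^[n] '' S) := by
    intro n
    induction n with
    | zero => simpa using isSubgraph_core hΓ P
    | succ n ih =>
      rw [Function.iterate_succ', image_comp]
      exact hg.isSubgraph_image ih ((hsub n).trans (hSP.trans hP))
  have hGL : g^[k] '' S ⊆ L := (hsub k).trans (hSP.trans hP)
  have hmaps : MapsTo g (g^[k] '' S) (g^[k] '' S) := by
    rintro _ ⟨x, hx, rfl⟩
    exact ⟨g x, hgS hx, by rw [← Function.iterate_succ_apply, Function.iterate_succ_apply']⟩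
  refine ⟨g^[k] '' S, (hsub k).trans hSP, ⟨hsubgraph k, hmaps, hg.injOn.mono hGL,
    hg.continuous.continuousOn, fun x hx ↦ hg.image_oc x (hGL hx), fun x hx ↦ hg.dim x (hGL hx),
    ?_, ?_⟩, ?_, ?_⟩
  · refine (hSgS.image hΓ (hg.continuous.iterate k)).mono ?_
    rintro _ ⟨⟨x, hx, rfl⟩, hx'⟩
    refine ⟨x, ⟨hx, ?_⟩, rfl⟩
    rintro ⟨y, hy, rfl⟩
    exact hx' ⟨g^[k] y, ⟨y, hy, rfl⟩, by
      rw [← Function.iterate_succ_apply, Function.iterate_succ_apply']⟩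
  · intro x hx
    obtain ⟨n, hn⟩ := (h.forward {x} isCompact_singleton).exists
    exact ⟨n, fun h' ↦ hn.notMem_of_mem_left (image_mono ((hsub k).trans hSP) h') rfl⟩
  · rintro x hx ⟨y, hy, hxy⟩
    have hgx : g x ∈ g^[k] '' S := hxy ▸ hmaps hy
    by_cases hxS : x ∈ S
    · rw [← hg.injOn (hGL hy) (hP (hSP hxS)) hxy] at hx
      exact hx hy
    · exact hk.notMem_of_mem_left (image_mono hSP hgx) (hHC ⟨hsub k hgx, mem_image_of_mem _ hxS⟩)
  · have : ∀ n, CellFinite (P \ g^[n] '' S) := by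
      intro n
      induction n with
      | zero => simpa using hPS
      | succ n ih =>
        refine (ih.union (hSgS.image hΓ (hg.continuous.iterate n))).mono ?_
        rintro x ⟨hx, hx'⟩
        by_cases hxn : x ∈ g^[n] '' S
        · obtain ⟨y, hy, rfl⟩ := hxn
          refine Or.inr ⟨y, ⟨hy, ?_⟩, rfl⟩
          rintro ⟨z, hz, rfl⟩
          exact hx' ⟨z, hz, rfl⟩
        · exact Or.inl ⟨hx, hxn⟩
    exact this k

/-- The part of the graph near the repelling ends. -/
theorem Escapes.exists_shift_right {g : Γ → Γ} {P Q L : Set Γ} (hΓ : IsGraph Γ)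
    (h : Escapes g P Q) (hg : CellularOn g L) (hQ : Q ⊆ L) :
    ∃ G ⊆ Q, ∃ θ, Shift G θ ∧ (∀ x ∈ G, g (θ x) = x) ∧ (∀ x, g x ∈ G → x ∈ G ∧ θ (g x) = x) ∧
      CellFinite (Q \ G) := by
  let S : ℕ → Set Γ := fun m ↦ core (g^[m] ⁻¹' Q)
  have hSQ : ∀ m, S m ⊆ Q := fun m x hx ↦ h.of_iterate_mem (n := m) (core_subset (g^[m] ⁻¹' Q) hx)
  have hS : ∀ m x, x ∈ S (m + 1) ↔ g x ∈ S m := by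
    intro m x
    constructor
    · intro hx
      change cc (cellOf (g x)) ⊆ _
      rw [← hg.image_cc (hQ (hSQ _ hx))]
      rintro _ ⟨y, hy, rfl⟩
      exact hx hy
    · intro hx y hy
      have hxQ : x ∈ Q := h.of_map_mem _ (hSQ _ hx)
      have : g y ∈ cc (cellOf (g x)) := by
        rw [← hg.image_cc (hQ hxQ)]; exact mem_image_of_mem _ hy
      exact hx this
  have hSS : ∀ m, S (m + 1) ⊆ S m := fun m ↦ core_mono fun x hx ↦ by
    rw [mem_preimage, Function.iterate_succ_apply'] at hx
    exact h.of_map_mem _ hx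
  have hfin : ∀ m, CellFinite (S m \ S (m + 1)) := by
    intro m
    obtain ⟨C, hC, -, hsub⟩ := (h.cofinite 0 (m + 1)).exists_compact hΓ
    refine CellFinite.of_meets hΓ hC fun x hx ↦ ?_
    obtain ⟨z, hz, hz'⟩ := not_subset.1 hx.2
    refine ⟨z, hz, hsub ?_⟩
    rintro (h' | h')
    · exact h.disjoint.notMem_of_mem_right (h.of_iterate_mem (hx.1 hz)) (by simpa using h')
    · exact hz' h'
  have hcell : ∀ m x y, x ∈ S m → cellOf y = cellOf x → y ∈ S m := by
    intro m x y hx hxy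
    change cc (cellOf y) ⊆ _
    rw [hxy]; exact hx
  have hcellg : ∀ x ∈ Q, ∀ y, cellOf y = cellOf x → cellOf (g y) = cellOf (g x) := by
    intro x hx y hxy
    refine cellOf_eq ?_
    rw [← hg.image_oc x (hQ hx), ← hxy]
    exact mem_image_of_mem _ (mem_oc_cellOf y)
  let f : Cell Γ → Cell Γ := fun c ↦ cellOf (g (oc_nonempty c).some)
  have hf : ∀ x ∈ Q, f (cellOf x) = cellOf (g x) := fun x hx ↦
    hcellg x hx _ (cellOf_eq (oc_nonempty (cellOf x)).some_mem)
  let D : ℕ → Set (Cell Γ) := fun m ↦ cellOf '' (S m \ S (m + 1))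
  have hmaps : ∀ m, MapsTo f (D (m + 1)) (D m) := by
    rintro m _ ⟨x, ⟨hx, hx'⟩, rfl⟩
    rw [hf x (hSQ _ hx)]
    exact mem_image_of_mem _ ⟨(hS _ _).1 hx, fun h' ↦ hx' ((hS _ _).2 h')⟩
  have hinj : ∀ m, InjOn f (D m) := by
    rintro m _ ⟨x, ⟨hx, hx'⟩, rfl⟩ _ ⟨y, ⟨hy, hy'⟩, rfl⟩ hxy
    rw [hf x (hSQ _ hx), hf y (hSQ _ hy)] at hxy
    have : g x ∈ g '' oc (cellOf y) := by
      rw [hg.image_oc y (hQ (hSQ _ hy)), ← hxy]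
      exact mem_oc_cellOf _
    obtain ⟨z, hz, hzx⟩ := this
    have hzS : z ∈ S m := hcell m y z hy (cellOf_eq hz)
    have := hg.injOn (hQ (hSQ _ hzS)) (hQ (hSQ _ hx)) hzx
    rw [← this, cellOf_eq hz]
  -- `D m` lists the cells of `Q` that leave after `m` further steps, and `g` injects `D (m + 1)`
  -- into `D m`. The finite cardinalities are nonincreasing, so from a minimum on the injections are
  -- bijections. Hence `g` is onto `S m₀` and has an inverse branch there.
  have hanti : Antitone fun m ↦ (D m).ncard := antitone_nat_of_succ_le fun m ↦
    ncard_le_ncard_of_injOn f (hmaps m) (hinj _) (hfin m)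
  obtain ⟨m₀, hm₀⟩ : ∃ m₀, ∀ m, (D m₀).ncard ≤ (D m).ncard :=
    ⟨Function.argmin (fun m ↦ (D m).ncard), fun m ↦ Function.argmin_le (fun m ↦ (D m).ncard) m⟩
  have hsurj : ∀ m ≥ m₀, f '' D (m + 1) = D m := by
    intro m hm
    refine eq_of_subset_of_ncard_le (hmaps m).image_subset ?_ (hfin m)
    rw [(hinj _).ncard_image]
    exact (hanti hm).trans (hm₀ _)
  have hpre : ∀ x ∈ S m₀, ∃ w, g w = x := by
    intro x hx
    have hex : ∃ n, x ∉ S (m₀ + n) := by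
      obtain ⟨N, hN⟩ := eventually_atTop.1 (h.backward {x} isCompact_singleton)
      exact ⟨N, fun h' ↦ (hN (m₀ + N) (by omega)).notMem_of_mem_left (core_subset _ h') rfl⟩
    classical
    obtain ⟨n, hn⟩ : ∃ n, Nat.find hex = n + 1 := Nat.exists_eq_succ_of_ne_zero fun h0 ↦ by
      have := Nat.find_spec hex
      rw [h0] at this
      exact this hx
    have hspec := Nat.find_spec hex
    rw [hn] at hspec
    have hxD : cellOf x ∈ D (m₀ + n) :=
      mem_image_of_mem _ ⟨not_not.1 (Nat.find_min hex (m := n) (by omega)), hspec⟩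
    rw [← hsurj _ (by omega)] at hxD
    obtain ⟨_, ⟨w, hw, rfl⟩, hwx⟩ := hxD
    have hwQ := hSQ _ hw.1
    rw [hf w hwQ] at hwx
    have hxo := mem_oc_cellOf x
    rw [← hwx, ← hg.image_oc w (hQ hwQ)] at hxo
    obtain ⟨z, -, hz⟩ := hxo
    exact ⟨z, hz⟩
  choose! θ hθ using hpre
  have hθS : ∀ x ∈ S m₀, θ x ∈ S (m₀ + 1) := fun x hx ↦ (hS _ _).2 (by rwa [hθ x hx])
  have hθg : ∀ x, g x ∈ S m₀ → x ∈ S m₀ ∧ θ (g x) = x := by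
    intro x hx
    have hx1 : x ∈ S (m₀ + 1) := (hS _ _).2 hx
    exact ⟨hSS _ hx1, hg.injOn (hQ (hSQ _ (hθS _ hx))) (hQ (hSQ _ hx1)) (hθ _ hx)⟩
  have hθmaps : MapsTo θ (S m₀) (S m₀) := fun x hx ↦ hSS _ (hθS x hx)
  refine ⟨S m₀, hSQ m₀, θ, ⟨isSubgraph_core hΓ _, hθmaps, ?_, ?_, ?_, ?_, ?_, ?_⟩, hθ, hθg, ?_⟩
  · intro x hx y hy hxy
    rw [← hθ x hx, hxy, hθ y hy]
  -- Continuity of `θ` is where `g` must be an embedding on `L` and not just injective.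
  · rw [continuousOn_iff_continuous_domRestrict]
    let θL : S m₀ → L := fun x ↦ ⟨θ x, hQ (hSQ _ (hθS x x.2))⟩
    have : Continuous θL := by
      rw [hg.isEmbedding.continuous_iff]
      have : L.domRestrict g ∘ θL = Subtype.val := funext fun x ↦ hθ x x.2
      rw [this]
      exact continuous_subtype_val
    exact continuous_subtype_val.comp this
  · intro x hx
    have hθx := hg.image_oc (θ x) (hQ (hSQ _ (hθS x hx)))
    rw [hθ x hx] at hθx
    rw [← hθx, image_image]
    ext y
    constructor
    · rintro ⟨z, hz, rfl⟩
      have hzS : z ∈ S (m₀ + 1) := hcell _ _ _ (hθS x hx) (cellOf_eq hz)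
      change θ (g z) ∈ _
      rw [(hθg z ((hS _ _).1 hzS)).2]
      exact hz
    · intro hy
      have hyS : y ∈ S (m₀ + 1) := hcell _ _ _ (hθS x hx) (cellOf_eq hy)
      exact ⟨y, hy, (hθg y ((hS _ _).1 hyS)).2⟩
  · intro x hx
    rw [← hg.dim _ (hQ (hSQ _ (hθS x hx))), hθ x hx]
  · refine (hfin m₀).mono ?_
    rintro x ⟨hx, hx'⟩
    refine ⟨hx, fun h' ↦ hx' ⟨g x, (hS _ _).1 h', (hθg x ((hS _ _).1 h')).2⟩⟩
  · intro x hx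
    obtain ⟨n, hn⟩ := (h.backward {x} isCompact_singleton).exists
    refine ⟨n, ?_⟩
    rintro ⟨y, hy, rfl⟩
    refine hn.notMem_of_mem_left (?_ : g^[n] (θ^[n] y) ∈ Q) rfl
    have : ∀ n, g^[n] (θ^[n] y) = y := by
      intro n
      induction n with
      | zero => rfl
      | succ n ih =>
        rw [Function.iterate_succ_apply, Function.iterate_succ_apply', hθ _ (hθmaps.iterate n hy),
          ih]
    rw [this]
    exact hSQ _ hy
  · have h0 : CellFinite (Q \ S 0) := by
      obtain ⟨C, hC, -, hsub⟩ := (h.cofinite 0 0).exists_compact hΓ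
      refine ((h.cellFinite_right hΓ hg hQ).union (CellFinite.of_meets hΓ (X := {x ∈ Q |
        (cc (cellOf x) ∩ C).Nonempty}) hC fun x hx ↦ hx.2)).mono ?_
      rintro y ⟨hy, hyc⟩
      obtain ⟨z, hz, hzQ⟩ := not_subset.1 hyc
      by_cases hzP : z ∈ P
      · exact Or.inl ⟨hy, z, hz, hzP⟩
      · refine Or.inr ⟨hy, z, hz, hsub ?_⟩
        rintro (h' | h')
        · exact hzP (by simpa using h')
        · exact hzQ h'
    have : ∀ n, CellFinite (Q \ S n) := by
      intro n
      induction n with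
      | zero => exact h0
      | succ n ih =>
        refine (ih.union (hfin n)).mono ?_
        rintro x ⟨hx, hx'⟩
        by_cases hxn : x ∈ S n
        · exact Or.inr ⟨hxn, hx'⟩
        · exact Or.inl ⟨hx, hxn⟩
    exact this m₀

/-- A map of a graph for which the complement of a finite set of cells splits into an attracting
part `Gp`, mapped into itself by `g`, and a repelling part `Gm`, mapped into itself by a branch `θ`
of the inverse of `g`. -/
structure EndDecomposition (g : Γ → Γ) (Gp Gm : Set Γ) (θ : Γ → Γ) : Prop where
  continuous : Continuous g
  vertex : ∀ x, (cellOf x).1 = 0 → (cellOf (g x)).1 = 0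
  shift_left : Shift Gp g
  not_mem_image : ∀ x ∉ Gp, g x ∉ g '' Gp
  shift_right : Shift Gm θ
  map_inverse : ∀ x ∈ Gm, g (θ x) = x
  of_map_mem : ∀ x, g x ∈ Gm → x ∈ Gm
  inverse_map : ∀ x, g x ∈ Gm → θ (g x) = x
  disjoint : Disjoint Gp Gm
  cofinite : CellFinite (Gp ∪ Gm)ᶜ

/-! ### The decomposition of the graph given by an end-periodic map -/

variable [ConnectedSpace Γ]

/-- `exists_escapes_of_iterate` is applied to the union of the attracting `U E` and the union of
iterated preimages of the repelling ones. Neighborhoods of different ends may overlap, but a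
neighborhood of one end meets only finitely many terms of a basis of another, so enough preimages
separate the two unions. Avoiding a compact set that contains `Lᶜ` puts the resulting `P` and `Q`
into `L`. -/
theorem exists_escapes (hΓ : IsGraph Γ) [Finite (SpaceEnd Γ)] {g : Γ → Γ}
    (hg : IsEndPeriodic g) :
    ∃ L P Q, CellularOn g L ∧ Escapes g P Q ∧ P ⊆ L ∧ Q ⊆ L := by
  obtain ⟨hgm, U, hU, hemb, hedge, p, hp, hpU⟩ := hg
  have hbasis : ∀ (E : SpaceEnd Γ) (V B : ℕ → Set Γ), IsEndBasisOf V E → IsEndBasisOf B E →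
      ∀ n, ∃ i, B i ⊆ V n := by
    rintro E V B ⟨hV, rfl⟩ ⟨hB, hBV⟩ n
    exact (Quotient.exact hBV n).1
  rw [largestSubgraph_eq_core hΓ] at hemb hedge
  have hself : ∀ B : ℕ → Set Γ, ∀ h : IsEndBasis B,
      IsEndBasisOf B (Quotient.mk (endSetoid Γ) ⟨B, h⟩ : SpaceEnd Γ) := fun B h ↦ ⟨h, rfl⟩
  have hL : CellularOn g (core (⋃ E, U E)) := by
    have hcases : ∀ x ∈ core (⋃ E, U E), g '' oc (cellOf x) = oc (cellOf (g x)) ∧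
        (cellOf (g x)).1 = (cellOf x).1 := by
      intro x hx
      rcases IsGraph.dim hΓ (cellOf x) with h | h
      · have hgx : (cellOf (g x)).1 = 0 :=
          mem_vertexSet_iff.1 (hgm.mapsTo_vertexSet (mem_vertexSet_iff.2 h))
        rw [← cc_eq_oc_of_vertex h, ← cc_eq_oc_of_vertex hgx, cc_cellOf_vertex h,
          cc_cellOf_vertex hgx, image_singleton, h, hgx]
        exact ⟨rfl, rfl⟩
      · obtain ⟨e, he⟩ := exists_edge h
        obtain ⟨e', he'⟩ := hedge e (by
          change oc (⟨1, e⟩ : Cell Γ) ⊆ _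
          rw [← he]; exact (isSubgraph_core hΓ _).oc_subset hx)
        have hx1 : g '' oc (cellOf x) = oc (⟨1, e'⟩ : Cell Γ) := by rw [he]; exact he'
        have hgx : cellOf (g x) = ⟨1, e'⟩ :=
          cellOf_eq (hx1 ▸ mem_image_of_mem _ (mem_oc_cellOf x))
        exact ⟨by rw [hx1, hgx], by rw [hgx, h]⟩
    refine ⟨hgm.continuous, isSubgraph_core hΓ _, ?_, hemb, fun x hx ↦ (hcases x hx).1,
      fun x hx ↦ (hcases x hx).2⟩
    have hfin : CellFinite (⋃ E, U E)ᶜ := by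
      refine cellFinite_compl_of_isEndBasis hΓ fun B hB ↦ ?_
      obtain ⟨N, hN⟩ := (hU _).tail_subset B (hself B hB)
      exact ⟨N, (hN N le_rfl).trans (subset_iUnion U _)⟩
    obtain ⟨C, hC, -, hsub⟩ := hfin.exists_compact hΓ
    refine CellFinite.of_meets hΓ hC fun x hx ↦ ?_
    obtain ⟨z, hz, hz'⟩ := not_subset.1 hx
    exact ⟨z, hz, hsub hz'⟩
  obtain ⟨K, hK, -, hKL⟩ := hL.cofinite.exists_compact hΓ
  let A : Set (SpaceEnd Γ) := {E | IsAttractingNhd g p (U E) E}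
  have hA : ∀ E, E ∉ A → IsRepellingNhd g p (U E) E := fun E hE ↦ (hpU E).resolve_left hE
  have hdisj : ∀ᶠ m in atTop, ∀ E ∈ A, ∀ E' ∉ A, Disjoint (U E) (g^[p * m] ⁻¹' U E') := by
    refine eventually_all.2 fun E ↦ eventually_all.2 fun hE ↦ eventually_all.2 fun E' ↦
      eventually_all.2 fun hE' ↦ ?_
    have hne : E' ≠ E := fun h ↦ hE' (h ▸ hE)
    have hfin := (hU E).finite_meet E' hne _ (hA E' hE').2
    filter_upwards [Nat.cofinite_eq_atTop ▸ hfin.compl_mem_cofinite] with n hn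
    rw [disjoint_comm, disjoint_iff_inter_eq_empty]
    exact not_nonempty_iff_eq_empty.1 hn
  obtain ⟨m₀, hm₀⟩ := hdisj.exists
  suffices ∃ P Q, Escapes g P Q ∧ Disjoint P K ∧ Disjoint Q K by
    obtain ⟨P, Q, hPQ, hPK, hQK⟩ := this
    exact ⟨_, P, Q, hL, hPQ, fun x hx ↦ not_not.1 fun h ↦ hPK.notMem_of_mem_left hx (hKL h),
      fun x hx ↦ not_not.1 fun h ↦ hQK.notMem_of_mem_left hx (hKL h)⟩
  refine exists_escapes_of_iterate hΓ hgm.continuous hp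
    (P := ⋃ E ∈ A, U E) (Q := ⋃ E ∈ Aᶜ, g^[p * m₀] ⁻¹' U E) hK ?_ ?_ ?_ ?_
  · intro C hC
    have : ∀ᶠ n in atTop, ∀ E ∈ A, Disjoint (g^[p * n] '' U E) C := by
      refine eventually_all.2 fun E ↦ eventually_all.2 fun hE ↦ ?_
      obtain ⟨hB, -⟩ := hE.2
      exact eventually_atTop.2 (hB.eventually_disjoint hC)
    filter_upwards [this] with n hn
    rw [image_iUnion₂]
    simpa using hn
  · intro C hC
    have : ∀ᶠ n in atTop, ∀ E ∈ Aᶜ, Disjoint (g^[p * n] ⁻¹' U E) C := by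
      refine eventually_all.2 fun E ↦ eventually_all.2 fun hE ↦ ?_
      obtain ⟨hB, -⟩ := (hA E hE).2
      exact eventually_atTop.2 (hB.eventually_disjoint hC)
    filter_upwards [(tendsto_add_atTop_nat m₀).eventually this] with n hn
    simp only [preimage_iUnion, disjoint_iUnion_left]
    intro E hE
    rw [← preimage_comp, ← Function.iterate_add, ← mul_add, add_comm]
    exact hn E hE
  · simp only [disjoint_iUnion_left, disjoint_iUnion_right]
    exact fun E hE E' hE' ↦ hm₀ E' hE' E hE
  · intro n m
    refine cellFinite_compl_of_isEndBasis hΓ fun B hB ↦ ?_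
    by_cases hE : (Quotient.mk (endSetoid Γ) ⟨B, hB⟩ : SpaceEnd Γ) ∈ A
    · obtain ⟨i, hi⟩ := hbasis _ _ B hE.2 (hself B hB) n
      exact ⟨i, hi.trans (subset_union_of_subset_left (image_mono (subset_biUnion_of_mem hE)) _)⟩
    · obtain ⟨i, hi⟩ := hbasis _ _ B (hA _ hE).2 (hself B hB) (m₀ + m)
      refine ⟨i, hi.trans (subset_union_of_subset_right ?_ _)⟩
      intro x hx
      refine mem_biUnion (show _ ∈ Aᶜ from hE) ?_
      rwa [mul_add, Function.iterate_add] at hx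

theorem exists_endDecomposition (hΓ : IsGraph Γ) [Finite (SpaceEnd Γ)] {g : Γ → Γ}
    (hg : IsEndPeriodic g) : ∃ Gp Gm θ, EndDecomposition g Gp Gm θ := by
  obtain ⟨L, P, Q, hL, h, hP, hQ⟩ := exists_escapes hΓ hg
  obtain ⟨Gp, hGp, hs, hm, hf⟩ := h.exists_shift_left hΓ hL hP
  obtain ⟨Gm, hGm, θ, hs', hθ, hθ', hf'⟩ := h.exists_shift_right hΓ hL hQ
  refine ⟨Gp, Gm, θ, hL.continuous, fun x hx ↦ mem_vertexSet_iff.1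
    (hg.1.mapsTo_vertexSet (mem_vertexSet_iff.2 hx)), hs, hm, hs', hθ, fun x hx ↦ (hθ' x hx).1,
    fun x hx ↦ (hθ' x hx).2, h.disjoint.mono hGp hGm, ?_⟩
  refine ((hf.union hf').union (h.cofinite 0 0)).mono fun x hx ↦ ?_
  by_contra hx'
  simp only [mem_union, Set.mem_sdiff, mem_compl_iff, Function.iterate_zero, image_id, preimage_id]
    at hx hx'
  tauto

end Shifts

end GraphCells

/-! ### Height functions -/

namespace GraphCells

section Heights

/-- A function on the image of a compact set is continuous if its pullback is. -/
lemma _root_.ContinuousOn.of_comp_of_isCompact {X Y Z : Type*} [TopologicalSpace X]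
    [TopologicalSpace Y] [T2Space Y] [TopologicalSpace Z] {K : Set X} (hK : IsCompact K)
    {f : X → Y} (hf : ContinuousOn f K) {T : Y → Z} (hT : ContinuousOn (T ∘ f) K) :
    ContinuousOn T (f '' K) := by
  have : CompactSpace K := isCompact_iff_compactSpace.1 hK
  let f' : K → f '' K := fun x ↦ ⟨f x, mem_image_of_mem f x.2⟩
  have hf' : Continuous f' := Continuous.subtype_mk (continuousOn_iff_continuous_domRestrict.1 hf) _
  have hsurj : Function.Surjective f' := by
    rintro ⟨_, x, hx, rfl⟩
    exact ⟨⟨x, hx⟩, rfl⟩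
  have hq : IsQuotientMap f' := hf'.isClosedMap.isQuotientMap hf' hsurj
  rw [continuousOn_iff_continuous_domRestrict, hq.continuous_iff]
  exact continuousOn_iff_continuous_domRestrict.1 hT

variable {Γ : Type u} [TopologicalSpace Γ] [CWComplex (univ : Set Γ)] {G : Set Γ} {θ : Γ → Γ}

namespace Shift

/-- Inverting `θ` as often as possible stops by `escape`. The conclusion is conditional so that
`depth` and `base` are total functions; their values off `G` carry no meaning. -/
lemma exists_base (h : Shift G θ) (x : Γ) :
    ∃ p : ℕ × Γ, x ∈ G → p.2 ∈ G \ θ '' G ∧ θ^[p.1] p.2 = x := by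
  by_cases hx : x ∈ G
  · have hex := h.escape x hx
    classical
    obtain ⟨n, hn⟩ : ∃ n, Nat.find hex = n + 1 := Nat.exists_eq_succ_of_ne_zero fun h0 ↦ by
      have := Nat.find_spec hex
      rw [h0] at this
      exact this (by simpa using hx)
    obtain ⟨w, hw, hwy⟩ := not_not.1 (Nat.find_min hex (m := n) (by omega))
    have hspec := Nat.find_spec hex
    rw [hn] at hspec
    exact ⟨(n, w), fun _ ↦ ⟨⟨hw, fun ⟨v, hv, hvw⟩ ↦ hspec ⟨v, hv, by
      rw [Function.iterate_succ_apply, hvw, hwy]⟩⟩, hwy⟩⟩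
  · exact ⟨(0, x), fun h ↦ (hx h).elim⟩

/-- The number of times that `θ` can be inverted at `x`. -/
noncomputable def depth (h : Shift G θ) (x : Γ) : ℕ := (h.exists_base x).choose.1

/-- The point of the fundamental domain whose orbit contains `x`. -/
noncomputable def base (h : Shift G θ) (x : Γ) : Γ := (h.exists_base x).choose.2

lemma base_mem (h : Shift G θ) {x : Γ} (hx : x ∈ G) : h.base x ∈ G \ θ '' G :=
  ((h.exists_base x).choose_spec hx).1

lemma iterate_base (h : Shift G θ) {x : Γ} (hx : x ∈ G) : θ^[h.depth x] (h.base x) = x :=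
  ((h.exists_base x).choose_spec hx).2

lemma iterate_mem (h : Shift G θ) {x : Γ} (hx : x ∈ G) (n : ℕ) : θ^[n] x ∈ G :=
  h.mapsTo.iterate n hx

/-- Injectivity cancels the common power of `θ`; a leftover power would put a point of the
fundamental domain into the image of `θ`. -/
lemma iterate_unique (h : Shift G θ) {x y : Γ} (hx : x ∈ G \ θ '' G) (hy : y ∈ G \ θ '' G)
    {k l : ℕ} (hxy : θ^[k] x = θ^[l] y) : k = l ∧ x = y := by
  wlog hkl : k ≤ l generalizing x y k l
  · obtain ⟨h1, h2⟩ := this hy hx hxy.symm (by omega)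
    exact ⟨h1.symm, h2.symm⟩
  obtain ⟨m, rfl⟩ := Nat.exists_eq_add_of_le hkl
  rw [Function.iterate_add_apply] at hxy
  have hxy' := h.injOn.iterate h.mapsTo k hx.1 (h.iterate_mem hy.1 m) hxy
  cases m with
  | zero => exact ⟨rfl, hxy'⟩
  | succ m =>
    rw [Function.iterate_succ_apply'] at hxy'
    exact (hx.2 ⟨_, h.iterate_mem hy.1 m, hxy'.symm⟩).elim

lemma depth_iterate (h : Shift G θ) {x : Γ} (hx : x ∈ G \ θ '' G) (k : ℕ) :
    h.depth (θ^[k] x) = k ∧ h.base (θ^[k] x) = x :=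
  have hG := h.iterate_mem hx.1 k
  h.iterate_unique (h.base_mem hG) hx (h.iterate_base hG)

lemma depth_of_mem (h : Shift G θ) {x : Γ} (hx : x ∈ G \ θ '' G) : h.depth x = 0 ∧ h.base x = x :=
  h.depth_iterate hx 0

lemma depth_map (h : Shift G θ) {x : Γ} (hx : x ∈ G) :
    h.depth (θ x) = h.depth x + 1 ∧ h.base (θ x) = h.base x := by
  have := h.depth_iterate (h.base_mem hx) (h.depth x + 1)
  rwa [Function.iterate_succ_apply', h.iterate_base hx] at this

lemma iterate_dim (h : Shift G θ) {x : Γ} (hx : x ∈ G) (n : ℕ) :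
    (cellOf (θ^[n] x)).1 = (cellOf x).1 := by
  induction n with
  | zero => rfl
  | succ n ih => rw [Function.iterate_succ_apply', h.dim _ (h.iterate_mem hx n), ih]

lemma base_dim (h : Shift G θ) {x : Γ} (hx : x ∈ G) : (cellOf (h.base x)).1 = (cellOf x).1 := by
  rw [← h.iterate_dim (h.base_mem hx).1 (h.depth x), h.iterate_base hx]

/-- The fundamental domain is a union of open cells. -/
lemma mem_domain_of_cellOf_eq (h : Shift G θ) {x y : Γ} (hx : x ∈ G \ θ '' G)
    (hxy : cellOf y = cellOf x) : y ∈ G \ θ '' G := by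
  refine ⟨h.subgraph.oc_subset hx.1 (hxy ▸ mem_oc_cellOf y), ?_⟩
  rintro ⟨w, hw, rfl⟩
  have := mem_oc_cellOf x
  rw [← hxy, ← h.image_oc w hw] at this
  exact hx.2 (image_mono (h.subgraph.oc_subset hw) this)

lemma iterate_continuousOn (h : Shift G θ) (n : ℕ) : ContinuousOn θ^[n] G := by
  induction n with
  | zero => exact continuousOn_id
  | succ n ih =>
    rw [Function.iterate_succ']
    exact h.continuousOn.comp ih (h.mapsTo.iterate n)

variable [T2Space Γ]

lemma image_cc (h : Shift G θ) {x : Γ} (hx : x ∈ G) :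
    θ '' cc (cellOf x) = cc (cellOf (θ x)) := by
  rw [← closure_oc (cellOf (θ x)), ← h.image_oc x hx, ← closure_oc, image_closure_of_isCompact]
  · rw [closure_oc]; exact isCompact_cc _
  · rw [closure_oc]; exact h.continuousOn.mono (h.subgraph x hx)

lemma iterate_image_cc (h : Shift G θ) {x : Γ} (hx : x ∈ G) (n : ℕ) :
    θ^[n] '' cc (cellOf x) = cc (cellOf (θ^[n] x)) := by
  induction n with
  | zero => simp
  | succ n ih =>
    rw [Function.iterate_succ', image_comp, ih, h.image_cc (h.iterate_mem hx n)]
    rfl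

/-- A continuous function on `G` that decreases by one under `θ`, is at least `3` on the closed
cells of the fundamental domain and on a given finite set of cells, and has the constant integer
value `N` at the vertices of the fundamental domain. -/
structure IsHeight (G : Set Γ) (θ : Γ → Γ) (A : Set Γ) (N : ℕ) (T : Γ → ℝ) : Prop where
  continuousOn : ContinuousOn T G
  map : ∀ x ∈ G, T (θ x) = T x - 1
  vertex : ∀ x ∈ G \ θ '' G, (cellOf x).1 = 0 → T x = N
  le : ∀ x ∈ G \ θ '' G, T x ≤ N
  three_le : ∀ x ∈ G \ θ '' G, ∀ w ∈ cc (cellOf x), 3 ≤ T w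
  three_le_of_mem : ∀ x ∈ A ∩ G, (cellOf x).1 = 0 → 3 ≤ T x

/-- A height is determined by its values on the fundamental domain `D`, but the closure `C` of `D`
may contain vertices that are already translates of points of `D`. At the vertices of `C` the value
is therefore forced to be a constant minus the depth. Tietze's theorem extends these values to `C`,
and `θ` spreads the result over `G`. -/
theorem exists_isHeight (h : Shift G θ) (hΓ : IsGraph Γ) {A : Set Γ} (hA : CellFinite A) :
    ∃ (N : ℕ) (T : Γ → ℝ), IsHeight G θ A N T := by
  set D := G \ θ '' G with hD
  let C : Set Γ := ⋃ c ∈ cellOf '' D, cc c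
  have hCc : IsCompact C := h.finite.isCompact_biUnion fun c _ ↦ isCompact_cc c
  have hmemC : ∀ x ∈ D, cc (cellOf x) ⊆ C := fun x hx ↦
    subset_biUnion_of_mem (u := fun c : Cell Γ ↦ cc c) (mem_image_of_mem _ hx)
  have hCG : C ⊆ G := by
    refine iUnion₂_subset ?_
    rintro _ ⟨x, hx, rfl⟩
    exact h.subgraph x hx.1
  have hCD : ∀ w ∈ C, w ∈ D ∨ (cellOf w).1 = 0 := by
    intro w hw
    simp only [C, mem_iUnion] at hw
    obtain ⟨_, ⟨x, hx, rfl⟩, hw⟩ := hw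
    rcases mem_cc hΓ hw with hw | hw
    · exact Or.inl (h.mem_domain_of_cellOf_eq hx (cellOf_eq hw))
    · exact Or.inr hw
  let V : Set Γ := {x ∈ (A ∩ G) ∪ C | (cellOf x).1 = 0}
  have hVfin : V.Finite := by
    refine CellFinite.finite_vertices (CellFinite.mono ?_ (sep_subset _ _)) fun x hx ↦ hx.2
    exact (hA.mono inter_subset_left).union (CellFinite.of_subset_compact hΓ hCc subset_rfl)
  -- `J` bounds the depth of the relevant vertices, so that the constant `J + 3` keeps all
  -- prescribed values in `[3, J + 3]`.
  obtain ⟨J, hJ⟩ := (hVfin.image h.depth).bddAbove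
  have hJ' : ∀ x ∈ V, (h.depth x : ℝ) ≤ J := fun x hx ↦
    Nat.cast_le.2 (hJ (mem_image_of_mem _ hx))
  have : CompactSpace C := isCompact_iff_compactSpace.1 hCc
  let s : Set C := {x | (cellOf (x : Γ)).1 = 0}
  have hs : s.Finite := by
    refine Finite.of_finite_image (f := Subtype.val) (hVfin.subset ?_)
      Subtype.val_injective.injOn
    rintro _ ⟨x, hx, rfl⟩
    exact ⟨Or.inr x.2, hx⟩
  have : Finite s := hs
  let f : C(s, ℝ) := ⟨fun x ↦ (J : ℝ) + 3 - h.depth x.1.1, continuous_of_discreteTopology⟩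
  obtain ⟨t, ht, htf⟩ := f.exists_restrict_eq_forall_mem_of_closed (t := Icc 3 ((J : ℝ) + 3))
    (fun x ↦ by
      have h1 := hJ' x.1.1 ⟨Or.inr x.1.2, x.2⟩
      have h2 : (0 : ℝ) ≤ h.depth x.1.1 := Nat.cast_nonneg _
      change _ ≤ (J : ℝ) + 3 - h.depth x.1.1 ∧ (J : ℝ) + 3 - h.depth x.1.1 ≤ _
      constructor <;> linarith) ⟨3, by simp⟩ hs.isClosed
  have htf' : ∀ w : C, (cellOf (w : Γ)).1 = 0 → t w = (J : ℝ) + 3 - h.depth (w : Γ) := by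
    intro w hw
    exact congrArg (fun φ : C(s, ℝ) ↦ φ ⟨w, hw⟩) htf
  classical
  let T₀ : Γ → ℝ := fun x ↦ if hx : x ∈ C then t ⟨x, hx⟩ else 0
  have hT₀ : ∀ w (hw : w ∈ C), T₀ w = t ⟨w, hw⟩ := fun w hw ↦ dif_pos hw
  have hT₀c : ContinuousOn T₀ C := by
    rw [continuousOn_iff_continuous_domRestrict]
    convert t.continuous using 1
    exact funext fun x ↦ hT₀ x x.2
  let T : Γ → ℝ := fun x ↦ T₀ (h.base x) - h.depth x
  have hDC : D ⊆ C := fun x hx ↦ hmemC x hx (mem_cc_cellOf x)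
  have hTD : ∀ x ∈ D, T x = T₀ x := by
    intro x hx
    obtain ⟨h1, h2⟩ := h.depth_of_mem hx
    simp only [T, h1, h2, Nat.cast_zero, sub_zero]
  have hvert : ∀ x ∈ D, (cellOf x).1 = 0 → T₀ x = (J : ℝ) + 3 := by
    intro x hx hx0
    rw [hT₀ x (hDC hx), htf' ⟨x, hDC hx⟩ hx0, (h.depth_of_mem hx).1]
    simp
  have hTvert : ∀ x ∈ G, (cellOf x).1 = 0 → T x = (J : ℝ) + 3 - h.depth x := by
    intro x hx hx0
    change T₀ (h.base x) - h.depth x = _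
    rw [hvert _ (h.base_mem hx) ((h.base_dim hx).trans hx0)]
  -- Points of `C` outside `D` are vertices, where the Tietze extension was prescribed to agree with
  -- the spread-out function.
  have hTC : ∀ x ∈ C, T x = T₀ x := by
    intro w hw
    rcases hCD w hw with hwD | hw0
    · exact hTD w hwD
    · rw [hTvert w (hCG hw) hw0, hT₀ w hw, htf' _ hw0]
  have hmap : ∀ x ∈ G, T (θ x) = T x - 1 := by
    intro x hx
    obtain ⟨h1, h2⟩ := h.depth_map hx
    simp only [T, h1, h2, Nat.cast_add, Nat.cast_one]
    ring
  have hmapn : ∀ n : ℕ, ∀ x ∈ G, T (θ^[n] x) = T x - n := by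
    intro n x hx
    induction n with
    | zero => simp
    | succ n ih =>
      rw [Function.iterate_succ_apply', hmap _ (h.iterate_mem hx n), ih]
      push_cast
      ring
  refine ⟨J + 3, T, ?_, hmap, ?_, ?_, ?_, ?_⟩
  -- Each closed cell of `G` is a translate of one in `C`, on which `T` equals `T₀`; translation
  -- changes `T` by a constant.
  · have hcell : ∀ x ∈ G, ContinuousOn T (cc (cellOf x)) := by
      intro x hx
      have hb := h.base_mem hx
      have hsub : cc (cellOf (h.base x)) ⊆ C := hmemC _ hb
      rw [← h.iterate_base hx, ← h.iterate_image_cc hb.1]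
      refine ContinuousOn.of_comp_of_isCompact (isCompact_cc _)
        ((h.iterate_continuousOn _).mono (hsub.trans hCG)) ?_
      refine ContinuousOn.congr (f := fun w ↦ T₀ w - h.depth x)
        ((hT₀c.mono hsub).sub continuousOn_const) fun w hw ↦ ?_
      rw [Function.comp_apply, hmapn _ _ (hCG (hsub hw)), hTC w (hsub hw)]
    have hG : G = ⋃ c : {c : Cell Γ // cc c ⊆ G}, cc c.1 := by
      ext x
      simp only [mem_iUnion]
      exact ⟨fun hx ↦ ⟨⟨cellOf x, h.subgraph x hx⟩, mem_cc_cellOf x⟩, fun ⟨c, hc⟩ ↦ c.2 hc⟩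
    rw [hG]
    refine (hΓ.locallyFinite.comp_injective Subtype.val_injective).continuousOn_iUnion
      (fun c ↦ isClosed_cc c.1) fun c ↦ ?_
    obtain ⟨x, hx⟩ := oc_nonempty c.1
    change ContinuousOn T (cc c.1)
    rw [← cellOf_eq hx]
    exact hcell x (c.2 (oc_subset_cc _ hx))
  · intro x hx hx0
    rw [hTD x hx, hvert x hx hx0]
    push_cast
    ring
  · intro x hx
    rw [hTD x hx, hT₀ x (hDC hx)]
    push_cast
    exact (ht _).2
  · intro x hx w hw
    rw [hTC w (hmemC x hx hw), hT₀ w (hmemC x hx hw)]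
    exact (ht _).1
  · intro x hx hx0
    have := hJ' x ⟨Or.inl hx, hx0⟩
    rw [hTvert x hx.2 hx0]
    linarith

end Shift

end Heights

end GraphCells

/-! ### The mapping torus and its suspension semiflow -/

namespace MappingTorus

variable {X : Type*} {f : X → X}

lemma mk_one (x : X) : MappingTorus.mk f x 1 = MappingTorus.mk f (f x) 0 :=
  Quot.sound ⟨rfl, rfl⟩

/-- The point reached from `(x, 0)` in time `s ≥ 0`. -/
noncomputable def orbit (f : X → X) (x : X) (s : ℝ) : MappingTorus f :=
  MappingTorus.mk f (f^[⌊s⌋₊] x) ⟨Int.fract s, Int.fract_nonneg _, (Int.fract_lt_one _).le⟩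

lemma orbit_coe (x : X) (y : I) : orbit f x y = MappingTorus.mk f x y := by
  rcases y.2.2.lt_or_eq with h | h
  · have h1 : ⌊(y : ℝ)⌋₊ = 0 := Nat.floor_eq_zero.2 h
    have h2 : Int.fract (y : ℝ) = y := Int.fract_eq_self.2 ⟨y.2.1, h⟩
    simp only [orbit, h1, h2, Function.iterate_zero, id_eq]
  · obtain rfl : y = 1 := Subtype.ext h
    rw [mk_one]
    simp only [orbit, Icc.coe_one, Nat.floor_one, Int.fract_one, Function.iterate_one]
    rfl

lemma orbit_add_nat (x : X) {s : ℝ} (hs : 0 ≤ s) (n : ℕ) :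
    orbit f x (s + n) = orbit f (f^[n] x) s := by
  simp only [orbit, Nat.floor_add_natCast hs, Int.fract_add_natCast, Function.iterate_add_apply]

lemma orbit_add_one (x : X) {s : ℝ} (hs : 0 ≤ s) : orbit f x (s + 1) = orbit f (f x) s := by
  simpa using orbit_add_nat (f := f) x hs 1

lemma suspensionSemiflow_mk (x : X) (y : I) (t : ℝ≥0) :
    suspensionSemiflow f t (MappingTorus.mk f x y) = orbit f x (y + t) := rfl

lemma suspensionSemiflow_orbit (x : X) {s : ℝ} (hs : 0 ≤ s) (t : ℝ≥0) :
    suspensionSemiflow f t (orbit f x s) = orbit f x (s + t) := by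
  rw [orbit, suspensionSemiflow_mk]
  change orbit f _ (Int.fract s + t) = _
  rw [← orbit_add_nat _ (add_nonneg (Int.fract_nonneg s) t.coe_nonneg)]
  congr 1
  have h1 : (⌊s⌋₊ : ℝ) = ⌊s⌋ := natCast_floor_eq_intCast_floor hs
  have h2 := Int.fract_add_floor s
  rw [h1]
  linarith

/-- The representative of a point of the mapping torus in `X × [0, 1)`. -/
noncomputable def rep (f : X → X) : MappingTorus f → X × ℝ := by
  classical
  exact Quot.lift (fun a ↦ if a.2 = 1 then (f a.1, 0) else (a.1, (a.2 : ℝ))) (by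
    rintro ⟨x, y⟩ ⟨x', y'⟩ ⟨h1, h2⟩
    obtain rfl : y = 1 := h1
    obtain ⟨rfl, rfl⟩ := Prod.mk.inj h2
    simp)

lemma rep_mk_of_lt (x : X) (y : I) (hy : (y : ℝ) < 1) :
    rep f (MappingTorus.mk f x y) = (x, (y : ℝ)) :=
  if_neg fun h ↦ hy.ne (congrArg Subtype.val h)

lemma rep_orbit (x : X) (s : ℝ) : rep f (orbit f x s) = (f^[⌊s⌋₊] x, Int.fract s) :=
  rep_mk_of_lt _ _ (Int.fract_lt_one s)

lemma exists_orbit_eq (z : MappingTorus f) : ∃ x, ∃ y ∈ Ico (0 : ℝ) 1, z = orbit f x y := by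
  obtain ⟨⟨x, y⟩, rfl⟩ := Quot.exists_rep z
  rcases y.2.2.lt_or_eq with h | h
  · exact ⟨x, y, ⟨y.2.1, h⟩, (orbit_coe x y).symm⟩
  · obtain rfl : y = 1 := Subtype.ext h
    exact ⟨f x, 0, by simp, (mk_one x).trans (orbit_coe (f x) 0).symm⟩

lemma rep_orbit_of_mem {x : X} {y : ℝ} (hy : y ∈ Ico (0 : ℝ) 1) : rep f (orbit f x y) = (x, y) := by
  rw [rep_orbit, Int.fract_eq_self.2 hy, Nat.floor_eq_zero.2 hy.2]
  rfl

lemma orbit_rep (z : MappingTorus f) : orbit f (rep f z).1 (rep f z).2 = z := by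
  obtain ⟨x, y, hy, rfl⟩ := exists_orbit_eq z
  rw [rep_orbit_of_mem hy]

lemma rep_mem (z : MappingTorus f) : (rep f z).2 ∈ Ico (0 : ℝ) 1 := by
  obtain ⟨x, y, hy, rfl⟩ := exists_orbit_eq z
  rw [rep_orbit_of_mem hy]
  exact hy

lemma rep_injective : Function.Injective (rep f) := fun z w h ↦ by
  rw [← orbit_rep z, h, orbit_rep]

/-- Descend a function on `X × [0, 1]` to the mapping torus. -/
noncomputable def lift {Y : Type*} (f : X → X) (F : X → ℝ → Y) (z : MappingTorus f) : Y :=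
  F (rep f z).1 (rep f z).2

lemma lift_orbit {Y : Type*} {F : X → ℝ → Y} (hF : ∀ x, F x 1 = F (f x) 0) (x : X) {y : ℝ}
    (hy : y ∈ Icc (0 : ℝ) 1) : lift f F (orbit f x y) = F x y := by
  rcases hy.2.lt_or_eq with h | rfl
  · rw [lift, rep_orbit_of_mem ⟨hy.1, h⟩]
  · rw [lift, rep_orbit, hF]
    simp

/-! ### Topology of the mapping torus -/

section Topology

variable [TopologicalSpace X]

lemma isQuotientMap_mk : IsQuotientMap fun a : X × I ↦ MappingTorus.mk f a.1 a.2 :=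
  isQuotientMap_quot_mk

/-- On the strip `n ≤ s ≤ n + 1` the map is `f^[n]` followed by the quotient map. Finitely many
closed strips cover a neighborhood of each point. -/
lemma continuousOn_orbit (hf : Continuous f) :
    ContinuousOn (fun a : X × ℝ ↦ orbit f a.1 a.2) (univ ×ˢ Ici 0) := by
  have hpiece : ∀ n : ℕ, ContinuousOn (fun a : X × ℝ ↦ orbit f a.1 a.2)
      (univ ×ˢ Icc (n : ℝ) (n + 1)) := by
    intro n
    have h' : Continuous fun a : X × ℝ ↦
        ((f^[n] a.1, projIcc (0 : ℝ) 1 zero_le_one (a.2 - n)) : X × I) :=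
      ((hf.iterate n).comp continuous_fst).prodMk
        (continuous_projIcc.comp (continuous_snd.sub continuous_const))
    have h : Continuous fun a : X × ℝ ↦
        MappingTorus.mk f (f^[n] a.1) (projIcc (0 : ℝ) 1 zero_le_one (a.2 - n)) :=
      isQuotientMap_mk.continuous.comp h'
    refine h.continuousOn.congr ?_
    rintro ⟨x, s⟩ ⟨-, hs⟩
    have hmem : s - n ∈ Icc (0 : ℝ) 1 := ⟨by linarith [hs.1], by linarith [hs.2]⟩
    change orbit f x s = MappingTorus.mk f (f^[n] x) _
    rw [projIcc_of_mem _ hmem, ← orbit_coe, ← orbit_add_nat _ hmem.1]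
    simp
  have hind : ∀ n : ℕ, ContinuousOn (fun a : X × ℝ ↦ orbit f a.1 a.2)
      (univ ×ˢ Icc (0 : ℝ) (n + 1)) := by
    intro n
    induction n with
    | zero => simpa using hpiece 0
    | succ n ih =>
      have hU : (univ : Set X) ×ˢ Icc (0 : ℝ) ((n + 1 : ℕ) + 1) =
          univ ×ˢ Icc (0 : ℝ) (n + 1) ∪ univ ×ˢ Icc ((n + 1 : ℕ) : ℝ) ((n + 1 : ℕ) + 1) := by
        rw [← prod_union]
        push_cast
        rw [Icc_union_Icc_eq_Icc] <;> linarith [n.cast_nonneg (α := ℝ)]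
      rw [hU]
      exact ih.union_of_isClosed (hpiece (n + 1)) (isClosed_univ.prod isClosed_Icc)
        (isClosed_univ.prod isClosed_Icc)
  rintro ⟨x, s⟩ ⟨-, hs⟩
  obtain ⟨n, hn⟩ := exists_nat_gt s
  refine (hind n (x, s) ⟨trivial, hs, by linarith⟩).mono_of_mem_nhdsWithin ?_
  have h1 : (univ : Set X) ×ˢ Iio ((n : ℝ) + 1) ∈ 𝓝 (x, s) :=
    (isOpen_univ.prod isOpen_Iio).mem_nhds ⟨trivial, by simpa using hn.trans (by linarith)⟩
  filter_upwards [mem_nhdsWithin_of_mem_nhds h1, self_mem_nhdsWithin] with a ha hb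
  exact ⟨trivial, hb.2, ha.2.le⟩

/-- The suspension semiflow, as a flow of nonnegative times. -/
noncomputable def flow (hf : Continuous f) : Flow ℝ≥0 (MappingTorus f) where
  toFun := suspensionSemiflow f
  cont' := by
    -- The product of the quotient map with the locally compact space `ℝ≥0` is again a quotient map,
    -- which gives joint continuity.
    refine isQuotientMap_mk.continuous_lift_prod_right (f := fun a : X × I ↦
      MappingTorus.mk f a.1 a.2) ?_
    have h : Continuous fun p : ℝ≥0 × (X × I) ↦ ((p.2.1, (p.2.2 : ℝ) + p.1) : X × ℝ) := by
      fun_prop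
    exact (continuousOn_orbit hf).comp_continuous h fun p ↦
      ⟨trivial, add_nonneg p.2.2.2.1 p.1.coe_nonneg⟩
  map_add' t₁ t₂ z := by
    obtain ⟨x, y, hy, rfl⟩ := exists_orbit_eq z
    rw [suspensionSemiflow_orbit _ hy.1, suspensionSemiflow_orbit _ hy.1,
      suspensionSemiflow_orbit _ (add_nonneg hy.1 t₂.coe_nonneg)]
    congr 1
    push_cast
    ring
  map_zero' z := by
    obtain ⟨x, y, hy, rfl⟩ := exists_orbit_eq z
    rw [suspensionSemiflow_orbit _ hy.1]
    simp

lemma continuous_lift {Y : Type*} [TopologicalSpace Y] {F : X → ℝ → Y}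
    (hF : ∀ x, F x 1 = F (f x) 0) (hc : Continuous fun a : X × ℝ ↦ F a.1 a.2) :
    Continuous (lift f F) := by
  rw [isQuotientMap_mk.continuous_iff]
  have : (lift f F ∘ fun a : X × I ↦ MappingTorus.mk f a.1 a.2) =
      (fun a : X × ℝ ↦ F a.1 a.2) ∘ fun a : X × I ↦ (a.1, (a.2 : ℝ)) := by
    funext a
    simp only [Function.comp_apply]
    rw [← orbit_coe, lift_orbit hF _ a.2.2]
  rw [this]
  exact hc.comp (by fun_prop)

/-- Points at different heights are separated by the map to the circle. Points at the same height
are separated by disjoint open sets of `X`, thickened in the flow direction; only the seam needs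
care, since `f` may identify points there. -/
lemma t2Space [T2Space X] (hf : Continuous f) : T2Space (MappingTorus f) := by
  have hcirc : Continuous (lift f fun (_ : X) (y : ℝ) ↦ (y : AddCircle (1 : ℝ))) := by
    refine continuous_lift (fun x ↦ ?_) ((AddCircle.continuous_mk' 1).comp continuous_snd)
    rw [AddCircle.coe_period, AddCircle.coe_zero]
  refine ⟨fun z z' hzz' ↦ ?_⟩
  by_cases hy : (rep f z).2 = (rep f z').2
  · have hx : (rep f z).1 ≠ (rep f z').1 := fun h ↦ hzz' (rep_injective (Prod.ext h hy))
    obtain ⟨U, V, hU, hV, hxU, hxV, hUV⟩ := t2_separation hx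
    by_cases h0 : (rep f z).2 = 0
    -- A neighborhood of a point on the seam must contain everything that is about to flow into it,
    -- hence the condition on `f` in the upper half.
    · have hopen : ∀ W : Set X, IsOpen W → IsOpen {w | ((rep f w).2 < 1 / 2 ∧ (rep f w).1 ∈ W) ∨
          (1 / 2 < (rep f w).2 ∧ f (rep f w).1 ∈ W)} := by
        intro W hW
        rw [← isQuotientMap_mk.isOpen_preimage]
        have : (fun a : X × I ↦ MappingTorus.mk f a.1 a.2) ⁻¹' {w |
            ((rep f w).2 < 1 / 2 ∧ (rep f w).1 ∈ W) ∨ (1 / 2 < (rep f w).2 ∧ f (rep f w).1 ∈ W)} =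
            {a : X × I | (a.2 : ℝ) < 1 / 2 ∧ a.1 ∈ W} ∪
              {a : X × I | 1 / 2 < (a.2 : ℝ) ∧ f a.1 ∈ W} := by
          ext ⟨x, y⟩
          rcases y.2.2.lt_or_eq with h | h
          · simp only [mem_preimage, mem_ofPred_eq, rep_mk_of_lt x y h, mem_union]
          · obtain rfl : y = 1 := Subtype.ext h
            have : rep f (MappingTorus.mk f x 1) = (f x, 0) := by
              rw [mk_one, rep_mk_of_lt _ _ (by simp)]; simp
            simp only [mem_preimage, mem_ofPred_eq, this, mem_union, Icc.coe_one]
            norm_num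
        rw [this]
        have h1 : Continuous fun a : X × I ↦ (a.2 : ℝ) := by fun_prop
        exact ((isOpen_lt h1 continuous_const).inter (hW.preimage continuous_fst)).union
          ((isOpen_lt continuous_const h1).inter (hW.preimage (hf.comp continuous_fst)))
      refine ⟨_, _, hopen U hU, hopen V hV, ?_, ?_, ?_⟩
      · left; rw [h0]; exact ⟨by norm_num, hxU⟩
      · left; rw [← hy, h0]; exact ⟨by norm_num, hxV⟩
      · refine disjoint_left.2 ?_
        rintro w (⟨h1, h2⟩ | ⟨h1, h2⟩) (⟨h3, h4⟩ | ⟨h3, h4⟩)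
        · exact hUV.notMem_of_mem_left h2 h4
        · linarith
        · linarith
        · exact hUV.notMem_of_mem_left h2 h4
    · have hopen : ∀ W : Set X, IsOpen W → IsOpen {w | (rep f w).2 ≠ 0 ∧ (rep f w).1 ∈ W} := by
        intro W hW
        rw [← isQuotientMap_mk.isOpen_preimage]
        have : (fun a : X × I ↦ MappingTorus.mk f a.1 a.2) ⁻¹'
            {w | (rep f w).2 ≠ 0 ∧ (rep f w).1 ∈ W} =
            {a : X × I | ((a.2 : ℝ) < 1 ∧ (a.2 : ℝ) ≠ 0) ∧ a.1 ∈ W} := by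
          ext ⟨x, y⟩
          rcases y.2.2.lt_or_eq with h | h
          · simp only [mem_preimage, mem_ofPred_eq, rep_mk_of_lt x y h, h, true_and]
          · obtain rfl : y = 1 := Subtype.ext h
            have : rep f (MappingTorus.mk f x 1) = (f x, 0) := by
              rw [mk_one, rep_mk_of_lt _ _ (by simp)]; simp
            simp [this]
        rw [this]
        have h1 : Continuous fun a : X × I ↦ (a.2 : ℝ) := by fun_prop
        exact ((isOpen_lt h1 continuous_const).inter (isOpen_ne_fun h1 continuous_const)).inter
          (hW.preimage continuous_fst)
      refine ⟨_, _, hopen U hU, hopen V hV, ⟨h0, hxU⟩, ⟨hy ▸ h0, hxV⟩, ?_⟩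
      exact disjoint_left.2 fun w h1 h2 ↦ hUV.notMem_of_mem_left h1.2 h2.2
  · have hne : lift f (fun (_ : X) (y : ℝ) ↦ (y : AddCircle (1 : ℝ))) z ≠
        lift f (fun (_ : X) (y : ℝ) ↦ (y : AddCircle (1 : ℝ))) z' := by
      intro h
      have h1 := rep_mem z
      have h2 := rep_mem z'
      refine hy ((AddCircle.coe_eq_coe_iff_of_mem_Ico (p := (1 : ℝ)) (a := 0) ?_ ?_).1 h)
      · simpa using h1
      · simpa using h2
    exact separated_by_continuous hcirc hne

end Topology

end MappingTorus

/-! ### Exit and entrance times -/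

namespace GraphCells

open MappingTorus

/-- The function `T` on `G`, truncated at `3`. -/
noncomputable def truncated {Γ : Type u} (G : Set Γ) (T : Γ → ℝ) (x : Γ) : ℝ := by
  classical exact if x ∈ G then min (T x) 3 else 3

lemma truncated_of_mem {Γ : Type u} {G : Set Γ} {T : Γ → ℝ} {x : Γ} (hx : x ∈ G) :
    truncated G T x = min (T x) 3 := if_pos hx

lemma truncated_of_notMem {Γ : Type u} {G : Set Γ} {T : Γ → ℝ} {x : Γ} (hx : x ∉ G) :
    truncated G T x = 3 := if_neg hx

lemma mem_of_truncated_lt {Γ : Type u} {G : Set Γ} {T : Γ → ℝ} {x : Γ} (hx : truncated G T x < 3) :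
    x ∈ G ∧ truncated G T x = T x := by
  by_cases h : x ∈ G
  · rw [truncated_of_mem h] at hx ⊢
    exact ⟨h, min_eq_left ((min_lt_iff.1 hx).resolve_right (lt_irrefl _)).le⟩
  · rw [truncated_of_notMem h] at hx
    exact (lt_irrefl _ hx).elim

section Times

variable {Γ : Type u} [TopologicalSpace Γ] [CWComplex (univ : Set Γ)]

/-- The points in closed cells which are outside of `Gp` and `Gm`. -/
def middle (Gp Gm : Set Γ) : Set Γ := {x | ∃ y ∈ (Gp ∪ Gm)ᶜ, x ∈ cc (cellOf y)}

/-- A decomposition of the graph, together with height functions on the two ends. -/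
structure Heights (g : Γ → Γ) (Gp Gm : Set Γ) (θ : Γ → Γ) (Np Nm : ℕ) (Tp Tm : Γ → ℝ) :
    Prop where
  isGraph : IsGraph Γ
  decomp : EndDecomposition g Gp Gm θ
  left : Shift.IsHeight Gp g (middle Gp Gm) Np Tp
  right : Shift.IsHeight Gm θ (middle Gp Gm) Nm Tm

lemma Shift.IsHeight.iterate {G : Set Γ} {θ : Γ → Γ} {A : Set Γ} {N : ℕ} {T : Γ → ℝ}
    (hs : Shift G θ) (h : Shift.IsHeight G θ A N T) {x : Γ} (hx : x ∈ G) (n : ℕ) :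
    T (θ^[n] x) = T x - n := by
  induction n with
  | zero => simp
  | succ n ih =>
    rw [Function.iterate_succ_apply', h.map _ (hs.iterate_mem hx n), ih]
    push_cast
    ring

lemma Shift.IsHeight.eq_base {G : Set Γ} {θ : Γ → Γ} {A : Set Γ} {N : ℕ} {T : Γ → ℝ}
    (hs : Shift G θ) (h : Shift.IsHeight G θ A N T) {x : Γ} (hx : x ∈ G) :
    T x = T (hs.base x) - hs.depth x := by
  rw [← h.iterate hs (hs.base_mem hx).1, hs.iterate_base hx]

lemma cellFinite_middle [T2Space Γ] {Gp Gm : Set Γ} (hΓ : IsGraph Γ)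
    (h : CellFinite (Gp ∪ Gm)ᶜ) :
    CellFinite (middle Gp Gm) := by
  refine CellFinite.of_subset_compact hΓ (C := ⋃ c ∈ cellOf '' (Gp ∪ Gm)ᶜ, cc c)
    (h.isCompact_biUnion fun c _ ↦ isCompact_cc c) ?_
  rintro x ⟨y, hy, hx⟩
  exact mem_biUnion (mem_image_of_mem _ hy) hx

lemma EndDecomposition.exists_heights [T2Space Γ] {g : Γ → Γ} {Gp Gm : Set Γ} {θ : Γ → Γ}
    (hΓ : IsGraph Γ) (h : EndDecomposition g Gp Gm θ) :
    ∃ Np Nm Tp Tm, Heights g Gp Gm θ Np Nm Tp Tm := by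
  obtain ⟨Np, Tp, hp⟩ := h.shift_left.exists_isHeight hΓ (cellFinite_middle hΓ h.cofinite)
  obtain ⟨Nm, Tm, hm⟩ := h.shift_right.exists_isHeight hΓ (cellFinite_middle hΓ h.cofinite)
  exact ⟨Np, Nm, Tp, Tm, hΓ, h, hp, hm⟩

lemma Shift.cellFinite_depth_le {G : Set Γ} {θ : Γ → Γ} (hΓ : IsGraph Γ) (h : Shift G θ) (K : ℕ) :
    CellFinite {x ∈ G | h.depth x ≤ K} := by
  have hC : IsCompact (⋃ c ∈ cellOf '' (G \ θ '' G), cc c) :=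
    h.finite.isCompact_biUnion fun c _ ↦ isCompact_cc c
  have hCG : (⋃ c ∈ cellOf '' (G \ θ '' G), cc c) ⊆ G := by
    refine iUnion₂_subset ?_
    rintro _ ⟨x, hx, rfl⟩
    exact h.subgraph x hx.1
  refine CellFinite.of_subset_compact hΓ ((finite_le_nat K).isCompact_biUnion fun n _ ↦
    hC.image_of_continuousOn ((h.iterate_continuousOn n).mono hCG)) ?_
  rintro x ⟨hx, hxK⟩
  exact mem_biUnion (show h.depth x ∈ {i | i ≤ K} from hxK) ⟨h.base x,
    mem_biUnion (mem_image_of_mem _ (h.base_mem hx)) (mem_cc_cellOf _), h.iterate_base hx⟩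

variable {g : Γ → Γ} {Gp Gm : Set Γ} {θ : Γ → Γ} {Np Nm : ℕ} {Tp Tm : Γ → ℝ}

/-- The two formulas agree on the frontier of `G`: a frontier point is a vertex of a cell that
leaves `G`, so it lies in `A`, where the height is at least `3`. -/
lemma Shift.IsHeight.continuous_truncated [T2Space Γ] {G A : Set Γ} {N : ℕ} {T : Γ → ℝ}
    (hΓ : IsGraph Γ) (hs : Shift G θ) (h : Shift.IsHeight G θ A N T)
    (hA : ∀ x ∈ G, ∀ y ∉ G, x ∈ cc (cellOf y) → x ∈ A) : Continuous (truncated G T) := by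
  have hcl := hs.subgraph.isClosed hΓ
  classical
  refine continuous_if ?_ ?_ continuousOn_const
  · intro x hx
    have hxG : x ∈ G := hcl.frontier_subset hx
    have hx' : x ∈ closure Gᶜ := by
      rw [frontier_eq_closure_inter_closure] at hx
      exact hx.2
    obtain ⟨y, hy, hyG⟩ := mem_closure_iff.1 hx' _ (isOpen_openStar hΓ x) (mem_openStar_self x)
    refine min_eq_right (h.three_le_of_mem x ⟨hA x hxG y hyG hy, hxG⟩ ?_)
    rcases mem_cc hΓ hy with hxy | hxy
    · refine (hyG ?_).elim
      have := hs.subgraph.oc_subset hxG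
      rw [cellOf_eq hxy] at this
      exact this (mem_oc_cellOf y)
    · exact hxy
  · change ContinuousOn _ (closure G)
    rw [hcl.closure_eq]
    exact h.continuousOn.inf continuousOn_const

namespace Heights

variable (h : Heights g Gp Gm θ Np Nm Tp Tm)
include h

lemma notMem_right {x : Γ} (hx : x ∈ Gp) : x ∉ Gm := h.decomp.disjoint.notMem_of_mem_left hx

lemma notMem_left {x : Γ} (hx : x ∈ Gm) : x ∉ Gp := h.decomp.disjoint.notMem_of_mem_right hx

lemma mem_middle_of_left {x y : Γ} (hx : x ∈ Gp) (hy : y ∉ Gp) (hxy : x ∈ cc (cellOf y)) :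
    x ∈ middle Gp Gm :=
  ⟨y, fun h' ↦ h'.elim hy fun hm ↦ h.notMem_right hx (h.decomp.shift_right.subgraph y hm hxy), hxy⟩

lemma mem_middle_of_right {x y : Γ} (hx : x ∈ Gm) (hy : y ∉ Gm) (hxy : x ∈ cc (cellOf y)) :
    x ∈ middle Gp Gm :=
  ⟨y, fun h' ↦ h'.elim (fun hm ↦ h.notMem_left hx (h.decomp.shift_left.subgraph y hm hxy)) hy, hxy⟩

/-- This is the gluing condition for `exitTime` at the seam. A point that enters `Gp` from outside
lands in the fundamental domain, where the height is at least `3`, so the truncation hides the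
entry. -/
lemma truncated_left_map (x : Γ) :
    min (truncated Gp Tp (g x)) 2 = truncated Gp Tp x - 1 := by
  have hs := h.decomp.shift_left
  by_cases hx : x ∈ Gp
  · rw [truncated_of_mem hx, truncated_of_mem (hs.mapsTo hx), h.left.map x hx]
    grind
  · have h3 : truncated Gp Tp (g x) = 3 := by
      by_cases hgx : g x ∈ Gp
      · rw [truncated_of_mem hgx]
        exact min_eq_right (h.left.three_le _ ⟨hgx, h.decomp.not_mem_image x hx⟩ _
          (mem_cc_cellOf _))
      · exact truncated_of_notMem hgx
    rw [h3, truncated_of_notMem hx]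
    norm_num

lemma mem_domain_right {x : Γ} (hx : x ∈ Gm) (hgx : g x ∉ Gm) : x ∈ Gm \ θ '' Gm := by
  refine ⟨hx, ?_⟩
  rintro ⟨w, hw, rfl⟩
  exact hgx (by rwa [h.decomp.map_inverse w hw])

/-- The gluing condition for `entryTime`: a point leaves `Gm` only from the fundamental domain,
where the height is at least `3`. -/
lemma truncated_right_map (x : Γ) :
    truncated Gm Tm (g x) = min (truncated Gm Tm x + 1) 3 := by
  by_cases hgx : g x ∈ Gm
  · have hx := h.decomp.of_map_mem x hgx
    have hT := h.right.map _ hgx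
    rw [h.decomp.inverse_map x hgx] at hT
    rw [truncated_of_mem hx, truncated_of_mem hgx, hT]
    grind
  · rw [truncated_of_notMem hgx]
    by_cases hx : x ∈ Gm
    · have := h.right.three_le x (h.mem_domain_right hx hgx) x (mem_cc_cellOf x)
      rw [truncated_of_mem hx]
      grind
    · rw [truncated_of_notMem hx]
      norm_num

end Heights

/-- The time until a point of the mapping torus reaches the level zero of the attracting ends,
truncated at `2`. -/
noncomputable def exitTime (g : Γ → Γ) (Gp : Set Γ) (Tp : Γ → ℝ) : MappingTorus g → ℝ :=
  -- `truncated` is exact only below `3`, and up to `1` is subtracted from it, so the result is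
  -- exact below `2`. The entry time adds `y` and can keep the cutoff `3`.
  lift g fun x y ↦ min (truncated Gp Tp x - y) 2

/-- The time since a point of the mapping torus left the level zero of the repelling ends,
truncated at `3`. -/
noncomputable def entryTime (g : Γ → Γ) (Gm : Set Γ) (Tm : Γ → ℝ) : MappingTorus g → ℝ :=
  lift g fun x y ↦ min (truncated Gm Tm x + y) 3

namespace Heights

variable (h : Heights g Gp Gm θ Np Nm Tp Tm)
include h

lemma exitTime_orbit (x : Γ) {y : ℝ} (hy : y ∈ Icc (0 : ℝ) 1) :
    exitTime g Gp Tp (orbit g x y) = min (truncated Gp Tp x - y) 2 := by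
  refine lift_orbit (F := fun x y ↦ min (truncated Gp Tp x - y) 2) (fun x ↦ ?_) x hy
  have := h.truncated_left_map x
  rw [sub_zero, this, ← this, min_assoc, min_self]

lemma exitTime_orbit_of_mem {x : Γ} (hx : x ∈ Gp) {r : ℝ} (hr : 0 ≤ r) :
    exitTime g Gp Tp (orbit g x r) = min (Tp x - r) 2 := by
  have hs := h.decomp.shift_left
  have hr' : r = Int.fract r + ⌊r⌋₊ := by
    rw [natCast_floor_eq_intCast_floor hr, Int.fract_add_floor]
  have h0 := Int.fract_nonneg r
  have h1 := (Int.fract_lt_one r).le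
  rw [hr', orbit_add_nat _ h0, h.exitTime_orbit _ ⟨h0, h1⟩,
    truncated_of_mem (hs.iterate_mem hx _), h.left.iterate hs hx]
  grind

lemma exitTime_le_two (z : MappingTorus g) : exitTime g Gp Tp z ≤ 2 := by
  obtain ⟨x, y, hy, rfl⟩ := exists_orbit_eq z
  rw [h.exitTime_orbit x ⟨hy.1, hy.2.le⟩]
  exact min_le_right _ _

lemma exists_of_exitTime_lt {z : MappingTorus g} (hz : exitTime g Gp Tp z < 2) :
    ∃ x ∈ Gp, ∃ y ∈ Ico (0 : ℝ) 1, z = orbit g x y ∧ exitTime g Gp Tp z = Tp x - y := by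
  obtain ⟨x, y, hy, rfl⟩ := exists_orbit_eq z
  have hy' : y ∈ Icc (0 : ℝ) 1 := ⟨hy.1, hy.2.le⟩
  have hz' := hz
  rw [h.exitTime_orbit x hy', min_lt_iff] at hz'
  have hlt := hz'.resolve_right (lt_irrefl _)
  obtain ⟨hx, hT⟩ := mem_of_truncated_lt (show truncated Gp Tp x < 3 by linarith [hy.2])
  refine ⟨x, hx, y, hy, rfl, ?_⟩
  rw [h.exitTime_orbit x hy', min_eq_left hlt.le, hT]

lemma entryTime_orbit (x : Γ) {r : ℝ} (hr : 0 ≤ r) :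
    entryTime g Gm Tm (orbit g x r) = min (truncated Gm Tm x + r) 3 := by
  have key : ∀ x, ∀ y ∈ Icc (0 : ℝ) 1,
      entryTime g Gm Tm (orbit g x y) = min (truncated Gm Tm x + y) 3 := by
    intro x y hy
    refine lift_orbit (F := fun x y ↦ min (truncated Gm Tm x + y) 3) (fun x ↦ ?_) x hy
    rw [add_zero, h.truncated_right_map x, min_assoc, min_self]
  have hn : ∀ n : ℕ, ∀ x, ∀ y ∈ Icc (0 : ℝ) 1,
      entryTime g Gm Tm (orbit g x (y + n)) = min (truncated Gm Tm x + (y + n)) 3 := by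
    intro n
    induction n with
    | zero => intro x y hy; simpa using key x y hy
    | succ n ih =>
      intro x y hy
      have h1 : y + (n + 1 : ℕ) = (y + n) + 1 := by push_cast; ring
      have h2 : 0 ≤ y + n := add_nonneg hy.1 n.cast_nonneg
      rw [h1, orbit_add_one _ h2, ih _ y hy, h.truncated_right_map]
      grind
  have hr' : r = Int.fract r + ⌊r⌋₊ := by
    rw [natCast_floor_eq_intCast_floor hr, Int.fract_add_floor]
  rw [hr']
  exact hn _ x _ ⟨Int.fract_nonneg r, (Int.fract_lt_one r).le⟩

lemma entryTime_orbit_of_mem {x : Γ} (hx : x ∈ Gm) {r : ℝ} (hr : 0 ≤ r) :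
    entryTime g Gm Tm (orbit g x r) = min (Tm x + r) 3 := by
  rw [h.entryTime_orbit x hr, truncated_of_mem hx]
  grind

lemma entryTime_flow (z : MappingTorus g) (t : ℝ≥0) :
    entryTime g Gm Tm (suspensionSemiflow g t z) = min (entryTime g Gm Tm z + t) 3 := by
  obtain ⟨x, y, hy, rfl⟩ := exists_orbit_eq z
  have ht := t.coe_nonneg
  rw [suspensionSemiflow_orbit x hy.1, h.entryTime_orbit x hy.1,
    h.entryTime_orbit x (add_nonneg hy.1 ht)]
  grind

lemma entryTime_le_three (z : MappingTorus g) : entryTime g Gm Tm z ≤ 3 := by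
  obtain ⟨x, y, hy, rfl⟩ := exists_orbit_eq z
  rw [h.entryTime_orbit x hy.1]
  exact min_le_right _ _

lemma exists_of_entryTime_lt {z : MappingTorus g} (hz : entryTime g Gm Tm z < 3) :
    ∃ x ∈ Gm, ∃ y ∈ Ico (0 : ℝ) 1, z = orbit g x y ∧ entryTime g Gm Tm z = Tm x + y := by
  obtain ⟨x, y, hy, rfl⟩ := exists_orbit_eq z
  have hz' := hz
  rw [h.entryTime_orbit x hy.1, min_lt_iff] at hz'
  have hlt := hz'.resolve_right (lt_irrefl _)
  obtain ⟨hx, hT⟩ := mem_of_truncated_lt (show truncated Gm Tm x < 3 by linarith [hy.1])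
  refine ⟨x, hx, y, hy, rfl, ?_⟩
  rw [h.entryTime_orbit x hy.1, min_eq_left hlt.le, hT]

lemma entryTime_eq_of_exitTime_lt {z : MappingTorus g} (hz : exitTime g Gp Tp z < 2) :
    entryTime g Gm Tm z = 3 := by
  obtain ⟨x, hx, y, hy, rfl, -⟩ := h.exists_of_exitTime_lt hz
  rw [h.entryTime_orbit x hy.1, truncated_of_notMem (h.notMem_right hx)]
  exact min_eq_right (by linarith [hy.1])

lemma exitTime_eq_of_entryTime_lt {z : MappingTorus g} (hz : entryTime g Gm Tm z < 3) :
    exitTime g Gp Tp z = 2 := by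
  obtain ⟨x, hx, y, hy, rfl, -⟩ := h.exists_of_entryTime_lt hz
  rw [h.exitTime_orbit x ⟨hy.1, hy.2.le⟩, truncated_of_notMem (h.notMem_left hx)]
  exact min_eq_right (by linarith [hy.2])

lemma iterate_inverse {x : Γ} (hx : x ∈ Gm) (n : ℕ) : g^[n] (θ^[n] x) = x := by
  induction n with
  | zero => rfl
  | succ n ih =>
    rw [Function.iterate_succ_apply, Function.iterate_succ_apply',
      h.decomp.map_inverse _ (h.decomp.shift_right.iterate_mem hx n), ih]

lemma inverse_iterate {x : Γ} {n : ℕ} (hx : g^[n] x ∈ Gm) : θ^[n] (g^[n] x) = x := by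
  induction n with
  | zero => rfl
  | succ n ih =>
    rw [Function.iterate_succ_apply' g] at hx ⊢
    rw [Function.iterate_succ_apply θ, h.decomp.inverse_map _ hx, ih (h.decomp.of_map_mem _ hx)]

/-! ### Compact levels and collars at the ends -/

variable [T2Space Γ]

lemma continuous_exitTime : Continuous (exitTime g Gp Tp) := by
  have hc := h.left.continuous_truncated h.isGraph h.decomp.shift_left
    fun x hx y hy ↦ h.mem_middle_of_left hx hy
  refine continuous_lift (fun x ↦ ?_) (by fun_prop)
  have := h.truncated_left_map x
  rw [sub_zero, this, ← this, min_assoc, min_self]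

lemma continuous_entryTime : Continuous (entryTime g Gm Tm) := by
  have hc := h.right.continuous_truncated h.isGraph h.decomp.shift_right
    fun x hx y hy ↦ h.mem_middle_of_right hx hy
  refine continuous_lift (fun x ↦ ?_) (by fun_prop)
  rw [add_zero, h.truncated_right_map x, min_assoc, min_self]

/-- The part of the mapping torus where both times are bounded below is compact. -/
lemma isCompact_le_time (M : ℝ) :
    IsCompact {z | -M ≤ exitTime g Gp Tp z ∧ -M ≤ entryTime g Gm Tm z} := by
  have hsl := h.decomp.shift_left
  have hsr := h.decomp.shift_right
  -- A height is at most `Np` or `Nm` minus the depth, so a lower bound for the times bounds the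
  -- depth. The extra `1` absorbs the fractional time, and one `K` serves both kinds of ends.
  obtain ⟨K, hK⟩ := exists_nat_ge (M + Np + Nm + 1)
  have hfin : CellFinite ((Gp ∪ Gm)ᶜ ∪ ({x ∈ Gp | hsl.depth x ≤ K} ∪ {x ∈ Gm | hsr.depth x ≤ K})) :=
    h.decomp.cofinite.union ((hsl.cellFinite_depth_le h.isGraph K).union
      (hsr.cellFinite_depth_le h.isGraph K))
  obtain ⟨C, hC, -, hsub⟩ := hfin.exists_compact h.isGraph
  have himage := (hC.prod (isCompact_Icc (a := (0 : ℝ)) (b := 1))).image_of_continuousOn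
    ((continuousOn_orbit h.decomp.continuous).mono fun a ha ↦ ⟨trivial, ha.2.1⟩)
  refine himage.of_isClosed_subset ((isClosed_le continuous_const h.continuous_exitTime).inter
    (isClosed_le continuous_const h.continuous_entryTime)) ?_
  rintro z ⟨hz1, hz2⟩
  obtain ⟨x, y, hy, rfl⟩ := exists_orbit_eq z
  refine ⟨(x, y), ⟨hsub ?_, hy.1, hy.2.le⟩, rfl⟩
  by_cases hxp : x ∈ Gp
  · refine Or.inr (Or.inl ⟨hxp, ?_⟩)
    rw [h.exitTime_orbit_of_mem hxp hy.1, h.left.eq_base hsl hxp] at hz1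
    have := h.left.le _ (hsl.base_mem hxp)
    have h1 := min_le_left (Tp (hsl.base x) - hsl.depth x - y) 2
    have hnm : (0 : ℝ) ≤ Nm := Nat.cast_nonneg _
    have : (hsl.depth x : ℝ) ≤ K := by linarith [hy.1]
    exact_mod_cast this
  · by_cases hxm : x ∈ Gm
    · refine Or.inr (Or.inr ⟨hxm, ?_⟩)
      rw [h.entryTime_orbit_of_mem hxm hy.1, h.right.eq_base hsr hxm] at hz2
      have := h.right.le _ (hsr.base_mem hxm)
      have h1 := min_le_left (Tm (hsr.base x) - hsr.depth x + y) 3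
      have hnm : (0 : ℝ) ≤ Np := Nat.cast_nonneg _
      have : (hsr.depth x : ℝ) ≤ K := by linarith [hy.2]
      exact_mod_cast this
    · exact Or.inl fun h' ↦ h'.elim hxp hxm

/-- The level `1` of the attracting ends, pushed along the semiflow, is a closed collar. -/
theorem exists_collar_left :
    ∃ c : {z // exitTime g Gp Tp z = 1} × ℝ≥0 → MappingTorus g, IsClosedEmbedding c ∧
      (∀ q, exitTime g Gp Tp (c q) = 1 - q.2) ∧ range c = {z | exitTime g Gp Tp z ≤ 1} ∧
      ∀ b s t, suspensionSemiflow g t (c (b, s)) = c (b, s + t) := by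
  have hs := h.decomp.shift_left
  have := t2Space h.decomp.continuous
  let ψ := flow h.decomp.continuous
  let c : {z // exitTime g Gp Tp z = 1} × ℝ≥0 → MappingTorus g := fun q ↦ ψ q.2 q.1
  have hrep : ∀ b : {z // exitTime g Gp Tp z = 1}, ∃ x ∈ Gp, ∃ y ∈ Ico (0 : ℝ) 1,
      b.1 = orbit g x y ∧ Tp x - y = 1 ∧ ∀ s, c (b, s) = orbit g x (y + s) := by
    intro b
    obtain ⟨x, hx, y, hy, hb, hT⟩ := h.exists_of_exitTime_lt (z := b.1) (by rw [b.2]; norm_num)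
    refine ⟨x, hx, y, hy, hb, by rw [← hT, b.2], fun s ↦ ?_⟩
    change suspensionSemiflow g s b.1 = _
    rw [hb, suspensionSemiflow_orbit x hy.1]
  have htime : ∀ q, exitTime g Gp Tp (c q) = 1 - q.2 := by
    rintro ⟨b, s⟩
    obtain ⟨x, hx, y, hy, -, hT, hc⟩ := hrep b
    have := s.coe_nonneg
    rw [hc, h.exitTime_orbit_of_mem hx (add_nonneg hy.1 this), min_eq_left] <;>
    linarith
  have hcont : Continuous c := ψ.continuous continuous_snd (continuous_subtype_val.comp
    continuous_fst)
  have hcompact : CompactSpace {z // exitTime g Gp Tp z = 1} := by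
    refine isCompact_iff_compactSpace.1 ((h.isCompact_le_time 0).of_isClosed_subset
      (isClosed_eq h.continuous_exitTime continuous_const) ?_)
    intro z (hz : exitTime g Gp Tp z = 1)
    refine ⟨by rw [hz]; norm_num, ?_⟩
    rw [h.entryTime_eq_of_exitTime_lt (by rw [hz]; norm_num)]
    norm_num
  -- The collar coordinate is recovered from the exit time, and the level is compact.
  have hproper : IsProperMap c := by
    refine isProperMap_of_comp_of_t2 hcont
      (g := fun z ↦ (1 - exitTime g Gp Tp z).toNNReal)
      (continuous_real_toNNReal.comp (continuous_const.sub h.continuous_exitTime)) ?_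
    have : ((fun z ↦ (1 - exitTime g Gp Tp z).toNNReal) ∘ c) = Prod.snd := by
      funext q
      simp [htime q]
    rw [this]
    exact isProperMap_snd_of_compactSpace
  have hinj : Function.Injective c := by
    rintro ⟨b, s⟩ ⟨b', s'⟩ hq
    have hss : s = s' := by
      have h1 := htime (b, s)
      have h2 := htime (b', s')
      rw [hq, h2] at h1
      exact NNReal.coe_injective (by simpa using h1.symm)
    subst hss
    obtain ⟨x, hx, y, hy, hb, hT, hc⟩ := hrep b
    obtain ⟨x', hx', y', hy', hb', hT', hc'⟩ := hrep b'
    rw [hc, hc'] at hq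
    have hr := congrArg (rep g) hq
    rw [rep_orbit, rep_orbit, Prod.mk.injEq] at hr
    have hyy : y = y' := by
      have h1 : Int.fract y = Int.fract y' := by
        obtain ⟨n, hn⟩ := Int.fract_eq_fract.1 hr.2
        exact Int.fract_eq_fract.2 ⟨n, by linarith⟩
      rwa [Int.fract_eq_self.2 hy, Int.fract_eq_self.2 hy'] at h1
    subst hyy
    have hxx : x = x' := hs.injOn.iterate hs.mapsTo _ hx hx' hr.1
    rw [Prod.mk.injEq]
    exact ⟨Subtype.ext (by rw [hb, hb', hxx]), rfl⟩
  refine ⟨c, IsClosedEmbedding.of_continuous_injective_isClosedMap hcont hinj hproper.isClosedMap, htime, ?_, ?_⟩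
  · ext z
    constructor
    · rintro ⟨q, rfl⟩
      change exitTime g Gp Tp (c q) ≤ 1
      rw [htime]
      linarith [q.2.coe_nonneg]
    · intro hz
      change exitTime g Gp Tp z ≤ 1 at hz
      obtain ⟨x, hx, y, hy, rfl, hT⟩ := h.exists_of_exitTime_lt (z := z) (by linarith)
      have hb := hs.base_mem hx
      have h3 := h.left.three_le _ hb _ (mem_cc_cellOf _)
      have hbase := h.left.eq_base hs hx
      rw [hT] at hz
      -- The flow line of the point passes through the base point, whose height is at least `3`; it
      -- crosses level `1` at time `Tp (hs.base x) - 1`, and the remaining time is the collar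
      -- coordinate.
      have h0 : 0 ≤ Tp (hs.base x) - 1 := by linarith
      refine ⟨(⟨orbit g (hs.base x) (Tp (hs.base x) - 1), ?_⟩,
        ⟨hs.depth x + y - (Tp (hs.base x) - 1), ?_⟩), ?_⟩
      · rw [h.exitTime_orbit_of_mem hb.1 h0, min_eq_left] <;> linarith
      · linarith
      · refine (suspensionSemiflow_orbit _ h0 _).trans ?_
        change orbit g _ (_ + (hs.depth x + y - (Tp (hs.base x) - 1))) = _
        rw [show Tp (hs.base x) - 1 + (hs.depth x + y - (Tp (hs.base x) - 1)) = y + hs.depth x by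
          ring, orbit_add_nat _ hy.1, hs.iterate_base hx]
  · intro b s t
    change ψ t (ψ s b) = ψ (s + t) b
    rw [← ψ.map_add, add_comm]

/-- The level `1` of the repelling ends, pushed backward along the semiflow, is a closed collar. -/
theorem exists_collar_right :
    ∃ c : {z // entryTime g Gm Tm z = 1} × ℝ≥0 → MappingTorus g, IsClosedEmbedding c ∧
      (∀ q, entryTime g Gm Tm (c q) = 1 - q.2) ∧ range c = {z | entryTime g Gm Tm z ≤ 1} ∧
      ∀ b s t, suspensionSemiflow g t (c (b, s + t)) = c (b, s) := by
  have hs := h.decomp.shift_right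
  have := t2Space h.decomp.continuous
  let ψ := flow h.decomp.continuous
  let R : Set (MappingTorus g) := {z | entryTime g Gm Tm z ≤ 1}
  have hR : IsClosed R := isClosed_le h.continuous_entryTime continuous_const
  let τ : R → ℝ≥0 := fun z ↦ ⟨1 - entryTime g Gm Tm z, sub_nonneg.2 z.2⟩
  have hτ : Continuous τ := Continuous.subtype_mk
    (continuous_const.sub (h.continuous_entryTime.comp continuous_subtype_val)) _
  have hlevel : ∀ z : R, entryTime g Gm Tm (ψ (τ z) z) = 1 := by
    intro z
    change entryTime g Gm Tm (suspensionSemiflow g (τ z) z) = 1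
    rw [h.entryTime_flow]
    change min (_ + (1 - entryTime g Gm Tm z)) 3 = 1
    rw [add_sub_cancel]
    norm_num
  -- The semiflow cannot be run backward, so the collar is obtained as the inverse of the map that
  -- waits until level `1` is reached.
  let F : R → {z // entryTime g Gm Tm z = 1} × ℝ≥0 := fun z ↦ (⟨ψ (τ z) z, hlevel z⟩, τ z)
  have hF : Continuous F :=
    (Continuous.subtype_mk (ψ.continuous hτ continuous_subtype_val) _).prodMk hτ
  have hinj : Function.Injective F := by
    intro z z' hzz'
    have h1 : τ z = τ z' := congrArg Prod.snd hzz'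
    have h2 : ψ (τ z) z = ψ (τ z') z' := congrArg Subtype.val (congrArg Prod.fst hzz')
    rw [← h1] at h2
    have hz1 : entryTime g Gm Tm (z : MappingTorus g) ≤ 1 := z.2
    have hz1' : entryTime g Gm Tm (z' : MappingTorus g) ≤ 1 := z'.2
    obtain ⟨x, hx, y, hy, hz, hT⟩ := h.exists_of_entryTime_lt (z := z.1) (by linarith)
    obtain ⟨x', hx', y', hy', hz', hT'⟩ := h.exists_of_entryTime_lt (z := z'.1) (by linarith)
    have hl := hlevel z
    change suspensionSemiflow g (τ z) z.1 = suspensionSemiflow g (τ z) z'.1 at h2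
    change entryTime g Gm Tm (suspensionSemiflow g (τ z) z.1) = 1 at hl
    rw [hz, hz', suspensionSemiflow_orbit _ hy.1, suspensionSemiflow_orbit _ hy'.1] at h2
    rw [hz, suspensionSemiflow_orbit _ hy.1] at hl
    obtain ⟨w, hw, y'', hy'', hwz, -⟩ := h.exists_of_entryTime_lt (z := orbit g x (y + τ z))
      (by rw [hl]; norm_num)
    have hr := congrArg (rep g) h2
    have hrw := congrArg (rep g) hwz
    rw [rep_orbit, rep_orbit, Prod.mk.injEq] at hr
    rw [rep_orbit, rep_orbit_of_mem hy'', Prod.mk.injEq] at hrw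
    have hyy : y = y' := by
      have h1 : Int.fract y = Int.fract y' := by
        obtain ⟨n, hn⟩ := Int.fract_eq_fract.1 hr.2
        exact Int.fract_eq_fract.2 ⟨n, by linarith⟩
      rwa [Int.fract_eq_self.2 hy, Int.fract_eq_self.2 hy'] at h1
    subst hyy
    -- Waiting loses no information, because it ends above `Gm`, where `θ` undoes each application
    -- of `g`.
    have hxx : x = x' := by
      rw [← h.inverse_iterate (x := x) (n := ⌊y + τ z⌋₊) (by rw [hrw.1]; exact hw),
        ← h.inverse_iterate (x := x') (n := ⌊y + τ z⌋₊) (by rw [← hr.1, hrw.1]; exact hw), hr.1]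
    exact Subtype.ext (by rw [hz, hz', hxx])
  have hsurj : Function.Surjective F := by
    rintro ⟨⟨b, hb⟩, s⟩
    obtain ⟨x, hx, y, hy, rfl, hT⟩ := h.exists_of_entryTime_lt (z := b) (by rw [hb]; norm_num)
    -- Starting `n ≥ s` steps earlier along `θ` makes the time `y + n - s` nonnegative.
    obtain ⟨n, hn⟩ := exists_nat_ge (s : ℝ)
    have h0 : 0 ≤ y + n - s := by linarith [hy.1]
    rw [hT] at hb
    have hz : entryTime g Gm Tm (orbit g (θ^[n] x) (y + n - s)) = 1 - s := by
      rw [h.entryTime_orbit_of_mem (hs.iterate_mem hx n) h0, h.right.iterate hs hx, min_eq_left]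
      · linarith
      · linarith [s.coe_nonneg]
    refine ⟨⟨orbit g (θ^[n] x) (y + n - s), ?_⟩, ?_⟩
    · change entryTime g Gm Tm _ ≤ 1
      rw [hz]
      linarith [s.coe_nonneg]
    · have hτz : ∀ hm, τ ⟨orbit g (θ^[n] x) (y + n - s), hm⟩ = s := fun hm ↦
        NNReal.coe_injective (by
          change 1 - entryTime g Gm Tm (orbit g (θ^[n] x) (y + n - s)) = s
          rw [hz]; ring)
      refine Prod.ext (Subtype.ext ?_) (hτz _)
      refine (congrArg (fun t ↦ suspensionSemiflow g t (orbit g (θ^[n] x) (y + n - s)))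
        (hτz _)).trans ?_
      rw [ suspensionSemiflow_orbit _ h0, sub_add_cancel, orbit_add_nat _ hy.1,
        h.iterate_inverse hx]
  have hproper : IsProperMap F := by
    have hsnd : IsProperMap τ := by
      rw [isProperMap_iff_isCompact_preimage]
      refine ⟨hτ, fun K hK ↦ ?_⟩
      obtain ⟨M, hM⟩ := hK.bddAbove
      have hcpt : IsCompact {z | entryTime g Gm Tm z ≤ 1 ∧ -(M : ℝ) ≤ entryTime g Gm Tm z} := by
        refine (h.isCompact_le_time M).of_isClosed_subset (hR.inter
          (isClosed_le continuous_const h.continuous_entryTime)) ?_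
        rintro z ⟨hz1, hz2⟩
        refine ⟨?_, hz2⟩
        rw [h.exitTime_eq_of_entryTime_lt (by linarith)]
        linarith [M.coe_nonneg]
      refine (hR.isClosedEmbedding_subtypeVal.isCompact_preimage hcpt).of_isClosed_subset
        (hK.isClosed.preimage hτ) ?_
      intro z hz
      refine ⟨z.2, ?_⟩
      have : ((1 - entryTime g Gm Tm z : ℝ)) ≤ M := hM hz
      linarith
    exact isProperMap_of_comp_of_t2 hF continuous_snd hsnd
  let e := Equiv.ofBijective F ⟨hinj, hsurj⟩
  have hFe : IsClosedEmbedding F := IsClosedEmbedding.of_continuous_injective_isClosedMap hF hinj hproper.isClosedMap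
  let H : R ≃ₜ {z // entryTime g Gm Tm z = 1} × ℝ≥0 := e.toHomeomorphOfContinuousClosed hF
    hFe.isClosedMap
  have hHF : ∀ z, H z = F z := fun z ↦ rfl
  have hsymm : ∀ q, F (H.symm q) = q := fun q ↦ H.apply_symm_apply q
  have htime : ∀ q, entryTime g Gm Tm (H.symm q : R) = 1 - q.2 := by
    intro q
    have h1 := congrArg (fun q ↦ (q.2 : ℝ)) (hsymm q)
    change 1 - entryTime g Gm Tm (H.symm q : R) = q.2 at h1
    linarith
  refine ⟨fun q ↦ (H.symm q : R), hR.isClosedEmbedding_subtypeVal.comp H.symm.isClosedEmbedding,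
    htime, ?_, ?_⟩
  · ext z
    constructor
    · rintro ⟨q, rfl⟩
      exact (H.symm q).2
    · intro hz
      exact ⟨H ⟨z, hz⟩, by simp⟩
  · intro b s t
    have hmem : entryTime g Gm Tm (suspensionSemiflow g t (H.symm (b, s + t) : R)) = 1 - s := by
      rw [h.entryTime_flow, htime]
      push_cast
      rw [min_eq_left] <;> linarith [s.coe_nonneg]
    have hmemR : suspensionSemiflow g t (H.symm (b, s + t) : R) ∈ R := by
      change entryTime g Gm Tm _ ≤ 1
      rw [hmem]
      linarith [s.coe_nonneg]
    have hτz : τ ⟨_, hmemR⟩ = s := NNReal.coe_injective (by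
      change 1 - entryTime g Gm Tm _ = s
      rw [hmem]; ring)
    have hfst := congrArg (fun q ↦ (q.1 : MappingTorus g)) (hsymm (b, s + t))
    have hsnd : τ (H.symm (b, s + t)) = s + t := congrArg Prod.snd (hsymm (b, s + t))
    change ψ (τ (H.symm (b, s + t))) (H.symm (b, s + t) : R) = b at hfst
    rw [hsnd, ψ.map_add] at hfst
    have hFz : F ⟨_, hmemR⟩ = (b, s) := by
      refine Prod.ext (Subtype.ext ?_) hτz
      change ψ (τ ⟨_, hmemR⟩) _ = _
      rw [hτz]
      exact hfst
    have := congrArg H.symm hFz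
    rw [← hHF, H.symm_apply_apply] at this
    exact congrArg Subtype.val this

end Heights

end Times

end GraphCells

/-! ### Compactifying collars -/

namespace Collar

/-- An increasing homeomorphism from `[0, ∞]` to `[0, 1]`. -/
noncomputable def squeeze (s : ℝ≥0∞) : ℝ≥0 :=
  ⟨(ENNReal.orderIsoUnitIntervalBirational s : ℝ), (ENNReal.orderIsoUnitIntervalBirational s).2.1⟩

lemma squeeze_strictMono : StrictMono squeeze := fun _ _ h ↦
  ENNReal.orderIsoUnitIntervalBirational.strictMono h

lemma continuous_squeeze : Continuous squeeze :=
  (continuous_subtype_val.comp ENNReal.orderIsoUnitIntervalBirational.continuous).subtype_mk _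

lemma isClosedEmbedding_squeeze : IsClosedEmbedding squeeze :=
  continuous_squeeze.isClosedEmbedding squeeze_strictMono.injective

lemma squeeze_le (s : ℝ≥0∞) : squeeze s ≤ 1 := (ENNReal.orderIsoUnitIntervalBirational s).2.2

lemma squeeze_top : squeeze ∞ = 1 :=
  congrArg (fun x : Icc (0 : ℝ) 1 ↦ (⟨x, x.2.1⟩ : ℝ≥0))
    ENNReal.orderIsoUnitIntervalBirational.map_top

lemma squeeze_zero : squeeze 0 = 0 :=
  congrArg (fun x : Icc (0 : ℝ) 1 ↦ (⟨x, x.2.1⟩ : ℝ≥0))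
    ENNReal.orderIsoUnitIntervalBirational.map_bot

lemma squeeze_pos {s : ℝ≥0∞} : 0 < squeeze s ↔ 0 < s := by
  simpa only [squeeze_zero] using squeeze_strictMono.lt_iff_lt (a := 0) (b := s)

lemma exists_squeeze_eq {r : ℝ≥0} (hr : r ≤ 1) : ∃ s, squeeze s = r :=
  ⟨ENNReal.orderIsoUnitIntervalBirational.symm ⟨r, r.2, hr⟩, Subtype.ext (by
    change ((ENNReal.orderIsoUnitIntervalBirational
      (ENNReal.orderIsoUnitIntervalBirational.symm ⟨r, r.2, hr⟩) : Icc (0 : ℝ) 1) : ℝ) = r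
    rw [OrderIso.apply_symm_apply])⟩

/-- A continuous function which is inverse to `squeeze` on `[0, squeeze n]`. -/
noncomputable def stretch (n : ℝ≥0) (r : ℝ≥0) : ℝ≥0 :=
  (min (ENNReal.orderIsoUnitIntervalBirational.symm (projIcc 0 1 zero_le_one (r : ℝ))) n).toNNReal

lemma continuous_stretch (n : ℝ≥0) : Continuous (stretch n) := by
  refine ENNReal.continuousOn_toNNReal.comp_continuous ?_
    fun r ↦ ne_top_of_le_ne_top ENNReal.coe_ne_top (min_le_right _ _)
  exact (ENNReal.orderIsoUnitIntervalBirational.symm.continuous.comp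
    (continuous_projIcc.comp NNReal.continuous_coe)).min continuous_const

lemma stretch_squeeze (n : ℝ≥0) (s : ℝ≥0) : stretch n (squeeze s) = min s n := by
  have h : projIcc 0 1 zero_le_one (squeeze s : ℝ) = ENNReal.orderIsoUnitIntervalBirational s :=
    projIcc_val zero_le_one _
  rw [stretch, h, OrderIso.symm_apply_apply]
  norm_cast

/-- The linear interpolation between the identity and `squeeze`. -/
noncomputable def interpolate (t : I) (s : ℝ≥0) : ℝ≥0 :=
  unitInterval.toNNReal t * s + unitInterval.toNNReal (unitInterval.symm t) * squeeze s

lemma continuous_interpolate : Continuous fun p : I × ℝ≥0 ↦ interpolate p.1 p.2 := by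
  have h : Continuous fun p : I × ℝ≥0 ↦ squeeze p.2 :=
    continuous_squeeze.comp (ENNReal.continuous_coe.comp continuous_snd)
  have h1 : Continuous unitInterval.toNNReal := by fun_prop
  exact ((h1.comp continuous_fst).mul continuous_snd).add
    ((h1.comp (unitInterval.continuous_symm.comp continuous_fst)).mul h)

lemma interpolate_apply_zero (t : I) : interpolate t 0 = 0 := by
  simp [interpolate, squeeze_zero]

lemma interpolate_zero : interpolate 0 = fun s : ℝ≥0 ↦ squeeze s := by
  funext s
  simp [interpolate]

lemma interpolate_one : interpolate 1 = id := by
  funext s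
  simp [interpolate]

lemma interpolate_le (t : I) {s : ℝ≥0} (hs : s ≤ 1) : interpolate t s ≤ 1 := by
  have h1 := squeeze_le s
  have h : unitInterval.toNNReal t + unitInterval.toNNReal (unitInterval.symm t) = 1 :=
    NNReal.coe_injective (by simp)
  calc interpolate t s ≤ unitInterval.toNNReal t * 1 +
        unitInterval.toNNReal (unitInterval.symm t) * 1 := by
        unfold interpolate
        gcongr
    _ = 1 := by rw [mul_one, mul_one, h]

/-- The change of the collar coordinate by `ρ`. -/
noncomputable def reparam {Z B : Type*} (c : B × ℝ≥0 → Z) (ρ : ℝ≥0 → ℝ≥0) (z : Z) : Z := by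
  classical
  exact if h : ∃ q, c q = z then c (h.choose.1, ρ h.choose.2) else z

lemma reparam_of_notMem {Z B : Type*} {c : B × ℝ≥0 → Z} (ρ : ℝ≥0 → ℝ≥0) {z : Z} (hz : z ∉ range c) :
    reparam c ρ z = z := dif_neg hz

/-- What remains when the part of the collar beyond `1` is removed. -/
def truncation {Z B : Type*} (c : B × ℝ≥0 → Z) : Set Z := (c '' {q | 1 < q.2})ᶜ

variable {Z B : Type*} [TopologicalSpace Z] [TopologicalSpace B]

/-- A closed embedding of `B × [0, ∞)` which is open away from `B × {0}`. -/
structure IsCollar (c : B × ℝ≥0 → Z) : Prop where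
  isClosedEmbedding : IsClosedEmbedding c
  isOpen : IsOpen (c '' {q | 0 < q.2})

namespace IsCollar

variable {c : B × ℝ≥0 → Z} (hc : IsCollar c)

include hc

lemma reparam_apply (ρ : ℝ≥0 → ℝ≥0) (q : B × ℝ≥0) : reparam c ρ (c q) = c (q.1, ρ q.2) := by
  have h : ∃ q', c q' = c q := ⟨q, rfl⟩
  rw [reparam, dif_pos h, hc.isClosedEmbedding.injective h.choose_spec]

lemma reparam_id (z : Z) : reparam c id z = z := by
  by_cases h : z ∈ range c
  · obtain ⟨q, rfl⟩ := h
    exact hc.reparam_apply _ _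
  · exact reparam_of_notMem _ h

lemma reparam_of_zero {ρ : ℝ≥0 → ℝ≥0} (h0 : ρ 0 = 0) {z : Z} (hz : z ∉ c '' {q | 0 < q.2}) :
    reparam c ρ z = z := by
  by_cases h : z ∈ range c
  · obtain ⟨⟨b, s⟩, rfl⟩ := h
    have hs : s = 0 := by
      by_contra hs
      exact hz (mem_image_of_mem c (show (b, s) ∈ {q : B × ℝ≥0 | 0 < q.2} from pos_iff_ne_zero.2 hs))
    subst hs
    rw [hc.reparam_apply, h0]
  · exact reparam_of_notMem ρ h

/-- The closed sets `range c` and the complement of the open part of the collar cover `Z`. On the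
second one the map is the identity, because every `ρ t` fixes `0`. -/
lemma continuous_reparam {T : Type*} [TopologicalSpace T] {ρ : T → ℝ≥0 → ℝ≥0}
    (hρ : Continuous fun p : T × ℝ≥0 ↦ ρ p.1 p.2) (h0 : ∀ t, ρ t 0 = 0) :
    Continuous fun p : T × Z ↦ reparam c (ρ p.1) p.2 := by
  have hemb : IsClosedEmbedding (Prod.map id c : T × (B × ℝ≥0) → T × Z) :=
    IsClosedEmbedding.id.prodMap hc.isClosedEmbedding
  have hrange : ContinuousOn (fun p : T × Z ↦ reparam c (ρ p.1) p.2)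
      (range (Prod.map id c : T × (B × ℝ≥0) → T × Z)) := by
    rw [← image_univ, hemb.isInducing.continuousOn_image_iff, continuousOn_univ]
    have : ((fun p : T × Z ↦ reparam c (ρ p.1) p.2) ∘ Prod.map id c) =
        fun p : T × (B × ℝ≥0) ↦ c (p.2.1, ρ p.1 p.2.2) :=
      funext fun p ↦ hc.reparam_apply _ _
    rw [this]
    exact hc.isClosedEmbedding.continuous.comp ((continuous_fst.comp continuous_snd).prodMk
      (hρ.comp (continuous_fst.prodMk (continuous_snd.comp continuous_snd))))
  have hcompl : ContinuousOn (fun p : T × Z ↦ reparam c (ρ p.1) p.2)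
      (univ ×ˢ (c '' {q | 0 < q.2})ᶜ) :=
    continuousOn_snd.congr fun p hp ↦ hc.reparam_of_zero (h0 p.1) hp.2
  have := hrange.union_of_isClosed hcompl hemb.isClosed_range
    (isClosed_univ.prod hc.isOpen.isClosed_compl)
  rw [← continuousOn_univ]
  refine this.mono fun p _ ↦ ?_
  by_cases hp : p.2 ∈ range c
  · obtain ⟨q, hq⟩ := hp
    exact Or.inl ⟨(p.1, q), Prod.ext rfl hq⟩
  · exact Or.inr ⟨trivial, fun h ↦ hp (image_subset_range _ _ h)⟩

lemma mem_truncation (q : B × ℝ≥0) : c q ∈ truncation c ↔ q.2 ≤ 1 := by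
  rw [truncation, mem_compl_iff, hc.isClosedEmbedding.injective.mem_set_image]
  exact not_lt (a := 1) (b := q.2)

lemma reparam_mem_truncation {ρ : ℝ≥0 → ℝ≥0} {z : Z} (h : ∀ q, c q = z → ρ q.2 ≤ 1) :
    reparam c ρ z ∈ truncation c := by
  by_cases hz : z ∈ range c
  · obtain ⟨q, rfl⟩ := hz
    rw [hc.reparam_apply, hc.mem_truncation]
    exact h q rfl
  · rw [reparam_of_notMem ρ hz]
    exact fun h ↦ hz (image_subset_range _ _ h)

/-- The space, with the collar squeezed, inside of its truncation. -/
noncomputable def inclusion (z : Z) : truncation c :=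
  ⟨reparam c (fun s ↦ squeeze s) z, hc.reparam_mem_truncation fun _ _ ↦ squeeze_le _⟩

/-- The compactified collar. -/
noncomputable def compactified (q : B × ℝ≥0∞) : truncation c :=
  ⟨c (q.1, squeeze q.2), (hc.mem_truncation _).2 (squeeze_le _)⟩

lemma coe_inclusion (z : Z) : (hc.inclusion z : Z) = reparam c (fun s ↦ squeeze s) z := rfl

lemma inclusion_apply (b : B) (s : ℝ≥0) : hc.inclusion (c (b, s)) = hc.compactified (b, s) :=
  Subtype.ext ((hc.coe_inclusion _).trans (hc.reparam_apply _ _))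

lemma inclusion_of_notMem {z : Z} (hz : z ∉ range c) : (hc.inclusion z : Z) = z :=
  (hc.coe_inclusion z).trans (reparam_of_notMem _ hz)

lemma continuous_inclusion : Continuous hc.inclusion := by
  refine Continuous.subtype_mk ?_ _
  exact (hc.continuous_reparam (T := Unit) (ρ := fun _ s ↦ squeeze s)
    (continuous_squeeze.comp (ENNReal.continuous_coe.comp continuous_snd))
    fun _ ↦ squeeze_zero).comp (continuous_const.prodMk continuous_id : Continuous fun z ↦ ((), z))

lemma isClosedEmbedding_compactified : IsClosedEmbedding hc.compactified := by
  have h : IsClosedEmbedding (Subtype.val ∘ hc.compactified) :=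
    hc.isClosedEmbedding.comp (IsClosedEmbedding.id.prodMap isClosedEmbedding_squeeze)
  refine ⟨h.isEmbedding.of_comp (Continuous.subtype_mk h.continuous _) continuous_subtype_val, ?_⟩
  have := h.isClosed_range.preimage (continuous_subtype_val (p := (· ∈ truncation c)))
  rwa [range_comp, preimage_image_eq _ Subtype.val_injective] at this

lemma isOpen_image_compactified {A : Set (B × ℝ≥0∞)} (hA : IsOpen A) (h : A ⊆ {q | 0 < q.2}) :
    IsOpen (hc.compactified '' A) := by
  have hpos : IsOpen (hc.compactified '' {q | 0 < q.2}) := by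
    convert hc.isOpen.preimage continuous_subtype_val using 1
    ext w
    constructor
    · rintro ⟨q, hq, rfl⟩
      exact ⟨(q.1, squeeze q.2), squeeze_pos.2 hq, rfl⟩
    · rintro ⟨⟨b, r⟩, hr, hw⟩
      have hr1 : r ≤ 1 := (hc.mem_truncation (b, r)).1 (by rw [hw]; exact w.2)
      obtain ⟨s, rfl⟩ := exists_squeeze_eq hr1
      exact ⟨(b, s), squeeze_pos.1 hr, Subtype.ext hw⟩
  obtain ⟨O, hO, rfl⟩ := hc.isClosedEmbedding_compactified.isInducing.isOpen_iff.1 hA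
  rw [← inter_eq_left.2 h, image_preimage_inter]
  exact hO.inter hpos

lemma inclusion_injective : Function.Injective hc.inclusion := by
  have key : ∀ q z, z ∉ range c → hc.inclusion (c q) ≠ hc.inclusion z := by
    intro q z hz h
    have := congrArg Subtype.val h
    rw [hc.inclusion_of_notMem hz] at this
    exact hz ⟨(q.1, squeeze q.2), by rw [← this, hc.inclusion_apply]; rfl⟩
  intro z z' h
  by_cases hz : z ∈ range c
  · obtain ⟨q, rfl⟩ := hz
    by_cases hz' : z' ∈ range c
    · obtain ⟨q', rfl⟩ := hz'
      have := hc.isClosedEmbedding_compactified.injective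
        (((hc.inclusion_apply q.1 q.2).symm.trans h).trans (hc.inclusion_apply q'.1 q'.2))
      rw [Prod.mk.injEq] at this
      rw [show q = q' from Prod.ext this.1 (ENNReal.coe_injective this.2)]
    · exact (key _ _ hz' h).elim
  · by_cases hz' : z' ∈ range c
    · obtain ⟨q', rfl⟩ := hz'
      exact (key _ _ hz h.symm).elim
    · rw [← hc.inclusion_of_notMem hz, h, hc.inclusion_of_notMem hz']

/-- There is a continuous inverse near each point: if the collar coordinate of `z` is less than `n`,
then `stretch n` undoes `squeeze` on coordinates up to `n`, and the points with smaller coordinate,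
together with those outside of the collar, form a neighborhood of `z`. -/
lemma isEmbedding_inclusion : IsEmbedding hc.inclusion := by
  refine ⟨isInducing_iff_nhds.2 fun z ↦ le_antisymm hc.continuous_inclusion.continuousAt.le_comap ?_,
    hc.inclusion_injective⟩
  obtain ⟨n, hn⟩ : ∃ n : ℝ≥0, ∀ q, c q = z → q.2 < n := by
    by_cases hz : z ∈ range c
    · obtain ⟨q, rfl⟩ := hz
      exact ⟨q.2 + 1, fun q' h ↦ by
        rw [hc.isClosedEmbedding.injective h]; exact lt_add_one _⟩
    · exact ⟨0, fun q h ↦ (hz ⟨q, h⟩).elim⟩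
  have hcont : Continuous fun w : truncation c ↦ reparam c (stretch n) w :=
    (hc.continuous_reparam (T := Unit) (ρ := fun _ ↦ stretch n)
      ((continuous_stretch n).comp continuous_snd) fun _ ↦ by
        have := stretch_squeeze n 0
        simpa [squeeze_zero] using this).comp
      (continuous_const.prodMk continuous_subtype_val :
        Continuous fun w : truncation c ↦ ((), (w : Z)))
  have hcomp : ∀ z, reparam c (stretch n) (hc.inclusion z) = reparam c (fun s ↦ min s n) z := by
    intro z
    by_cases hz : z ∈ range c
    · obtain ⟨⟨b, s⟩, rfl⟩ := hz
      rw [hc.inclusion_apply, hc.reparam_apply]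
      change reparam c _ (c (b, squeeze s)) = _
      rw [hc.reparam_apply, stretch_squeeze]
    · rw [hc.inclusion_of_notMem hz, reparam_of_notMem _ hz, reparam_of_notMem _ hz]
  have hclosed : IsClosed (c '' {q | n ≤ q.2}) :=
    hc.isClosedEmbedding.isClosedMap _ (isClosed_le continuous_const continuous_snd)
  have hzn : z ∈ (c '' {q | n ≤ q.2})ᶜ := by
    rintro ⟨q, hq, hqz⟩
    exact (hn q hqz).not_ge hq
  have hid : ∀ w ∈ (c '' {q | n ≤ q.2})ᶜ, reparam c (fun s ↦ min s n) w = w := by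
    intro w hw
    by_cases hwc : w ∈ range c
    · obtain ⟨q, rfl⟩ := hwc
      rw [hc.reparam_apply, min_eq_left]
      by_contra h
      exact hw ⟨q, (not_le.1 h).le, rfl⟩
    · exact reparam_of_notMem _ hwc
  have hid' : ∀ w, reparam c (fun s ↦ min s n) w ∈ (c '' {q | n ≤ q.2})ᶜ →
      w ∈ (c '' {q | n ≤ q.2})ᶜ := by
    rintro w hw ⟨q, hq, rfl⟩
    rw [hc.reparam_apply] at hw
    exact hw ⟨(q.1, min q.2 n), le_min (show n ≤ q.2 from hq) le_rfl, rfl⟩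
  intro U hU
  have hV : U ∩ (c '' {q | n ≤ q.2})ᶜ ∈ 𝓝 (reparam c (stretch n) (hc.inclusion z)) := by
    rw [hcomp, hid z hzn]
    exact Filter.inter_mem hU (hclosed.isOpen_compl.mem_nhds hzn)
  refine ⟨_, hcont.continuousAt.preimage_mem_nhds hV, fun w hw ↦ ?_⟩
  change reparam c (stretch n) (hc.inclusion w) ∈ U ∩ (c '' {q | n ≤ q.2})ᶜ at hw
  rw [hcomp] at hw
  have := hid w (hid' w hw.2)
  rw [this] at hw
  exact hw.1

/-- `squeeze` takes the value `1` only at `∞`, and maps onto `[0, 1]`. -/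
lemma range_inclusion : range hc.inclusion = (hc.compactified '' {q | q.2 = ∞})ᶜ := by
  ext w
  constructor
  · rintro ⟨z, rfl⟩ ⟨⟨b, s⟩, hs, h⟩
    obtain rfl : s = ∞ := hs
    by_cases hz : z ∈ range c
    · obtain ⟨q, rfl⟩ := hz
      have := hc.isClosedEmbedding_compactified.injective (h.trans (hc.inclusion_apply q.1 q.2))
      exact ENNReal.coe_ne_top (congrArg Prod.snd this).symm
    · have := congrArg Subtype.val h
      rw [hc.inclusion_of_notMem hz] at this
      exact hz ⟨_, this⟩
  · intro hw
    by_cases h : (w : Z) ∈ range c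
    · obtain ⟨⟨b, r⟩, hr⟩ := h
      have hr1 : r ≤ 1 := (hc.mem_truncation (b, r)).1 (by rw [hr]; exact w.2)
      obtain ⟨s, rfl⟩ := exists_squeeze_eq hr1
      have hs : s ≠ ∞ := fun hs ↦ hw ⟨(b, s), hs, Subtype.ext hr⟩
      lift s to ℝ≥0 using hs
      exact ⟨c (b, s), (hc.inclusion_apply b s).trans (Subtype.ext hr)⟩
    · exact ⟨w, Subtype.ext (hc.inclusion_of_notMem h)⟩

lemma isOpenEmbedding_inclusion : IsOpenEmbedding hc.inclusion := by
  refine ⟨hc.isEmbedding_inclusion, ?_⟩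
  rw [range_inclusion]
  exact (hc.isClosedEmbedding_compactified.isClosedMap _
    (isClosed_eq continuous_snd continuous_const)).isOpen_compl

/-- Squeezing the collar is a homotopy equivalence. -/
noncomputable def homotopyEquiv : Z ≃ₕ truncation c where
  toFun := ⟨hc.inclusion, hc.continuous_inclusion⟩
  -- Both composites are the squeezing map, on `Z` and on the truncation. Interpolated coordinates
  -- starting at most `1` stay at most `1`, so the second homotopy does not leave the truncation.
  invFun := ⟨Subtype.val, continuous_subtype_val⟩
  left_inv := ⟨{
    toFun := fun p ↦ reparam c (interpolate p.1) p.2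
    continuous_toFun := hc.continuous_reparam continuous_interpolate interpolate_apply_zero
    map_zero_left := fun z ↦ congrArg (reparam c · z) interpolate_zero
    map_one_left := fun z ↦ (congrArg (reparam c · z) interpolate_one).trans (hc.reparam_id z) }⟩
  right_inv := ⟨{
    toFun := fun p ↦ ⟨reparam c (interpolate p.1) p.2, hc.reparam_mem_truncation (by
      intro q hq
      refine interpolate_le p.1 ((hc.mem_truncation q).1 ?_)
      exact hq ▸ p.2.2)⟩
    continuous_toFun := ((hc.continuous_reparam continuous_interpolate
      interpolate_apply_zero).comp (continuous_fst.prodMk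
        (continuous_subtype_val.comp continuous_snd))).subtype_mk _
    map_zero_left := fun z ↦ Subtype.ext (congrArg (reparam c · (z : Z)) interpolate_zero)
    map_one_left := fun z ↦ Subtype.ext
      ((congrArg (reparam c · (z : Z)) interpolate_one).trans (hc.reparam_id z)) }⟩

end IsCollar

end Collar

/-! ### Extending a semiflow over compactified collars -/

namespace Collar

variable {Z P M : Type*}

/-- The union of two collars. -/
def combined (cp : P × ℝ≥0 → Z) (cm : M × ℝ≥0 → Z) (q : (P ⊕ M) × ℝ≥0) : Z :=
  Sum.elim (fun b ↦ cp (b, q.2)) (fun b ↦ cm (b, q.2)) q.1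

lemma combined_image (cp : P × ℝ≥0 → Z) (cm : M × ℝ≥0 → Z) (S : Set ℝ≥0) :
    combined cp cm '' {q | q.2 ∈ S} = cp '' {q | q.2 ∈ S} ∪ cm '' {q | q.2 ∈ S} := by
  ext z
  constructor
  · rintro ⟨⟨b | b, s⟩, hs, rfl⟩
    · exact Or.inl ⟨(b, s), hs, rfl⟩
    · exact Or.inr ⟨(b, s), hs, rfl⟩
  · rintro (⟨⟨b, s⟩, hs, rfl⟩ | ⟨⟨b, s⟩, hs, rfl⟩)
    · exact ⟨(Sum.inl b, s), hs, rfl⟩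
    · exact ⟨(Sum.inr b, s), hs, rfl⟩

/-- The collar is a neighborhood of its top end, so continuity there may be tested in the
coordinates of the collar. -/
lemma continuousAt_of_comp {W B Y : Type*} [TopologicalSpace W] [TopologicalSpace B] [TopologicalSpace Y]
    {k : B × ℝ≥0∞ → W} (hk : IsEmbedding k)
    (ho : IsOpen (k '' {q | 0 < q.2})) {F : ℝ≥0 × W → Y} {t : ℝ≥0}
    {b : B} (hF : ContinuousAt (fun p : ℝ≥0 × (B × ℝ≥0∞) ↦ F (p.1, k p.2)) (t, (b, ∞))) :
    ContinuousAt F (t, k (b, ∞)) := by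
  have hemb : IsEmbedding (Prod.map id k : ℝ≥0 × (B × ℝ≥0∞) → _) := IsEmbedding.id.prodMap hk
  have hmem : range (Prod.map id k : ℝ≥0 × (B × ℝ≥0∞) → _) ∈
      𝓝 (Prod.map id k (t, (b, ∞))) := by
    rw [range_prodMap, range_id]
    refine prod_mem_nhds Filter.univ_mem ?_
    exact Filter.mem_of_superset (ho.mem_nhds (mem_image_of_mem k
      (show (0 : ℝ≥0∞) < ∞ from ENNReal.zero_lt_top))) (image_subset_range _ _)
  have := hemb.map_nhds_of_mem _ hmem
  change Filter.Tendsto F (𝓝 (Prod.map id k (t, (b, ∞)))) _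
  rw [← this]
  exact hF

variable [TopologicalSpace Z] [TopologicalSpace P] [TopologicalSpace M]

/-- Two disjoint collars, on which a semiflow is translation away from and towards the base. -/
structure IsFlowCollars (ψ : Flow ℝ≥0 Z) (cp : P × ℝ≥0 → Z) (cm : M × ℝ≥0 → Z) : Prop where
  left : IsCollar cp
  right : IsCollar cm
  disjoint : ∀ p q, cp p ≠ cm q
  flow_left : ∀ b s t, ψ t (cp (b, s)) = cp (b, s + t)
  flow_right : ∀ b s t, ψ t (cm (b, s + t)) = cm (b, s)

/-- The top end of a product neighborhood `B × [0, ∞]` is homeomorphic to `B`. -/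
lemma exists_coorientation {W B : Type*} [TopologicalSpace W] [TopologicalSpace B]
    {k : B × ℝ≥0∞ → W} (hk : IsEmbedding k) (ho : IsOpen (k '' {q | 0 < q.2})) :
    ∃ c : (range fun b ↦ k (b, ∞)) × ℝ≥0∞ → W, IsEmbedding c ∧ IsOpen (c '' {q | 0 < q.2}) ∧
      (∀ x : range fun b ↦ k (b, ∞), c (x, ∞) = x) ∧ ∀ x, ∃ b, ∀ s, c (x, s) = k (b, s) := by
  have hemb : IsEmbedding fun b ↦ k (b, ∞) := hk.comp (isEmbedding_prodMkLeft ∞)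
  let H := hemb.toHomeomorph
  let e : (range fun b ↦ k (b, ∞)) × ℝ≥0∞ ≃ₜ B × ℝ≥0∞ := H.symm.prodCongr (Homeomorph.refl _)
  refine ⟨k ∘ e, hk.comp e.isEmbedding, ?_, fun x ↦ ?_, fun x ↦ ⟨H.symm x, fun s ↦ rfl⟩⟩
  · convert ho using 1
    rw [image_comp]
    congr 1
    ext q
    constructor
    · rintro ⟨q', hq', rfl⟩
      exact hq'
    · intro hq
      exact ⟨e.symm q, hq, e.apply_symm_apply q⟩
  · exact congrArg Subtype.val (H.apply_symm_apply x)

namespace IsFlowCollars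

variable {ψ : Flow ℝ≥0 Z} {cp : P × ℝ≥0 → Z} {cm : M × ℝ≥0 → Z} (h : IsFlowCollars ψ cp cm)

include h

lemma isCollar : IsCollar (combined cp cm) := by
  constructor
  · have hsum : IsClosedEmbedding (Sum.elim cp cm) := by
      refine h.left.isClosedEmbedding.sumElim h.right.isClosedEmbedding ?_
      exact Function.Injective.sumElim h.left.isClosedEmbedding.injective
        h.right.isClosedEmbedding.injective h.disjoint
    convert hsum.comp (Homeomorph.sumProdDistrib (X := P) (Y := M) (Z := ℝ≥0)).isClosedEmbedding
    ext ⟨b | b, s⟩ <;> rfl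
  · have := combined_image cp cm (Ioi 0)
    simp only [mem_Ioi] at this
    rw [this]
    exact h.left.isOpen.union h.right.isOpen

/-- The semiflow on the truncation, which fixes the ends of the collars. -/
noncomputable def extend (t : ℝ≥0) (w : truncation (combined cp cm)) :
    truncation (combined cp cm) := by
  classical
  exact if hw : ∃ z, h.isCollar.inclusion z = w then h.isCollar.inclusion (ψ t hw.choose) else w

/-- The compactified outgoing collar. -/
noncomputable def outgoing (q : P × ℝ≥0∞) : truncation (combined cp cm) :=
  h.isCollar.compactified (Sum.inl q.1, q.2)

/-- The compactified incoming collar. -/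
noncomputable def incoming (q : M × ℝ≥0∞) : truncation (combined cp cm) :=
  h.isCollar.compactified (Sum.inr q.1, q.2)

lemma extend_inclusion (t : ℝ≥0) (z : Z) :
    h.extend t (h.isCollar.inclusion z) = h.isCollar.inclusion (ψ t z) := by
  have hw : ∃ z', h.isCollar.inclusion z' = h.isCollar.inclusion z := ⟨z, rfl⟩
  rw [extend, dif_pos hw, h.isCollar.inclusion_injective hw.choose_spec]

lemma extend_top (t : ℝ≥0) (b : P ⊕ M) :
    h.extend t (h.isCollar.compactified (b, ∞)) = h.isCollar.compactified (b, ∞) := by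
  refine dif_neg ?_
  change h.isCollar.compactified (b, ∞) ∉ range h.isCollar.inclusion
  rw [h.isCollar.range_inclusion]
  exact fun h' ↦ h' (mem_image_of_mem _ rfl)

lemma inclusion_left (b : P) (s : ℝ≥0) : h.isCollar.inclusion (cp (b, s)) = h.outgoing (b, s) :=
  h.isCollar.inclusion_apply (Sum.inl b) s

lemma inclusion_right (b : M) (s : ℝ≥0) : h.isCollar.inclusion (cm (b, s)) = h.incoming (b, s) :=
  h.isCollar.inclusion_apply (Sum.inr b) s

lemma extend_outgoing (t : ℝ≥0) (b : P) (s : ℝ≥0∞) :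
    h.extend t (h.outgoing (b, s)) = h.outgoing (b, s + t) := by
  by_cases hs : s = ∞
  · subst hs
    rw [top_add]
    exact h.extend_top t _
  · lift s to ℝ≥0 using hs
    rw [← h.inclusion_left, extend_inclusion, h.flow_left, h.inclusion_left, ENNReal.coe_add]

lemma extend_incoming (t : ℝ≥0) (b : M) (s : ℝ≥0∞) :
    h.extend t (h.incoming (b, s + t)) = h.incoming (b, s) := by
  by_cases hs : s = ∞
  · subst hs
    rw [top_add]
    exact h.extend_top t _
  · lift s to ℝ≥0 using hs
    rw [← ENNReal.coe_add, ← h.inclusion_right, extend_inclusion, h.flow_right, h.inclusion_right]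

lemma isEmbedding_outgoing : IsEmbedding h.outgoing :=
  h.isCollar.isClosedEmbedding_compactified.isEmbedding.comp
    (IsEmbedding.inl.prodMap IsEmbedding.id)

lemma isEmbedding_incoming : IsEmbedding h.incoming :=
  h.isCollar.isClosedEmbedding_compactified.isEmbedding.comp
    (IsEmbedding.inr.prodMap IsEmbedding.id)

lemma isOpen_outgoing : IsOpen (h.outgoing '' {q | 0 < q.2}) := by
  have hmap : IsOpenMap (Prod.map Sum.inl id : P × ℝ≥0∞ → (P ⊕ M) × ℝ≥0∞) :=
    isOpenMap_inl.prodMap IsOpenMap.id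
  have := h.isCollar.isOpen_image_compactified
    (hmap {q | 0 < q.2} (isOpen_lt continuous_const continuous_snd)) (by
      rintro _ ⟨q, hq, rfl⟩
      exact hq)
  rwa [← image_comp] at this

lemma isOpen_incoming : IsOpen (h.incoming '' {q | 0 < q.2}) := by
  have hmap : IsOpenMap (Prod.map Sum.inr id : M × ℝ≥0∞ → (P ⊕ M) × ℝ≥0∞) :=
    isOpenMap_inr.prodMap IsOpenMap.id
  have := h.isCollar.isOpen_image_compactified
    (hmap {q | 0 < q.2} (isOpen_lt continuous_const continuous_snd)) (by
      rintro _ ⟨q, hq, rfl⟩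
      exact hq)
  rwa [← image_comp] at this

lemma exists_eq (w : truncation (combined cp cm)) :
    (∃ z, w = h.isCollar.inclusion z) ∨ (∃ b, w = h.outgoing (b, ∞)) ∨
      ∃ b, w = h.incoming (b, ∞) := by
  by_cases hw : w ∈ range h.isCollar.inclusion
  · obtain ⟨z, rfl⟩ := hw
    exact Or.inl ⟨z, rfl⟩
  · rw [h.isCollar.range_inclusion, notMem_compl_iff] at hw
    obtain ⟨⟨b | b, s⟩, hs, rfl⟩ := hw
    · obtain rfl : s = ∞ := hs
      exact Or.inr (Or.inl ⟨b, rfl⟩)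
    · obtain rfl : s = ∞ := hs
      exact Or.inr (Or.inr ⟨b, rfl⟩)

/-- On the open image of `Z` the map is conjugate to `ψ`. Near the added points it is a translation
of the collar coordinate, and translations extend continuously to `∞`. -/
lemma continuous_extend : Continuous fun p : ℝ≥0 × truncation (combined cp cm) ↦
    h.extend p.1 p.2 := by
  rw [continuous_iff_continuousAt]
  rintro ⟨t, w⟩
  rcases h.exists_eq w with ⟨z, rfl⟩ | ⟨b, rfl⟩ | ⟨b, rfl⟩
  · have hemb : IsOpenEmbedding (Prod.map id h.isCollar.inclusion : ℝ≥0 × Z → _) :=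
      IsOpenEmbedding.id.prodMap h.isCollar.isOpenEmbedding_inclusion
    refine (hemb.continuousAt_iff (x := (t, z))).1 (Continuous.continuousAt ?_)
    have : ((fun p : ℝ≥0 × truncation (combined cp cm) ↦ h.extend p.1 p.2) ∘
        Prod.map id h.isCollar.inclusion) = fun p ↦ h.isCollar.inclusion (ψ p.1 p.2) :=
      funext fun p ↦ h.extend_inclusion _ _
    rw [this]
    exact h.isCollar.continuous_inclusion.comp (ψ.continuous continuous_fst continuous_snd)
  · refine continuousAt_of_comp h.isEmbedding_outgoing h.isOpen_outgoing ?_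
    refine Continuous.continuousAt ?_
    have : (fun p : ℝ≥0 × (P × ℝ≥0∞) ↦ h.extend p.1 (h.outgoing p.2)) =
        fun p ↦ h.outgoing (p.2.1, p.2.2 + p.1) := funext fun p ↦ h.extend_outgoing _ _ _
    change Continuous fun p : ℝ≥0 × (P × ℝ≥0∞) ↦ h.extend p.1 (h.outgoing p.2)
    rw [this]
    exact h.isEmbedding_outgoing.continuous.comp (by fun_prop)
  · refine continuousAt_of_comp h.isEmbedding_incoming h.isOpen_incoming ?_
    -- On the incoming collar the flow is subtraction of time only as long as the coordinate exceeds
    -- the time, which holds near `∞`.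
    have hev : ∀ᶠ p : ℝ≥0 × (M × ℝ≥0∞) in 𝓝 (t, (b, ∞)),
        h.incoming (p.2.1, p.2.2 - p.1) = h.extend p.1 (h.incoming p.2) := by
      have hopen : IsOpen {p : ℝ≥0 × (M × ℝ≥0∞) | (p.1 : ℝ≥0∞) < p.2.2} :=
        isOpen_lt (by fun_prop) (by fun_prop)
      filter_upwards [hopen.mem_nhds (show ((t : ℝ≥0∞) < ∞) from ENNReal.coe_lt_top)] with p hp
      have hp' : (p.1 : ℝ≥0∞) ≤ p.2.2 := le_of_lt hp
      rw [← h.extend_incoming p.1, tsub_add_cancel_of_le hp']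
    refine ContinuousAt.congr ?_ hev
    refine h.isEmbedding_incoming.continuous.continuousAt.comp ?_
    refine ContinuousAt.prodMk (by fun_prop) ?_
    exact ENNReal.Tendsto.sub (by exact ContinuousAt.snd (by fun_prop))
      (by exact Continuous.continuousAt (by fun_prop)) (Or.inr ENNReal.coe_ne_top)

/-- The semiflow on the truncation, which fixes the ends of the collars. -/
noncomputable def flow : Flow ℝ≥0 (truncation (combined cp cm)) where
  toFun := h.extend
  cont' := h.continuous_extend
  map_add' s t w := by
    rcases h.exists_eq w with ⟨z, rfl⟩ | ⟨b, rfl⟩ | ⟨b, rfl⟩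
    · simp only [extend_inclusion, ψ.map_add]
    · simp only [extend_outgoing, top_add]
    · have : ∀ t, h.extend t (h.incoming (b, ∞)) = h.incoming (b, ∞) := fun t ↦ h.extend_top t _
      simp only [this]
  map_zero' w := by
    rcases h.exists_eq w with ⟨z, rfl⟩ | ⟨b, rfl⟩ | ⟨b, rfl⟩
    · simp only [extend_inclusion, ψ.map_zero_apply]
    · simp only [extend_outgoing, top_add]
    · exact h.extend_top _ _

theorem isOutwardCooriented :
    IsOutwardCooriented h.flow (range fun b ↦ h.outgoing (b, ∞)) := by
  obtain ⟨c, hc, hco, htop, hck⟩ := exists_coorientation h.isEmbedding_outgoing h.isOpen_outgoing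
  refine ⟨c, hc, hco, htop, fun x s t ↦ ?_⟩
  obtain ⟨b, hb⟩ := hck x
  rw [hb, hb]
  exact h.extend_outgoing t b s

theorem isInwardCooriented :
    IsInwardCooriented h.flow (range fun b ↦ h.incoming (b, ∞)) := by
  obtain ⟨c, hc, hco, htop, hck⟩ := exists_coorientation h.isEmbedding_incoming h.isOpen_incoming
  refine ⟨c, hc, hco, htop, fun x s t ↦ ?_⟩
  obtain ⟨b, hb⟩ := hck x
  rw [hb, hb]
  exact h.extend_incoming t b s

theorem range_inclusion : range h.isCollar.inclusion =
    ((range fun b ↦ h.outgoing (b, ∞)) ∪ range fun b ↦ h.incoming (b, ∞))ᶜ := by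
  rw [h.isCollar.range_inclusion]
  congr 1
  ext w
  constructor
  · rintro ⟨⟨b | b, s⟩, hs, rfl⟩
    · obtain rfl : s = ∞ := hs
      exact Or.inl ⟨b, rfl⟩
    · obtain rfl : s = ∞ := hs
      exact Or.inr ⟨b, rfl⟩
  · rintro (⟨b, rfl⟩ | ⟨b, rfl⟩)
    · exact ⟨(Sum.inl b, ∞), rfl, rfl⟩
    · exact ⟨(Sum.inr b, ∞), rfl, rfl⟩

end IsFlowCollars

end Collar

/-! ### Coordinates on the truncated mapping torus -/

namespace GraphCells

open MappingTorus

namespace Heights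

variable {Γ : Type u} [TopologicalSpace Γ] [CWComplex (univ : Set Γ)]
  {g : Γ → Γ} {Gp Gm : Set Γ} {θ : Γ → Γ} {Np Nm : ℕ} {Tp Tm : Γ → ℝ}
  (h : Heights g Gp Gm θ Np Nm Tp Tm)

include h

/-- A finite union of open cells meeting every flow line of the truncated mapping torus in a
controlled way: the points outside of the ends, and fundamental domains for the ends. -/
def block (_h : Heights g Gp Gm θ Np Nm Tp Tm) : Set Γ :=
  (Gp \ g '' Gp) ∪ ((Gm \ θ '' Gm) ∪ (Gp ∪ Gm)ᶜ)

/-- The parameters of the points above `x` in the truncated mapping torus. -/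
def Allowed (_h : Heights g Gp Gm θ Np Nm Tp Tm) (x : Γ) (p : ℝ) : Prop :=
  0 ≤ p ∧ (p < 1 ∨ p = 1 ∧ x ∈ Gp)

open Classical in
/-- The flow line above `x` in the truncated mapping torus, parametrized by `[0, 1]`, where `x` is
treated as a point of the closed cell `c`. -/
noncomputable def panel (_h : Heights g Gp Gm θ Np Nm Tp Tm) (c : Cell Γ) (x : Γ) (p : ℝ) :
    MappingTorus g :=
  -- Above `Gp` the panel runs from time `0` to the exit level `Tp x`. Above `Gm` it runs from time
  -- `-Tm x`, the entry level, to time `1`; negative times are reached by starting from `θ^[Nm] x`.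
  -- The formula is chosen by the cell and not by `x`, since a vertex of `Gp` or `Gm` may also bound
  -- an edge outside.
  if oc c ⊆ Gp then orbit g x (p * Tp x)
  else if oc c ⊆ Gm then orbit g (θ^[Nm] x) (Nm + (p * (Tm x + 1) - Tm x))
  else orbit g x p

open Classical in
/-- The coordinates of a point of the truncated mapping torus. -/
noncomputable def coord (z : MappingTorus g) : Γ × ℝ :=
  if (rep g z).1 ∈ Gp then
    (h.decomp.shift_left.base (rep g z).1,
      (h.decomp.shift_left.depth (rep g z).1 + (rep g z).2) /
        Tp (h.decomp.shift_left.base (rep g z).1))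
  else if (rep g z).1 ∈ Gm then
    (h.decomp.shift_right.base (rep g z).1,
      (-h.decomp.shift_right.depth (rep g z).1 + (rep g z).2 +
        Tm (h.decomp.shift_right.base (rep g z).1)) /
          (Tm (h.decomp.shift_right.base (rep g z).1) + 1))
  else rep g z

open Classical in
/-- The number of pieces into which the flow lines above the cell `c` are divided. -/
noncomputable def rungs (_h : Heights g Gp Gm θ Np Nm Tp Tm) (c : Cell Γ) : ℕ :=
  -- Above a vertex the flow line has integral length `Np`, `Nm + 1` or `1` and is cut at all
  -- integral times, where corners of other panels may lie. Panels above edges are not cut.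
  if c.1 = 0 then if oc c ⊆ Gp then Np else if oc c ⊆ Gm then Nm + 1 else 1 else 1

lemma not_oc_subset_left {c : Cell Γ} (hc : oc c ⊆ Gm) : ¬ oc c ⊆ Gp := fun hc' ↦ by
  obtain ⟨x, hx⟩ := oc_nonempty c
  exact h.notMem_left (hc hx) (hc' hx)

lemma panel_left {c : Cell Γ} (hc : oc c ⊆ Gp) (x : Γ) (p : ℝ) :
    h.panel c x p = orbit g x (p * Tp x) := if_pos hc

lemma panel_right {c : Cell Γ} (hc : oc c ⊆ Gm) (x : Γ) (p : ℝ) :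
    h.panel c x p = orbit g (θ^[Nm] x) (Nm + (p * (Tm x + 1) - Tm x)) := by
  rw [panel, if_neg (h.not_oc_subset_left hc), if_pos hc]

lemma panel_middle {c : Cell Γ} (hc : ¬ oc c ⊆ Gp) (hc' : ¬ oc c ⊆ Gm) (x : Γ) (p : ℝ) :
    h.panel c x p = orbit g x p := by
  rw [panel, if_neg hc, if_neg hc']

lemma oc_subset_left_iff {x : Γ} : oc (cellOf x) ⊆ Gp ↔ x ∈ Gp :=
  ⟨fun hx ↦ hx (mem_oc_cellOf x), h.decomp.shift_left.subgraph.oc_subset⟩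

lemma oc_subset_right_iff {x : Γ} : oc (cellOf x) ⊆ Gm ↔ x ∈ Gm :=
  ⟨fun hx ↦ hx (mem_oc_cellOf x), h.decomp.shift_right.subgraph.oc_subset⟩

lemma mem_block_of_cellOf_eq {x y : Γ} (hx : x ∈ h.block) (hxy : cellOf y = cellOf x) :
    y ∈ h.block := by
  rcases hx with hx | hx | hx
  · exact Or.inl (h.decomp.shift_left.mem_domain_of_cellOf_eq hx hxy)
  · exact Or.inr (Or.inl (h.decomp.shift_right.mem_domain_of_cellOf_eq hx hxy))
  · refine Or.inr (Or.inr ?_)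
    rintro (hy | hy)
    · exact hx (Or.inl (h.oc_subset_left_iff.1 (hxy ▸ h.oc_subset_left_iff.2 hy)))
    · exact hx (Or.inr (h.oc_subset_right_iff.1 (hxy ▸ h.oc_subset_right_iff.2 hy)))

lemma cellFinite_block : CellFinite h.block :=
  h.decomp.shift_left.finite.union (h.decomp.shift_right.finite.union h.decomp.cofinite)

lemma three_le_left {x : Γ} (hx : x ∈ Gp \ g '' Gp) : 3 ≤ Tp x :=
  h.left.three_le x hx x (mem_cc_cellOf x)

lemma three_le_right {x : Γ} (hx : x ∈ Gm \ θ '' Gm) : 3 ≤ Tm x :=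
  h.right.three_le x hx x (mem_cc_cellOf x)

lemma iterate_inverse_of_le {x : Γ} (hx : x ∈ Gm) {n N : ℕ} (hn : n ≤ N) :
    g^[n] (θ^[N] x) = θ^[N - n] x := by
  conv_lhs => rw [← Nat.add_sub_cancel' hn, Function.iterate_add_apply]
  exact h.iterate_inverse (h.decomp.shift_right.iterate_mem hx _) n

/-- The first `Nm` steps from `θ^[Nm] x` only undo `θ`. The bound `Tm x ≤ Nm` makes the starting
time nonnegative. -/
lemma rep_panel_right {x : Γ} (hx : x ∈ Gm \ θ '' Gm) {p : ℝ} (hp : 0 ≤ p) (hp1 : p < 1) :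
    ∃ n ≤ Nm, rep g (h.panel (cellOf x) x p) = (θ^[Nm - n] x, p * (Tm x + 1) - Tm x + (Nm - n)) ∧
      p * (Tm x + 1) - Tm x + (Nm - n) = Int.fract (Nm + (p * (Tm x + 1) - Tm x)) := by
  have h3 := h.three_le_right hx
  have hN := h.right.le x hx
  have h0 : 0 ≤ Nm + (p * (Tm x + 1) - Tm x) := by nlinarith
  have h1 : Nm + (p * (Tm x + 1) - Tm x) < Nm + 1 := by nlinarith
  have hn : ⌊Nm + (p * (Tm x + 1) - Tm x)⌋₊ ≤ Nm :=
    Nat.lt_succ_iff.1 ((Nat.floor_lt h0).2 (by push_cast; exact h1))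
  have hfract : p * (Tm x + 1) - Tm x + (Nm - ⌊Nm + (p * (Tm x + 1) - Tm x)⌋₊) =
      Int.fract (Nm + (p * (Tm x + 1) - Tm x)) := by
    rw [Int.fract, natCast_floor_eq_intCast_floor h0]
    ring
  refine ⟨_, hn, ?_, hfract⟩
  rw [h.panel_right (h.oc_subset_right_iff.2 hx.1), rep_orbit, h.iterate_inverse_of_le hx.1 hn,
    hfract]

lemma rep_panel_middle {x : Γ} (hx : x ∉ Gp) (hx' : x ∉ Gm) {p : ℝ} (hp : 0 ≤ p) (hp1 : p < 1) :
    rep g (h.panel (cellOf x) x p) = (x, p) := by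
  rw [h.panel_middle (mt h.oc_subset_left_iff.1 hx) (mt h.oc_subset_right_iff.1 hx'),
    rep_orbit_of_mem ⟨hp, hp1⟩]

/-- With `coord_mem` this identifies the truncated mapping torus, as a set, with the allowed pairs
over `block`: every point lies in the interior of exactly one piece. -/
lemma coord_panel {x : Γ} (hx : x ∈ h.block) {p : ℝ} (hp : h.Allowed x p) :
    h.coord (h.panel (cellOf x) x p) = (x, p) := by
  rcases hx with hx | hx | hx
  · have h3 := h.three_le_left hx
    have hr : 0 ≤ p * Tp x := mul_nonneg hp.1 (by linarith)
    have hd := h.decomp.shift_left.depth_iterate hx ⌊p * Tp x⌋₊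
    have hG := h.decomp.shift_left.iterate_mem hx.1 ⌊p * Tp x⌋₊
    rw [coord, h.panel_left (h.oc_subset_left_iff.2 hx.1), rep_orbit, if_pos hG, hd.1, hd.2,
      natCast_floor_eq_intCast_floor hr, Int.floor_add_fract, mul_div_cancel_right₀]
    linarith
  · have h3 := h.three_le_right hx
    obtain ⟨n, hn, hrep, -⟩ := h.rep_panel_right hx hp.1
      (hp.2.resolve_right fun h' ↦ h.notMem_left hx.1 h'.2)
    have hd := h.decomp.shift_right.depth_iterate hx (Nm - n)
    have hG := h.decomp.shift_right.iterate_mem hx.1 (Nm - n)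
    rw [coord, hrep, if_neg (h.notMem_left hG), if_pos hG, hd.1, hd.2, Nat.cast_sub hn]
    refine Prod.ext rfl ?_
    rw [div_eq_iff (by linarith)]
    ring
  · have hx1 : x ∉ Gp := fun h' ↦ hx (Or.inl h')
    have hx2 : x ∉ Gm := fun h' ↦ hx (Or.inr h')
    rw [coord, h.rep_panel_middle hx1 hx2 hp.1 (hp.2.resolve_right fun h' ↦ hx1 h'.2), if_neg hx1,
      if_neg hx2]

lemma coord_mem {z : MappingTorus g} (hz : 0 ≤ exitTime g Gp Tp z) (hz' : 0 ≤ entryTime g Gm Tm z) :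
    (h.coord z).1 ∈ h.block ∧ h.Allowed (h.coord z).1 (h.coord z).2 ∧
      h.panel (cellOf (h.coord z).1) (h.coord z).1 (h.coord z).2 = z := by
  obtain ⟨x, y, hy, rfl⟩ := exists_orbit_eq z
  by_cases hx : x ∈ Gp
  · have hb := h.decomp.shift_left.base_mem hx
    have h3 := h.three_le_left hb
    have hT := h.left.eq_base h.decomp.shift_left hx
    rw [h.exitTime_orbit_of_mem hx hy.1] at hz
    have hle := hz.trans (min_le_left _ _)
    have hd : (0 : ℝ) ≤ h.decomp.shift_left.depth x := Nat.cast_nonneg _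
    rw [coord, rep_orbit_of_mem hy, if_pos hx]
    refine ⟨Or.inl hb, ⟨div_nonneg (by linarith [hy.1]) (by linarith), ?_⟩, ?_⟩
    · refine (lt_or_eq_of_le ?_).imp_right fun h' ↦ ⟨h', hb.1⟩
      rw [div_le_one (by linarith)]
      linarith
    · rw [h.panel_left (h.oc_subset_left_iff.2 hb.1), div_mul_cancel₀ _ (by linarith), add_comm,
        orbit_add_nat _ hy.1, h.decomp.shift_left.iterate_base hx]
  · by_cases hx' : x ∈ Gm
    · have hb := h.decomp.shift_right.base_mem hx'
      have h3 := h.three_le_right hb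
      have hT := h.right.eq_base h.decomp.shift_right hx'
      have hN := h.right.le _ hb
      rw [h.entryTime_orbit_of_mem hx' hy.1] at hz'
      have hle := hz'.trans (min_le_left _ _)
      have hd : (0 : ℝ) ≤ h.decomp.shift_right.depth x := Nat.cast_nonneg _
      have hdN : h.decomp.shift_right.depth x ≤ Nm := by
        have : (h.decomp.shift_right.depth x : ℝ) < (Nm + 1 : ℕ) := by
          push_cast
          linarith [hy.2]
        exact Nat.lt_succ_iff.1 (by exact_mod_cast this)
      rw [coord, rep_orbit_of_mem hy, if_neg hx, if_pos hx']
      refine ⟨Or.inr (Or.inl hb), ⟨div_nonneg (by linarith) (by linarith), Or.inl ?_⟩, ?_⟩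
      · rw [div_lt_one (by linarith)]
        linarith [hy.2]
      · rw [h.panel_right (h.oc_subset_right_iff.2 hb.1), div_mul_cancel₀ _ (by linarith)]
        rw [show (Nm : ℝ) + (-h.decomp.shift_right.depth x + y +
            Tm (h.decomp.shift_right.base x) - Tm (h.decomp.shift_right.base x)) =
            y + (Nm - h.decomp.shift_right.depth x : ℕ) by rw [Nat.cast_sub hdN]; ring,
          orbit_add_nat _ hy.1, h.iterate_inverse_of_le hb.1 (Nat.sub_le _ _),
          Nat.sub_sub_self hdN, h.decomp.shift_right.iterate_base hx']
    · rw [coord, rep_orbit_of_mem hy, if_neg hx, if_neg hx']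
      exact ⟨Or.inr (Or.inr fun h' ↦ h'.elim hx hx'), ⟨hy.1, Or.inl hy.2⟩,
        h.panel_middle (mt h.oc_subset_left_iff.1 hx) (mt h.oc_subset_right_iff.1 hx') _ _⟩

lemma exitTime_eq_two {z : MappingTorus g} (hz : (rep g z).1 ∉ Gp) : exitTime g Gp Tp z = 2 := by
  refine (h.exitTime_le_two z).antisymm (not_lt.1 fun h' ↦ hz ?_)
  obtain ⟨x, hx, y, hy, rfl, -⟩ := h.exists_of_exitTime_lt h'
  rwa [rep_orbit_of_mem hy]

lemma entryTime_eq_three {z : MappingTorus g} (hz : (rep g z).1 ∉ Gm) :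
    entryTime g Gm Tm z = 3 := by
  refine (h.entryTime_le_three z).antisymm (not_lt.1 fun h' ↦ hz ?_)
  obtain ⟨x, hx, y, hy, rfl, -⟩ := h.exists_of_entryTime_lt h'
  rwa [rep_orbit_of_mem hy]

lemma times_panel_left {x : Γ} (hx : x ∈ Gp \ g '' Gp) {p : ℝ} (hp : 0 ≤ p) :
    exitTime g Gp Tp (h.panel (cellOf x) x p) = min (Tp x - p * Tp x) 2 ∧
      entryTime g Gm Tm (h.panel (cellOf x) x p) = 3 := by
  have h3 := h.three_le_left hx
  have hr : 0 ≤ p * Tp x := mul_nonneg hp (by linarith)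
  refine ⟨?_, h.entryTime_eq_three (h.notMem_right ?_)⟩
  · rw [h.panel_left (h.oc_subset_left_iff.2 hx.1), h.exitTime_orbit_of_mem hx.1 hr]
  · rw [h.panel_left (h.oc_subset_left_iff.2 hx.1), rep_orbit]
    exact h.decomp.shift_left.iterate_mem hx.1 _

lemma times_panel_right {x : Γ} (hx : x ∈ Gm \ θ '' Gm) {p : ℝ} (hp : 0 ≤ p) (hp1 : p < 1) :
    exitTime g Gp Tp (h.panel (cellOf x) x p) = 2 ∧
      entryTime g Gm Tm (h.panel (cellOf x) x p) = min (p * (Tm x + 1)) 3 := by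
  have h3 := h.three_le_right hx
  have hN := h.right.le x hx
  refine ⟨h.exitTime_eq_two (h.notMem_left ?_), ?_⟩
  · obtain ⟨n, -, hrep, -⟩ := h.rep_panel_right hx hp hp1
    rw [hrep]
    exact h.decomp.shift_right.iterate_mem hx.1 _
  · rw [h.panel_right (h.oc_subset_right_iff.2 hx.1), h.entryTime_orbit_of_mem
      (h.decomp.shift_right.iterate_mem hx.1 _) (by nlinarith),
      h.right.iterate h.decomp.shift_right hx.1]
    congr 1
    ring

lemma times_panel_middle {x : Γ} (hx : x ∉ Gp) (hx' : x ∉ Gm) {p : ℝ} (hp : 0 ≤ p) (hp1 : p < 1) :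
    exitTime g Gp Tp (h.panel (cellOf x) x p) = 2 ∧
      entryTime g Gm Tm (h.panel (cellOf x) x p) = 3 := by
  have hrep := h.rep_panel_middle hx hx' hp hp1
  exact ⟨h.exitTime_eq_two (by rwa [hrep]), h.entryTime_eq_three (by rwa [hrep])⟩

/-- Apart from staying in the truncated region, this locates the two boundaries: the exit level
consists of the allowed tops, and the entry level of the bottoms above `Gm`. -/
lemma times_panel {x : Γ} (hx : x ∈ h.block) {p : ℝ} (hp : h.Allowed x p) :
    (0 ≤ exitTime g Gp Tp (h.panel (cellOf x) x p) ∧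
      0 ≤ entryTime g Gm Tm (h.panel (cellOf x) x p)) ∧
    (exitTime g Gp Tp (h.panel (cellOf x) x p) = 0 ↔ p = 1) ∧
    (entryTime g Gm Tm (h.panel (cellOf x) x p) = 0 ↔ p = 0 ∧ x ∈ Gm) := by
  obtain ⟨hp0, hp1⟩ := hp
  rcases hx with hx | hx | hx
  · have h3 := h.three_le_left hx
    have hle : p ≤ 1 := hp1.elim le_of_lt fun h' ↦ h'.1.le
    obtain ⟨h1, h2⟩ := h.times_panel_left hx hp0
    have hnn : 0 ≤ Tp x - p * Tp x := by nlinarith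
    rw [h1, h2]
    refine ⟨⟨le_min hnn (by norm_num), by norm_num⟩, ⟨fun h' ↦ ?_, fun h' ↦ ?_⟩, ?_⟩
    · rcases min_choice (Tp x - p * Tp x) 2 with h4 | h4
      · rw [h4] at h'
        nlinarith
      · rw [h4] at h'
        norm_num at h'
    · rw [h', one_mul, sub_self]
      norm_num
    · exact ⟨fun h' ↦ by norm_num at h', fun h' ↦ (h.notMem_right hx.1 h'.2).elim⟩
  · have hlt := hp1.resolve_right fun h' ↦ h.notMem_left hx.1 h'.2
    have h3 := h.three_le_right hx
    obtain ⟨h1, h2⟩ := h.times_panel_right hx hp0 hlt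
    have hnn : 0 ≤ p * (Tm x + 1) := by nlinarith
    rw [h1, h2]
    refine ⟨⟨by norm_num, le_min hnn (by norm_num)⟩, ⟨fun h' ↦ by norm_num at h',
      fun h' ↦ (hlt.ne h').elim⟩, ⟨fun h' ↦ ⟨?_, hx.1⟩, fun h' ↦ ?_⟩⟩
    · rcases min_choice (p * (Tm x + 1)) 3 with h4 | h4
      · rw [h4] at h'
        exact (mul_eq_zero.1 h').resolve_right (by linarith)
      · rw [h4] at h'
        norm_num at h'
    · rw [h'.1, zero_mul]
      norm_num
  · have hx1 : x ∉ Gp := fun h' ↦ hx (Or.inl h')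
    have hx2 : x ∉ Gm := fun h' ↦ hx (Or.inr h')
    have hlt := hp1.resolve_right fun h' ↦ hx1 h'.2
    obtain ⟨h1, h2⟩ := h.times_panel_middle hx1 hx2 hp0 hlt
    rw [h1, h2]
    exact ⟨⟨by norm_num, by norm_num⟩, ⟨fun h' ↦ by norm_num at h', fun h' ↦ (hlt.ne h').elim⟩,
      fun h' ↦ by norm_num at h', fun h' ↦ (hx2 h'.2).elim⟩

lemma vertex_left {x : Γ} (hx : x ∈ Gp) (hv : (cellOf x).1 = 0) :
    Tp x = Np - h.decomp.shift_left.depth x := by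
  rw [h.left.eq_base h.decomp.shift_left hx, h.left.vertex _ (h.decomp.shift_left.base_mem hx)
    (by rw [h.decomp.shift_left.base_dim hx, hv])]

lemma vertex_right {x : Γ} (hx : x ∈ Gm) (hv : (cellOf x).1 = 0) :
    Tm x = Nm - h.decomp.shift_right.depth x := by
  rw [h.right.eq_base h.decomp.shift_right hx, h.right.vertex _ (h.decomp.shift_right.base_mem hx)
    (by rw [h.decomp.shift_right.base_dim hx, hv])]

lemma iterate_vertex {x : Γ} (hv : (cellOf x).1 = 0) (n : ℕ) : (cellOf (g^[n] x)).1 = 0 := by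
  induction n with
  | zero => exact hv
  | succ n ih =>
    rw [Function.iterate_succ_apply']
    exact h.decomp.vertex _ ih

/-- Over the vertices of a cell, the panel consists of flow lines of vertices, and it starts and
ends at integral times. -/
lemma panel_vertex {c : Cell Γ} {x : Γ} (hx : x ∈ cc c) (hv : (cellOf x).1 = 0) (p : ℝ) :
    (cellOf (rep g (h.panel c x p)).1).1 = 0 ∧
      (p = 0 ∨ p = 1 ∧ oc c ⊆ Gp → (rep g (h.panel c x p)).2 = 0) := by
  obtain ⟨y, hy⟩ := oc_nonempty c
  obtain rfl := cellOf_eq hy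
  by_cases h1 : y ∈ Gp
  · have hxG := h.decomp.shift_left.subgraph y h1 hx
    rw [h.panel_left (h.oc_subset_left_iff.2 h1), rep_orbit]
    refine ⟨h.iterate_vertex hv _, ?_⟩
    rintro (rfl | ⟨rfl, -⟩)
    · simp
    · rw [one_mul, h.vertex_left hxG hv]
      exact Int.fract_eq_zero_iff.2 ⟨Np - h.decomp.shift_left.depth x, by push_cast; rfl⟩
  · by_cases h2 : y ∈ Gm
    · have hxG := h.decomp.shift_right.subgraph y h2 hx
      rw [h.panel_right (h.oc_subset_right_iff.2 h2), rep_orbit]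
      refine ⟨h.iterate_vertex (by rw [h.decomp.shift_right.iterate_dim hxG, hv]) _, ?_⟩
      rintro (rfl | ⟨-, h'⟩)
      · rw [h.vertex_right hxG hv]
        exact Int.fract_eq_zero_iff.2 ⟨h.decomp.shift_right.depth x, by push_cast; ring⟩
      · exact (h1 (h' (mem_oc_cellOf y))).elim
    · rw [h.panel_middle (mt h.oc_subset_left_iff.1 h1) (mt h.oc_subset_right_iff.1 h2), rep_orbit]
      refine ⟨h.iterate_vertex hv _, ?_⟩
      rintro (rfl | ⟨-, h'⟩)
      · simp
      · exact (h1 (h' (mem_oc_cellOf y))).elim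

/-- The points above vertices have vertices as coordinates, and the points at integral times lie on
rungs. -/
lemma coord_vertex {z : MappingTorus g} (hz : 0 ≤ entryTime g Gm Tm z)
    (hv : (cellOf (rep g z).1).1 = 0) :
    (cellOf (h.coord z).1).1 = 0 ∧
      ((rep g z).2 = 0 → ∃ k : ℕ, (h.coord z).2 * h.rungs (cellOf (h.coord z).1) = k) := by
  obtain ⟨x, y, hy, rfl⟩ := exists_orbit_eq z
  rw [rep_orbit_of_mem hy] at hv
  change (cellOf x).1 = 0 at hv
  by_cases hx : x ∈ Gp
  · have hb := h.decomp.shift_left.base_mem hx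
    have h3 := h.three_le_left hb
    have hvb := (h.decomp.shift_left.base_dim hx).trans hv
    have hT := h.left.vertex _ hb hvb
    rw [coord, rep_orbit_of_mem hy, if_pos hx]
    refine ⟨hvb, fun h0 ↦ ⟨h.decomp.shift_left.depth x, ?_⟩⟩
    change y = 0 at h0
    rw [rungs, if_pos hvb, if_pos (h.oc_subset_left_iff.2 hb.1), h0, add_zero, ← hT,
      div_mul_cancel₀]
    linarith
  · by_cases hx' : x ∈ Gm
    · have hb := h.decomp.shift_right.base_mem hx'
      have h3 := h.three_le_right hb
      have hvb := (h.decomp.shift_right.base_dim hx').trans hv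
      have hT := h.right.vertex _ hb hvb
      rw [h.entryTime_orbit_of_mem hx' hy.1, h.vertex_right hx' hv] at hz
      have hle := hz.trans (min_le_left _ _)
      rw [coord, rep_orbit_of_mem hy, if_neg hx, if_pos hx']
      refine ⟨hvb, fun h0 ↦ ⟨Nm - h.decomp.shift_right.depth x, ?_⟩⟩
      change y = 0 at h0
      have hdN : h.decomp.shift_right.depth x ≤ Nm := by
        rw [h0] at hle
        exact_mod_cast (show (h.decomp.shift_right.depth x : ℝ) ≤ Nm by linarith)
      rw [rungs, if_pos hvb, if_neg (mt h.oc_subset_left_iff.1 (h.notMem_left hb.1)),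
        if_pos (h.oc_subset_right_iff.2 hb.1), Nat.cast_sub hdN, Nat.cast_add_one, ← hT,
        div_mul_cancel₀ _ (by linarith)]
      change -_ + y + _ = _
      rw [h0]
      ring
    · rw [coord, rep_orbit_of_mem hy, if_neg hx, if_neg hx']
      refine ⟨hv, fun h0 ↦ ⟨0, ?_⟩⟩
      change y = 0 at h0
      change y * _ = _
      rw [h0]
      simp

/-- Above a point which is not in the attracting ends, the panel ends at the bottom of another
panel. -/
lemma panel_top {x : Γ} (hx : x ∈ h.block) (hxp : x ∉ Gp) :
    g x ∈ h.block ∧ h.panel (cellOf x) x 1 = h.panel (cellOf (g x)) (g x) 0 := by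
  have hgm : g x ∉ Gm := by
    rcases hx with hx | hx | hx
    · exact (hxp hx.1).elim
    · exact fun h' ↦ hx.2 ⟨g x, h', h.decomp.inverse_map x h'⟩
    · exact fun h' ↦ hx (Or.inr (h.decomp.of_map_mem x h'))
  have hgp := h.decomp.not_mem_image x hxp
  have hbot : h.panel (cellOf (g x)) (g x) 0 = orbit g (g x) 0 := by
    by_cases h' : g x ∈ Gp
    · rw [h.panel_left (h.oc_subset_left_iff.2 h'), zero_mul]
    · exact h.panel_middle (mt h.oc_subset_left_iff.1 h') (mt h.oc_subset_right_iff.1 hgm) _ _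
  have htop : h.panel (cellOf x) x 1 = orbit g x (0 + 1) := by
    by_cases h' : x ∈ Gm
    · rw [h.panel_right (h.oc_subset_right_iff.2 h'),
        show (Nm : ℝ) + (1 * (Tm x + 1) - Tm x) = 0 + 1 + Nm by ring,
        orbit_add_nat _ (by norm_num), h.iterate_inverse h']
    · rw [h.panel_middle (mt h.oc_subset_left_iff.1 hxp) (mt h.oc_subset_right_iff.1 h'), zero_add]
  refine ⟨?_, by rw [hbot, htop, orbit_add_one _ le_rfl]⟩
  by_cases h' : g x ∈ Gp
  · exact Or.inl ⟨h', hgp⟩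
  · exact Or.inr (Or.inr fun h'' ↦ h''.elim h' hgm)

lemma continuousOn_panel [T2Space Γ] {x : Γ} (hx : x ∈ h.block) :
    ContinuousOn (fun q : Γ × ℝ ↦ h.panel (cellOf x) q.1 q.2)
      (cc (cellOf x) ×ˢ Icc (0 : ℝ) 1) := by
  have horbit := continuousOn_orbit h.decomp.continuous
  have hfst : ContinuousOn (Prod.fst : Γ × ℝ → Γ) (cc (cellOf x) ×ˢ Icc (0 : ℝ) 1) :=
    continuousOn_fst
  have hsnd : ContinuousOn (Prod.snd : Γ × ℝ → ℝ) (cc (cellOf x) ×ˢ Icc (0 : ℝ) 1) :=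
    continuousOn_snd
  rcases hx with hx | hx | hx
  · have hT : ContinuousOn (fun q : Γ × ℝ ↦ Tp q.1) (cc (cellOf x) ×ˢ Icc (0 : ℝ) 1) :=
      h.left.continuousOn.comp hfst fun q hq ↦ h.decomp.shift_left.subgraph x hx.1 hq.1
    refine (horbit.comp (hfst.prodMk (hsnd.mul hT)) fun q hq ↦ ⟨trivial, ?_⟩).congr fun q _ ↦
      h.panel_left (h.oc_subset_left_iff.2 hx.1) _ _
    exact mul_nonneg hq.2.1 (by linarith [h.left.three_le x hx q.1 hq.1])
  · have hmem : ∀ q ∈ cc (cellOf x) ×ˢ Icc (0 : ℝ) 1, q.1 ∈ Gm := fun q hq ↦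
      h.decomp.shift_right.subgraph x hx.1 hq.1
    have hT : ContinuousOn (fun q : Γ × ℝ ↦ Tm q.1) (cc (cellOf x) ×ˢ Icc (0 : ℝ) 1) :=
      h.right.continuousOn.comp hfst hmem
    have hθ : ContinuousOn (fun q : Γ × ℝ ↦ θ^[Nm] q.1) (cc (cellOf x) ×ˢ Icc (0 : ℝ) 1) :=
      (h.decomp.shift_right.iterate_continuousOn Nm).comp hfst hmem
    refine (horbit.comp (hθ.prodMk (continuousOn_const.add ((hsnd.mul
      (hT.add continuousOn_const)).sub hT))) fun q hq ↦ ⟨trivial, ?_⟩).congr fun q _ ↦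
      h.panel_right (h.oc_subset_right_iff.2 hx.1) _ _
    -- The closed cell may contain vertices outside the fundamental domain; their height is `Nm`
    -- minus the depth.
    have hle : Tm q.1 ≤ Nm := by
      rcases mem_cc h.isGraph hq.1 with hq' | hq'
      · exact h.right.le _ (h.decomp.shift_right.mem_domain_of_cellOf_eq hx (cellOf_eq hq'))
      · rw [h.vertex_right (hmem q hq) hq']
        linarith [(Nat.cast_nonneg (h.decomp.shift_right.depth q.1) : (0 : ℝ) ≤ _)]
    have h3 := h.right.three_le x hx q.1 hq.1
    have h0 : 0 ≤ q.2 * (Tm q.1 + 1) := mul_nonneg hq.2.1 (by linarith)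
    change (0 : ℝ) ≤ Nm + (q.2 * (Tm q.1 + 1) - Tm q.1)
    linarith
  · refine (horbit.mono fun q hq ↦ ⟨trivial, hq.2.1⟩).congr fun q _ ↦ ?_
    exact h.panel_middle (mt h.oc_subset_left_iff.1 fun h' ↦ hx (Or.inl h'))
      (mt h.oc_subset_right_iff.1 fun h' ↦ hx (Or.inr h')) _ _

lemma rungs_pos {x : Γ} (hx : x ∈ h.block) : 0 < h.rungs (cellOf x) := by
  unfold rungs
  split_ifs with h1 h2 h3
  · rcases hx with hx | hx | hx
    · have := h.three_le_left hx
      rw [h.left.vertex x hx h1] at this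
      exact_mod_cast (show (0 : ℝ) < Np by linarith)
    · exact (h.notMem_left hx.1 (h.oc_subset_left_iff.1 h2)).elim
    · exact (hx (Or.inl (h.oc_subset_left_iff.1 h2))).elim
  all_goals omega

lemma rungs_edge {c : Cell Γ} (hc : c.1 ≠ 0) : h.rungs c = 1 := if_neg hc

end Heights

end GraphCells

/-! ### Finite CW structures from finite families of cells -/

section CellSystem

open Metric

/-- The nearest point of the unit cube. -/
def cubeRetraction {n : ℕ} (u : Fin n → ℝ) (i : Fin n) : ℝ := max (-1) (min 1 (u i))

lemma cubeRetraction_mem {n : ℕ} (u : Fin n → ℝ) : cubeRetraction u ∈ closedBall 0 1 := by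
  rw [mem_closedBall_zero_iff, pi_norm_le_iff_of_nonneg zero_le_one]
  intro i
  rw [Real.norm_eq_abs, abs_le]
  exact ⟨le_max_left _ _, max_le (by norm_num) (min_le_left _ _)⟩

lemma cubeRetraction_of_mem {n : ℕ} {u : Fin n → ℝ} (hu : u ∈ closedBall 0 1) :
    cubeRetraction u = u := by
  rw [mem_closedBall_zero_iff, pi_norm_le_iff_of_nonneg zero_le_one] at hu
  funext i
  have := abs_le.1 (hu i)
  rw [cubeRetraction, min_eq_right this.2, max_eq_right this.1]

/-- Characteristic maps of a finite cell decomposition of the subset `W` of a space. -/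
structure CellSystem {Z : Type u} [TopologicalSpace Z] (W : Set Z) (cell : ℕ → Type u)
    (Φ : ∀ n, cell n → (Fin n → ℝ) → Z) : Prop where
  isEmpty : ∀ n, 3 ≤ n → IsEmpty (cell n)
  finite : ∀ n, Finite (cell n)
  continuousOn : ∀ n i, ContinuousOn (Φ n i) (closedBall 0 1)
  mapsTo : ∀ n i, MapsTo (Φ n i) (closedBall 0 1) W
  injOn : ∀ n i, InjOn (Φ n i) (ball 0 1)
  eq_of_mem : ∀ (a b : Σ n, cell n) (z : Z), z ∈ Φ a.1 a.2 '' ball 0 1 →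
    z ∈ Φ b.1 b.2 '' ball 0 1 → a = b
  sphere : ∀ n i, ∀ u ∈ sphere (0 : Fin n → ℝ) 1, ∃ m < n, ∃ j, Φ n i u ∈ Φ m j '' ball 0 1
  exists_mem : ∀ z ∈ W, ∃ n i, z ∈ Φ n i '' ball 0 1

namespace CellSystem

variable {Z : Type u} [TopologicalSpace Z] {W : Set Z} {cell : ℕ → Type u}
  {Φ : ∀ n, cell n → (Fin n → ℝ) → Z} (S : CellSystem W cell Φ)

include S

lemma finite_sigma : Finite (Σ n, cell n) := by
  have := S.finite
  let f : (Σ n, cell n) → Σ n : Fin 3, cell n := fun a ↦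
    ⟨⟨a.1, not_le.1 fun h ↦ (S.isEmpty a.1 h).false a.2⟩, a.2⟩
  refine Finite.of_injective f ?_
  rintro ⟨n, a⟩ ⟨m, b⟩ hab
  obtain rfl : n = m := congrArg (fun c ↦ (c.1 : ℕ)) hab
  simpa [f] using hab

/-- The characteristic maps with values in the subspace. -/
def toSubtype (n : ℕ) (i : cell n) (u : Fin n → ℝ) : W :=
  ⟨Φ n i (cubeRetraction u), S.mapsTo n i (cubeRetraction_mem u)⟩

lemma coe_toSubtype {n : ℕ} (i : cell n) {u : Fin n → ℝ} (hu : u ∈ closedBall 0 1) :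
    (S.toSubtype n i u : Z) = Φ n i u :=
  congrArg (Φ n i) (cubeRetraction_of_mem hu)

lemma mem_image_toSubtype {n : ℕ} (i : cell n) {s : Set (Fin n → ℝ)} (hs : s ⊆ closedBall 0 1)
    {w : W} : w ∈ S.toSubtype n i '' s ↔ (w : Z) ∈ Φ n i '' s := by
  constructor
  · rintro ⟨u, hu, rfl⟩
    exact ⟨u, hu, (S.coe_toSubtype i (hs hu)).symm⟩
  · rintro ⟨u, hu, hw⟩
    exact ⟨u, hu, Subtype.ext ((S.coe_toSubtype i (hs hu)).trans hw)⟩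

lemma injOn_toSubtype (n : ℕ) (i : cell n) : InjOn (S.toSubtype n i) (ball 0 1) := by
  intro u hu v hv huv
  have := congrArg Subtype.val huv
  rw [S.coe_toSubtype i (ball_subset_closedBall hu),
    S.coe_toSubtype i (ball_subset_closedBall hv)] at this
  exact S.injOn n i hu hv this

lemma continuousOn_toSubtype (n : ℕ) (i : cell n) :
    ContinuousOn (S.toSubtype n i) (closedBall 0 1) := by
  rw [IsInducing.subtypeVal.continuousOn_iff]
  exact (S.continuousOn n i).congr fun u hu ↦ S.coe_toSubtype i hu

/-- Boundary points are sent to open cells of smaller dimension, which are disjoint from this open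
cell. -/
lemma disjoint_sphere {n : ℕ} (i : cell n) {u v : Fin n → ℝ} (hu : u ∈ ball 0 1)
    (hv : v ∈ closedBall 0 1) (huv : Φ n i v = Φ n i u) : v ∈ ball (0 : Fin n → ℝ) 1 := by
  by_contra hv'
  rw [mem_ball, not_lt] at hv'
  obtain ⟨m, hm, j, hj⟩ := S.sphere n i v (le_antisymm hv hv')
  have := S.eq_of_mem ⟨n, i⟩ ⟨m, j⟩ (Φ n i v) ⟨u, hu, huv.symm⟩ hj
  exact hm.ne' (congrArg Sigma.fst this)

/-- The characteristic maps as partial equivalences. -/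
noncomputable def map (n : ℕ) (i : cell n) : PartialEquiv (Fin n → ℝ) W :=
  (S.injOn_toSubtype n i).toPartialEquiv

lemma mem_image_map {n : ℕ} (i : cell n) {s : Set (Fin n → ℝ)} (hs : s ⊆ closedBall 0 1)
    {w : W} : w ∈ S.map n i '' s ↔ (w : Z) ∈ Φ n i '' s := S.mem_image_toSubtype i hs

/-- Closed subsets of the cube have compact, hence closed images, and by `disjoint_sphere` such an
image meets the open cell only in images of interior points. -/
lemma continuousOn_symm [T2Space Z] (n : ℕ) (i : cell n) :
    ContinuousOn (S.map n i).symm (S.map n i).target := by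
  rw [continuousOn_iff_isClosed]
  intro A hA
  refine ⟨S.toSubtype n i '' (closedBall 0 1 ∩ A), ?_, ?_⟩
  · exact (((isCompact_closedBall 0 1).inter_right hA).image_of_continuousOn
      ((S.continuousOn_toSubtype n i).mono inter_subset_left)).isClosed
  · ext w
    constructor
    · rintro ⟨hw, hwt⟩
      have hb : (S.map n i).symm w ∈ ball 0 1 := (S.map n i).map_target hwt
      exact ⟨⟨_, ⟨ball_subset_closedBall hb, hw⟩, (S.map n i).right_inv hwt⟩, hwt⟩
    · rintro ⟨⟨v, hv, rfl⟩, hwt⟩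
      refine ⟨?_, hwt⟩
      have hb : (S.map n i).symm (S.toSubtype n i v) ∈ ball 0 1 := (S.map n i).map_target hwt
      have hr := congrArg Subtype.val ((S.map n i).right_inv hwt)
      change (S.toSubtype n i _ : Z) = _ at hr
      rw [S.coe_toSubtype i (ball_subset_closedBall hb), S.coe_toSubtype i hv.1] at hr
      have hvb := S.disjoint_sphere i hb hv.1 hr.symm
      have := S.injOn n i hb hvb hr
      change (S.map n i).symm (S.toSubtype n i v) ∈ A
      rw [this]
      exact hv.2

/-- The CW structure with the given cells. -/
@[reducible]
noncomputable def cwComplex [T2Space Z] : CWComplex (univ : Set W) :=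
  CWComplex.mkFinite univ cell S.map
    (Filter.eventually_atTop.2 ⟨3, S.isEmpty⟩) S.finite (fun _ _ ↦ rfl)
    S.continuousOn_toSubtype S.continuousOn_symm
    (by
      rintro a - b - hab
      refine disjoint_left.2 fun w hwa hwb ↦ hab ?_
      rw [S.mem_image_map _ ball_subset_closedBall] at hwa hwb
      exact S.eq_of_mem a b w hwa hwb)
    (by
      intro n i u hu
      obtain ⟨m, hm, j, hj⟩ := S.sphere n i u hu
      simp only [mem_iUnion]
      refine ⟨m, hm, j, ?_⟩
      rw [S.mem_image_map _ subset_rfl]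
      have : (S.map n i u : Z) = Φ n i u := S.coe_toSubtype i (sphere_subset_closedBall hu)
      rw [this]
      exact image_mono ball_subset_closedBall hj)
    (by
      refine eq_univ_of_forall fun w ↦ ?_
      obtain ⟨n, i, hi⟩ := S.exists_mem w w.2
      simp only [mem_iUnion]
      refine ⟨n, i, ?_⟩
      rw [S.mem_image_map _ subset_rfl]
      exact image_mono ball_subset_closedBall hi)

/-- A closed union of open cells, as a subcomplex. -/
noncomputable def subcomplex [T2Space Z] (D : Set W) (hD : IsClosed D) (J : ∀ n, Set (cell n))
    (hJ : ∀ w : W, w ∈ D ↔ ∃ n, ∃ i ∈ J n, (w : Z) ∈ Φ n i '' ball 0 1) :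
    letI := S.cwComplex
    RelCWComplex.Subcomplex (univ : Set W) :=
  letI := S.cwComplex
  ⟨D, J, hD, by
      ext w
      rw [hJ, empty_union]
      simp only [mem_iUnion]
      constructor
      · rintro ⟨n, ⟨i, hi⟩, hw⟩
        exact ⟨n, i, hi, (S.mem_image_map i ball_subset_closedBall).1 hw⟩
      · rintro ⟨n, i, hi, hw⟩
        exact ⟨n, ⟨i, hi⟩, (S.mem_image_map i ball_subset_closedBall).2 hw⟩⟩

end CellSystem

end CellSystem

/-! ### The cells of the truncated mapping torus -/

/-! ### A cube as the product of a cube and an interval -/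

section CubeCoordinates

open Metric

/-- The first `k` coordinates. -/
def lowerCoord {k n : ℕ} (hk : k ≤ n) (u : Fin n → ℝ) (i : Fin k) : ℝ := u (Fin.castLE hk i)

/-- The coordinate with number `k`, rescaled to `[0, 1]`, or zero if there is none. -/
noncomputable def upperCoord (k : ℕ) {n : ℕ} (u : Fin n → ℝ) : ℝ :=
  if hk : k < n then (u ⟨k, hk⟩ + 1) / 2 else 0

lemma mem_ball_zero_one_iff {n : ℕ} {u : Fin n → ℝ} : u ∈ ball 0 1 ↔ ∀ i, |u i| < 1 := by
  rw [mem_ball_zero_iff, pi_norm_lt_iff zero_lt_one]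
  rfl

lemma mem_closedBall_zero_one_iff {n : ℕ} {u : Fin n → ℝ} :
    u ∈ closedBall 0 1 ↔ ∀ i, |u i| ≤ 1 := by
  rw [mem_closedBall_zero_iff, pi_norm_le_iff_of_nonneg zero_le_one]
  rfl

variable {k n : ℕ} (hk : k ≤ n)

lemma continuous_lowerCoord : Continuous (lowerCoord hk) :=
  continuous_pi fun _ ↦ continuous_apply _

lemma continuous_upperCoord : Continuous (upperCoord k : (Fin n → ℝ) → ℝ) := by
  unfold upperCoord
  split_ifs
  · exact ((continuous_apply _).add continuous_const).div_const 2
  · exact continuous_const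

lemma lowerCoord_mem_closedBall {u : Fin n → ℝ} (hu : u ∈ closedBall 0 1) :
    lowerCoord hk u ∈ closedBall 0 1 :=
  mem_closedBall_zero_one_iff.2 fun _ ↦ mem_closedBall_zero_one_iff.1 hu _

lemma lowerCoord_mem_ball {u : Fin n → ℝ} (hu : u ∈ ball 0 1) : lowerCoord hk u ∈ ball 0 1 :=
  mem_ball_zero_one_iff.2 fun _ ↦ mem_ball_zero_one_iff.1 hu _

lemma upperCoord_mem {u : Fin n → ℝ} (hu : u ∈ closedBall 0 1) : upperCoord k u ∈ Icc (0 : ℝ) 1 := by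
  unfold upperCoord
  split_ifs with h
  · have := abs_le.1 (mem_closedBall_zero_one_iff.1 hu ⟨k, h⟩)
    exact ⟨by linarith, by linarith⟩
  · simp

lemma upperCoord_mem_Ioo (h : k < n) {u : Fin n → ℝ} (hu : u ∈ ball 0 1) :
    upperCoord k u ∈ Ioo (0 : ℝ) 1 := by
  rw [upperCoord, dif_pos h]
  have := abs_lt.1 (mem_ball_zero_one_iff.1 hu ⟨k, h⟩)
  exact ⟨by linarith, by linarith⟩

lemma eq_of_coord_eq (hn : n ≤ k + 1) {u v : Fin n → ℝ} (h1 : lowerCoord hk u = lowerCoord hk v)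
    (h2 : upperCoord k u = upperCoord k v) : u = v := by
  funext ⟨j, hj⟩
  by_cases hjk : j < k
  · exact congrFun h1 ⟨j, hjk⟩
  · obtain rfl : j = k := by omega
    rw [upperCoord, upperCoord, dif_pos hj, dif_pos hj] at h2
    linarith

lemma exists_coord_eq (hn : n ≤ k + 1) {w : Fin k → ℝ} (hw : w ∈ ball 0 1) {f : ℝ}
    (hf : k < n → f ∈ Ioo (0 : ℝ) 1) (hf' : k = n → f = 0) :
    ∃ u ∈ ball (0 : Fin n → ℝ) 1, lowerCoord hk u = w ∧ upperCoord k u = f := by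
  refine ⟨fun j ↦ if hj : (j : ℕ) < k then w ⟨j, hj⟩ else 2 * f - 1, ?_, ?_, ?_⟩
  · rw [mem_ball_zero_one_iff]
    intro j
    split_ifs with hj
    · exact mem_ball_zero_one_iff.1 hw _
    · obtain ⟨h1, h2⟩ := hf (by omega)
      rw [abs_lt]
      exact ⟨by linarith, by linarith⟩
  · funext i
    simp [lowerCoord]
  · unfold upperCoord
    split_ifs with h1
    · simp
    · exact (hf' (by omega)).symm

/-- In the sup norm some coordinate has absolute value `1`; if the first `k` do not, it is the last
one, so the point lies on the top or the bottom. -/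
lemma upperCoord_of_mem_sphere {u : Fin n → ℝ} (hn : n ≤ k + 1) (hu : u ∈ sphere 0 1)
    (hl : lowerCoord hk u ∈ ball 0 1) :
    n = k + 1 ∧ (upperCoord k u = 0 ∨ upperCoord k u = 1) := by
  have hu' : u ∉ ball 0 1 := fun h' ↦ by
    rw [mem_ball, mem_sphere.1 hu] at h'
    exact lt_irrefl _ h'
  rw [mem_ball_zero_one_iff, not_forall] at hu'
  obtain ⟨⟨j, hj⟩, hlt⟩ := hu'
  have hjk : ¬ j < k := fun hjk ↦ hlt (mem_ball_zero_one_iff.1 hl ⟨j, hjk⟩)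
  obtain rfl : j = k := by omega
  refine ⟨by omega, ?_⟩
  have heq := le_antisymm (mem_closedBall_zero_one_iff.1 (sphere_subset_closedBall hu) ⟨j, hj⟩)
    (not_lt.1 hlt)
  rw [upperCoord, dif_pos hj]
  rcases eq_or_eq_neg_of_abs_eq heq with h' | h' <;> rw [h'] <;> norm_num

end CubeCoordinates

namespace GraphCells

open MappingTorus Metric

namespace Heights

variable {Γ : Type u} [TopologicalSpace Γ] [CWComplex (univ : Set Γ)]
  {g : Γ → Γ} {Gp Gm : Set Γ} {θ : Γ → Γ} {Np Nm : ℕ} {Tp Tm : Γ → ℝ}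
  (h : Heights g Gp Gm θ Np Nm Tp Tm)

include h

/-- The piece with number `i` of the flow lines above the cell `c` is an `n`-cell: it is the level
`i` of these flow lines, or their part between the levels `i` and `i + 1`. -/
def IsPiece (n : ℕ) (q : Cell Γ × ℕ) : Prop :=
  oc q.1 ⊆ h.block ∧
    (q.1.1 = n ∧ (q.2 < h.rungs q.1 ∨ q.2 = h.rungs q.1 ∧ oc q.1 ⊆ Gp) ∨
      q.1.1 + 1 = n ∧ q.2 < h.rungs q.1)

/-- The `n`-cells of the truncated mapping torus. -/
def Piece (n : ℕ) : Type u := {q : Cell Γ × ℕ // h.IsPiece n q}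

lemma Piece.dim_le {n : ℕ} (q : h.Piece n) : q.1.1.1 ≤ n := by
  rcases q.2.2 with h' | h' <;> omega

lemma Piece.le_dim {n : ℕ} (q : h.Piece n) : n ≤ q.1.1.1 + 1 := by
  rcases q.2.2 with h' | h' <;> omega

/-- The characteristic map of a cell. -/
noncomputable def pieceMap (n : ℕ) (q : h.Piece n) (u : Fin n → ℝ) : MappingTorus g :=
  h.panel q.1.1 (RelCWComplex.map (C := (univ : Set Γ)) q.1.1.1 q.1.1.2
    (lowerCoord (Piece.dim_le h q) u)) ((q.1.2 + upperCoord q.1.1.1 u) / h.rungs q.1.1)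

/-- The parameters of the points of a piece. -/
def OnPiece {n : ℕ} (q : h.Piece n) (p : ℝ) : Prop :=
  q.1.1.1 = n ∧ p * h.rungs q.1.1 = q.1.2 ∨
    q.1.1.1 + 1 = n ∧ q.1.2 < p * h.rungs q.1.1 ∧ p * h.rungs q.1.1 < q.1.2 + 1

lemma Piece.rungs_pos {n : ℕ} (q : h.Piece n) : (0 : ℝ) < h.rungs q.1.1 := by
  obtain ⟨y, hy⟩ := oc_nonempty q.1.1
  have := h.rungs_pos (q.2.1 hy)
  rw [cellOf_eq hy] at this
  exact_mod_cast this

lemma OnPiece.allowed {n : ℕ} {q : h.Piece n} {p : ℝ} (hp : h.OnPiece q p) {x : Γ}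
    (hx : x ∈ oc q.1.1) : h.Allowed x p := by
  have hm := Piece.rungs_pos h q
  have hi : (0 : ℝ) ≤ q.1.2 := Nat.cast_nonneg _
  rcases hp with ⟨h1, h2⟩ | ⟨h1, h2, h3⟩
  · refine ⟨nonneg_of_mul_nonneg_left (h2 ▸ hi) hm, ?_⟩
    rcases q.2.2 with ⟨-, h' | ⟨h', h''⟩⟩ | ⟨h', -⟩
    · left
      have : (q.1.2 : ℝ) < h.rungs q.1.1 := by exact_mod_cast h'
      nlinarith
    · right
      rw [h'] at h2
      exact ⟨by nlinarith, h'' hx⟩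
    · omega
  · refine ⟨(pos_of_mul_pos_left (hi.trans_lt h2) hm.le).le, Or.inl ?_⟩
    rcases q.2.2 with ⟨h', -⟩ | ⟨-, h'⟩
    · omega
    · have : (q.1.2 : ℝ) + 1 ≤ h.rungs q.1.1 := by exact_mod_cast h'
      nlinarith

lemma pieceMap_ball {n : ℕ} (q : h.Piece n) {u : Fin n → ℝ} (hu : u ∈ ball 0 1) :
    RelCWComplex.map (C := (univ : Set Γ)) q.1.1.1 q.1.1.2
      (lowerCoord (Piece.dim_le h q) u) ∈ oc q.1.1 ∧
    h.OnPiece q ((q.1.2 + upperCoord q.1.1.1 u) / h.rungs q.1.1) := by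
  refine ⟨mem_image_of_mem _ (lowerCoord_mem_ball _ hu), ?_⟩
  have hm := Piece.rungs_pos h q
  rw [OnPiece, div_mul_cancel₀ _ hm.ne']
  by_cases hq : q.1.1.1 = n
  · refine Or.inl ⟨hq, ?_⟩
    rw [upperCoord, dif_neg (by omega), add_zero]
  · have h1 := Piece.dim_le h q
    have h2 := Piece.le_dim h q
    have := upperCoord_mem_Ioo (k := q.1.1.1) (by omega) hu
    exact Or.inr ⟨by omega, by linarith [this.1], by linarith [this.2]⟩

lemma mem_image_pieceMap {n : ℕ} (q : h.Piece n) {x : Γ} (hx : x ∈ oc q.1.1) {p : ℝ}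
    (hp : h.OnPiece q p) : h.panel (cellOf x) x p ∈ h.pieceMap n q '' ball 0 1 := by
  obtain ⟨w, hw, rfl⟩ := hx
  have hm := Piece.rungs_pos h q
  obtain ⟨u, hu, h1, h2⟩ := exists_coord_eq (Piece.dim_le h q) (Piece.le_dim h q) hw
    (f := p * h.rungs q.1.1 - q.1.2) (by
      intro hlt
      rcases hp with ⟨h', -⟩ | ⟨-, h1, h2⟩
      · omega
      · exact ⟨by linarith, by linarith⟩) (by
      intro heq
      rcases hp with ⟨-, h'⟩ | ⟨h', -⟩
      · linarith
      · omega)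
  refine ⟨u, hu, ?_⟩
  rw [pieceMap, h1, h2, add_sub_cancel, mul_div_cancel_right₀ _ hm.ne', cellOf_eq]
  exact mem_image_of_mem _ hw

lemma exists_of_mem_image {n : ℕ} {q : h.Piece n} {z : MappingTorus g}
    (hz : z ∈ h.pieceMap n q '' ball 0 1) :
    ∃ x ∈ oc q.1.1, ∃ p, h.OnPiece q p ∧ z = h.panel (cellOf x) x p := by
  obtain ⟨u, hu, rfl⟩ := hz
  obtain ⟨hx, hp⟩ := h.pieceMap_ball q hu
  exact ⟨_, hx, _, hp, by rw [cellOf_eq hx]; rfl⟩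

lemma coord_of_mem_image {n : ℕ} {q : h.Piece n} {z : MappingTorus g}
    (hz : z ∈ h.pieceMap n q '' ball 0 1) :
    cellOf (h.coord z).1 = q.1.1 ∧ h.OnPiece q (h.coord z).2 := by
  obtain ⟨x, hx, p, hp, rfl⟩ := h.exists_of_mem_image hz
  rw [h.coord_panel (q.2.1 hx) (OnPiece.allowed h hp hx)]
  exact ⟨cellOf_eq hx, hp⟩

/-- The piece has the dimension of the cell of `x`; this is the drop in dimension at the top and
bottom of a panel. -/
lemma exists_level {x : Γ} (hx : x ∈ h.block) {p : ℝ} (hp : h.Allowed x p) {k : ℕ}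
    (hk : p * h.rungs (cellOf x) = k) :
    ∃ q : h.Piece (cellOf x).1, q.1 = (cellOf x, k) ∧
      h.panel (cellOf x) x p ∈ h.pieceMap _ q '' ball 0 1 := by
  have hm : (0 : ℝ) < h.rungs (cellOf x) := by exact_mod_cast h.rungs_pos hx
  have hblock : oc (cellOf x) ⊆ h.block := fun y hy ↦ h.mem_block_of_cellOf_eq hx (cellOf_eq hy)
  have hq : h.IsPiece (cellOf x).1 (cellOf x, k) := by
    refine ⟨hblock, Or.inl ⟨rfl, hp.2.imp (fun h' ↦ ?_) fun h' ↦
      ⟨?_, h.oc_subset_left_iff.2 h'.2⟩⟩⟩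
    · exact_mod_cast (show (k : ℝ) < h.rungs (cellOf x) by rw [← hk]; nlinarith)
    · rw [h'.1, one_mul] at hk
      exact_mod_cast hk.symm
  exact ⟨⟨_, hq⟩, rfl, h.mem_image_pieceMap ⟨_, hq⟩ (mem_oc_cellOf x) (Or.inl ⟨rfl, hk⟩)⟩

lemma exists_piece {x : Γ} (hx : x ∈ h.block) {p : ℝ} (hp : h.Allowed x p) :
    ∃ n ≤ (cellOf x).1 + 1, ∃ q : h.Piece n,
      h.panel (cellOf x) x p ∈ h.pieceMap _ q '' ball 0 1 := by
  have hm : (0 : ℝ) < h.rungs (cellOf x) := by exact_mod_cast h.rungs_pos hx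
  have hr : 0 ≤ p * h.rungs (cellOf x) := mul_nonneg hp.1 hm.le
  by_cases hint : p * h.rungs (cellOf x) = ⌊p * h.rungs (cellOf x)⌋₊
  · obtain ⟨q, -, hq⟩ := h.exists_level hx hp hint
    exact ⟨_, Nat.le_succ _, q, hq⟩
  · have hblock : oc (cellOf x) ⊆ h.block := fun y hy ↦ h.mem_block_of_cellOf_eq hx (cellOf_eq hy)
    have hlt : p < 1 := hp.2.resolve_right fun h' ↦ hint (by rw [h'.1, one_mul, Nat.floor_natCast])
    have hq : h.IsPiece ((cellOf x).1 + 1) (cellOf x, ⌊p * h.rungs (cellOf x)⌋₊) := by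
      refine ⟨hblock, Or.inr ⟨rfl, (Nat.floor_lt hr).2 ?_⟩⟩
      nlinarith
    refine ⟨_, le_rfl, ⟨_, hq⟩, h.mem_image_pieceMap ⟨_, hq⟩ (mem_oc_cellOf x)
      (Or.inr ⟨rfl, ?_, Nat.lt_floor_add_one _⟩)⟩
    exact lt_of_le_of_ne (Nat.floor_le hr) (Ne.symm hint)

/-- The truncated mapping torus. -/
def region (_h : Heights g Gp Gm θ Np Nm Tp Tm) : Set (MappingTorus g) :=
  {z | 0 ≤ exitTime g Gp Tp z ∧ 0 ≤ entryTime g Gm Tm z}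

lemma finite_piece (n : ℕ) : Finite (h.Piece n) := by
  have hfin : (⋃ c ∈ cellOf '' h.block, (fun i : ℕ ↦ (c, i)) '' Iic (h.rungs c)).Finite :=
    Finite.biUnion h.cellFinite_block fun c _ ↦ (finite_Iic _).image _
  refine (hfin.subset ?_ : {q | h.IsPiece n q}.Finite)
  rintro ⟨c, i⟩ ⟨hc, hi⟩
  obtain ⟨y, hy⟩ := oc_nonempty c
  refine mem_biUnion ⟨y, hc hy, cellOf_eq hy⟩ ⟨i, ?_, rfl⟩
  change i ≤ h.rungs c
  rcases hi with ⟨-, h' | h'⟩ | ⟨-, h'⟩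
  · exact h'.le
  · exact h'.1.le
  · exact h'.le

lemma injOn_pieceMap (n : ℕ) (q : h.Piece n) : InjOn (h.pieceMap n q) (ball 0 1) := by
  intro u hu v hv huv
  obtain ⟨hx, hp⟩ := h.pieceMap_ball q hu
  obtain ⟨hx', hp'⟩ := h.pieceMap_ball q hv
  have key : ∀ {x p}, x ∈ oc q.1.1 → h.OnPiece q p → h.coord (h.panel q.1.1 x p) = (x, p) := by
    intro x p hx hp
    have := h.coord_panel (q.2.1 hx) (OnPiece.allowed h hp hx)
    rwa [cellOf_eq hx] at this
  have heq := congrArg h.coord huv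
  rw [pieceMap, pieceMap, key hx hp, key hx' hp', Prod.mk.injEq] at heq
  refine eq_of_coord_eq (Piece.dim_le h q) (Piece.le_dim h q) ?_ ?_
  · refine (RelCWComplex.map (C := (univ : Set Γ)) q.1.1.1 q.1.1.2).injOn ?_ ?_ heq.1
    · rw [RelCWComplex.source_eq]
      exact lowerCoord_mem_ball _ hu
    · rw [RelCWComplex.source_eq]
      exact lowerCoord_mem_ball _ hv
  · have := heq.2
    rw [div_left_inj' (Piece.rungs_pos h q).ne'] at this
    linarith

lemma parameter_mem {n : ℕ} (q : h.Piece n) {u : Fin n → ℝ} (hu : u ∈ closedBall 0 1) :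
    (q.1.2 + upperCoord q.1.1.1 u) / h.rungs q.1.1 ∈ Icc (0 : ℝ) 1 := by
  have hm := Piece.rungs_pos h q
  have hf := upperCoord_mem (k := q.1.1.1) hu
  refine ⟨div_nonneg (add_nonneg (Nat.cast_nonneg _) hf.1) hm.le, ?_⟩
  rw [div_le_one hm]
  have hlt : q.1.2 < h.rungs q.1.1 → (q.1.2 : ℝ) + upperCoord q.1.1.1 u ≤ h.rungs q.1.1 := by
    intro h'
    have : (q.1.2 : ℝ) + 1 ≤ h.rungs q.1.1 := by exact_mod_cast h'
    linarith [hf.2]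
  rcases q.2.2 with ⟨h1, h' | h'⟩ | ⟨-, h'⟩
  · exact hlt h'
  · rw [upperCoord, dif_neg (by omega), h'.1, add_zero]
  · exact hlt h'

lemma exitTime_eq_zero_iff {z : MappingTorus g} (hz : z ∈ h.region) :
    exitTime g Gp Tp z = 0 ↔ ∃ n, ∃ q ∈ {q : h.Piece n | q.1.1.1 = n ∧ q.1.2 = h.rungs q.1.1},
      z ∈ h.pieceMap n q '' ball 0 1 := by
  constructor
  · intro h0
    obtain ⟨hb, hall, hpanel⟩ := h.coord_mem hz.1 hz.2
    rw [← hpanel] at h0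
    have h1 := (h.times_panel hb hall).2.1.1 h0
    obtain ⟨q, hq, hzq⟩ := h.exists_level hb hall (k := h.rungs (cellOf (h.coord z).1)) (by
      rw [h1, one_mul])
    rw [hpanel] at hzq
    exact ⟨_, q, ⟨by rw [hq], by rw [hq]⟩, hzq⟩
  · rintro ⟨n, q, ⟨hq1, hq2⟩, hz⟩
    obtain ⟨x, hx, p, hp, rfl⟩ := h.exists_of_mem_image hz
    refine (h.times_panel (q.2.1 hx) (OnPiece.allowed h hp hx)).2.1.2 ?_
    rcases hp with ⟨-, hp⟩ | ⟨hp, -⟩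
    · rw [hq2] at hp
      have := Piece.rungs_pos h q
      nlinarith
    · omega

lemma entryTime_eq_zero_iff {z : MappingTorus g} (hz : z ∈ h.region) :
    entryTime g Gm Tm z = 0 ↔
      ∃ n, ∃ q ∈ {q : h.Piece n | q.1.1.1 = n ∧ q.1.2 = 0 ∧ oc q.1.1 ⊆ Gm},
      z ∈ h.pieceMap n q '' ball 0 1 := by
  constructor
  · intro h0
    obtain ⟨hb, hall, hpanel⟩ := h.coord_mem hz.1 hz.2
    rw [← hpanel] at h0
    have h1 := (h.times_panel hb hall).2.2.1 h0
    obtain ⟨q, hq, hzq⟩ := h.exists_level hb hall (k := 0) (by rw [h1.1, zero_mul, Nat.cast_zero])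
    rw [hpanel] at hzq
    exact ⟨_, q, ⟨by rw [hq], by rw [hq], by rw [hq]; exact h.oc_subset_right_iff.2 h1.2⟩, hzq⟩
  · rintro ⟨n, q, ⟨hq1, hq2, hq3⟩, hz⟩
    obtain ⟨x, hx, p, hp, rfl⟩ := h.exists_of_mem_image hz
    refine (h.times_panel (q.2.1 hx) (OnPiece.allowed h hp hx)).2.2.2 ⟨?_, hq3 hx⟩
    rcases hp with ⟨-, hp⟩ | ⟨hp, -⟩
    · rw [hq2, Nat.cast_zero] at hp
      exact (mul_eq_zero.1 hp).resolve_right (Piece.rungs_pos h q).ne'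
    · omega

variable [T2Space Γ]

lemma isClosed_region : IsClosed h.region :=
  (isClosed_le continuous_const h.continuous_exitTime).inter
    (isClosed_le continuous_const h.continuous_entryTime)

lemma continuousOn_pieceMap (n : ℕ) (q : h.Piece n) :
    ContinuousOn (h.pieceMap n q) (closedBall 0 1) := by
  obtain ⟨y, hy⟩ := oc_nonempty q.1.1
  have hc := h.continuousOn_panel (q.2.1 hy)
  rw [cellOf_eq hy] at hc
  have hmap : ContinuousOn (fun u : Fin n → ℝ ↦ RelCWComplex.map (C := (univ : Set Γ)) q.1.1.1
      q.1.1.2 (lowerCoord (Piece.dim_le h q) u)) (closedBall 0 1) :=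
    (RelCWComplex.continuousOn q.1.1.1 q.1.1.2).comp (continuous_lowerCoord _).continuousOn
      fun u hu ↦ lowerCoord_mem_closedBall _ hu
  have hpar : ContinuousOn (fun u : Fin n → ℝ ↦
      ((q.1.2 : ℝ) + upperCoord q.1.1.1 u) / (h.rungs q.1.1 : ℝ)) (closedBall 0 1) :=
    ((continuous_const.add continuous_upperCoord).div_const _).continuousOn
  have hmem : ∀ u ∈ closedBall (0 : Fin n → ℝ) 1, RelCWComplex.map (C := (univ : Set Γ)) q.1.1.1
      q.1.1.2 (lowerCoord (Piece.dim_le h q) u) ∈ cc q.1.1 := fun u hu ↦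
    mem_image_of_mem _ (lowerCoord_mem_closedBall _ hu)
  have hpair : MapsTo (fun u : Fin n → ℝ ↦ (RelCWComplex.map (C := (univ : Set Γ)) q.1.1.1
      q.1.1.2 (lowerCoord (Piece.dim_le h q) u),
      ((q.1.2 : ℝ) + upperCoord q.1.1.1 u) / (h.rungs q.1.1 : ℝ))) (closedBall 0 1)
      (cc q.1.1 ×ˢ Icc (0 : ℝ) 1) := fun u hu ↦ ⟨hmem u hu, h.parameter_mem q hu⟩
  refine (hc.comp (hmap.prodMk hpar) hpair).congr fun u _ ↦ ?_
  rw [pieceMap]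
  rfl

lemma mapsTo_pieceMap (n : ℕ) (q : h.Piece n) :
    MapsTo (h.pieceMap n q) (closedBall 0 1) h.region := by
  have hball : MapsTo (h.pieceMap n q) (ball 0 1) h.region := by
    intro u hu
    obtain ⟨hx, hp⟩ := h.pieceMap_ball q hu
    have := (h.times_panel (q.2.1 hx) (OnPiece.allowed h hp hx)).1
    rwa [cellOf_eq hx] at this
  -- The parameters of boundary points need not be allowed, but the region is closed and the cube is
  -- the closure of its interior.
  have := hball.closure_of_continuousOn (by
    rw [closure_ball _ one_ne_zero]
    exact h.continuousOn_pieceMap n q)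
  rwa [closure_ball _ one_ne_zero, h.isClosed_region.closure_eq] at this

/-- A boundary point is on the top or bottom of a piece, or above the frontier of its cell. The
first kind is a level of the same cell or, for a top outside `Gp`, the bottom of the panel above `g
x`. The second kind lies on the flow line of a vertex, which is cut into pieces of dimension at most
one. -/
lemma sphere_pieceMap (n : ℕ) (q : h.Piece n) (u : Fin n → ℝ) (hu : u ∈ sphere 0 1) :
    ∃ m < n, ∃ j, h.pieceMap n q u ∈ h.pieceMap m j '' ball 0 1 := by
  have huc := sphere_subset_closedBall hu
  have hle := Piece.dim_le h q
  have hle' := Piece.le_dim h q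
  have hm := Piece.rungs_pos h q
  have hmem := h.mapsTo_pieceMap n q huc
  by_cases hl : lowerCoord (Piece.dim_le h q) u ∈ ball 0 1
  · obtain ⟨hn, hf⟩ := upperCoord_of_mem_sphere (Piece.dim_le h q) hle' hu hl
    obtain ⟨k, hk⟩ : ∃ k : ℕ, (q.1.2 : ℝ) + upperCoord q.1.1.1 u = k := by
      rcases hf with hf | hf
      · exact ⟨q.1.2, by rw [hf, add_zero]⟩
      · exact ⟨q.1.2 + 1, by rw [hf]; push_cast; rfl⟩
    have hp := h.parameter_mem q huc
    set x := RelCWComplex.map (C := (univ : Set Γ)) q.1.1.1 q.1.1.2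
      (lowerCoord (Piece.dim_le h q) u) with hx
    have hxc : x ∈ oc q.1.1 := mem_image_of_mem _ hl
    have hxb := q.2.1 hxc
    have hcell := cellOf_eq hxc
    have heq : h.pieceMap n q u = h.panel (cellOf x) x
        ((q.1.2 + upperCoord q.1.1.1 u) / h.rungs q.1.1) := by
      rw [hcell]
      rfl
    rw [heq]
    by_cases hall : h.Allowed x ((q.1.2 + upperCoord q.1.1.1 u) / h.rungs q.1.1)
    · obtain ⟨j, -, hj⟩ := h.exists_level hxb hall (k := k) (by
        rw [hcell, div_mul_cancel₀ _ hm.ne', hk])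
      exact ⟨_, by rw [hcell]; omega, j, hj⟩
    · have h1 : (q.1.2 + upperCoord q.1.1.1 u) / h.rungs q.1.1 = 1 := by
        by_contra h'
        exact hall ⟨hp.1, Or.inl (lt_of_le_of_ne hp.2 h')⟩
      have hxp : x ∉ Gp := fun h' ↦ hall ⟨hp.1, Or.inr ⟨h1, h'⟩⟩
      obtain ⟨hgx, htop⟩ := h.panel_top hxb hxp
      obtain ⟨j, -, hj⟩ := h.exists_level hgx (p := 0) ⟨le_rfl, Or.inl zero_lt_one⟩ (k := 0)
        (by simp)
      rw [h1, htop]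
      refine ⟨_, ?_, j, hj⟩
      rw [hn]
      -- If `g x` is in an open edge, the dimension drops because `n = 2`: for `n = 1` the point `x`
      -- would be a vertex, and `g` preserves vertices.
      rcases IsGraph.dim h.isGraph (cellOf (g x)) with h0 | h0
      · omega
      · by_contra hlt
        have hv : (cellOf x).1 = 0 := by
          rw [hcell]
          omega
        have := h.decomp.vertex x hv
        omega
  · have hlc := lowerCoord_mem_closedBall (Piece.dim_le h q) huc
    have hfront : RelCWComplex.map (C := (univ : Set Γ)) q.1.1.1 q.1.1.2
        (lowerCoord (Piece.dim_le h q) u) ∈ RelCWComplex.cellFrontier q.1.1.1 q.1.1.2 :=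
      mem_image_of_mem _ (le_antisymm hlc (not_lt.1 hl))
    obtain ⟨hd, hv⟩ := cellOf_of_mem_cellFrontier h.isGraph hfront
    have hx : RelCWComplex.map (C := (univ : Set Γ)) q.1.1.1 q.1.1.2
        (lowerCoord (Piece.dim_le h q) u) ∈ cc q.1.1 := mem_image_of_mem _ hlc
    obtain ⟨hv1, hv2⟩ := h.panel_vertex hx hv
      ((q.1.2 + upperCoord q.1.1.1 u) / h.rungs q.1.1)
    change (cellOf (rep g (h.pieceMap n q u)).1).1 = 0 at hv1
    change _ → (rep g (h.pieceMap n q u)).2 = 0 at hv2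
    obtain ⟨hw, hlevel⟩ := h.coord_vertex hmem.2 hv1
    obtain ⟨hb, hall, hpanel⟩ := h.coord_mem hmem.1 hmem.2
    rw [← hpanel]
    rcases hle'.lt_or_eq with hn | hn
    -- This is an endpoint of a level of an edge. Edges have a single rung, so the level is the
    -- bottom or an allowed top; there vertices occur at integral times, hence in a `0`-cell.
    · have hn1 : n = q.1.1.1 := by omega
      obtain ⟨k, hk⟩ := hlevel (hv2 (by
        have hr := h.rungs_edge (c := q.1.1) (by omega)
        rw [upperCoord, dif_neg (by omega), hr, add_zero, Nat.cast_one, div_one]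
        rcases q.2.2 with ⟨-, h' | h'⟩ | ⟨h', -⟩
        · rw [hr] at h'
          exact Or.inl (by exact_mod_cast (show q.1.2 = 0 by omega))
        · rw [hr] at h'
          exact Or.inr ⟨by exact_mod_cast h'.1, h'.2⟩
        · omega))
      obtain ⟨j, -, hj⟩ := h.exists_level hb hall hk
      exact ⟨_, by omega, j, hj⟩
    · obtain ⟨m, hm', j, hj⟩ := h.exists_piece hb hall
      exact ⟨m, by omega, j, hj⟩

theorem cellSystem : CellSystem h.region h.Piece h.pieceMap where
  isEmpty n hn := ⟨fun q ↦ by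
    have := Piece.le_dim h q
    rcases IsGraph.dim h.isGraph q.1.1 with h' | h' <;> omega⟩
  finite := h.finite_piece
  continuousOn := h.continuousOn_pieceMap
  mapsTo := h.mapsTo_pieceMap
  injOn := h.injOn_pieceMap
  eq_of_mem := by
    rintro ⟨n, q⟩ ⟨m, r⟩ z hq hr
    obtain ⟨h1, h2⟩ := h.coord_of_mem_image hq
    obtain ⟨h1', h2'⟩ := h.coord_of_mem_image hr
    have hc : q.1.1 = r.1.1 := h1.symm.trans h1'
    change h.OnPiece q _ at h2
    change h.OnPiece r _ at h2'
    rw [OnPiece, hc] at h2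
    rw [OnPiece] at h2'
    -- The same number cannot be an integer level and lie strictly between consecutive integers, and
    -- the open unit intervals are disjoint.
    have key : n = m ∧ q.1.2 = r.1.2 := by
      rcases h2 with ⟨a1, a2⟩ | ⟨a1, a2, a3⟩ <;> rcases h2' with ⟨b1, b2⟩ | ⟨b1, b2, b3⟩
      · exact ⟨by omega, by exact_mod_cast a2.symm.trans b2⟩
      · rw [a2] at b2 b3
        have b2' : r.1.2 < q.1.2 := by exact_mod_cast b2
        have b3' : q.1.2 < r.1.2 + 1 := by exact_mod_cast b3
        omega
      · rw [b2] at a2 a3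
        have a2' : q.1.2 < r.1.2 := by exact_mod_cast a2
        have a3' : r.1.2 < q.1.2 + 1 := by exact_mod_cast a3
        omega
      · have c1 : r.1.2 < q.1.2 + 1 := by exact_mod_cast b2.trans a3
        have c2 : q.1.2 < r.1.2 + 1 := by exact_mod_cast a2.trans b3
        exact ⟨by omega, by omega⟩
    obtain ⟨rfl, hi⟩ := key
    rw [show q = r from Subtype.ext (Prod.ext hc hi)]
  sphere := h.sphere_pieceMap
  exists_mem z hz := by
    obtain ⟨hb, hall, hpanel⟩ := h.coord_mem hz.1 hz.2
    obtain ⟨n, -, q, hq⟩ := h.exists_piece hb hall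
    rw [hpanel] at hq
    exact ⟨n, q, hq⟩

end Heights

end GraphCells

/-! ### The compactified mapping torus -/

namespace GraphCells

open MappingTorus Collar

lemma image_collar {Z B : Type*} {c : B × ℝ≥0 → Z} {τ : Z → ℝ} (hτ : ∀ q, τ (c q) = 1 - q.2)
    (hr : range c = {z | τ z ≤ 1}) (r : ℝ≥0) : c '' {q | r < q.2} = {z | τ z < 1 - r} := by
  ext z
  constructor
  · rintro ⟨q, hq, rfl⟩
    have : (r : ℝ) < q.2 := NNReal.coe_lt_coe.2 hq
    change τ (c q) < 1 - r
    rw [hτ]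
    linarith
  · intro hz
    change τ z < 1 - r at hz
    have hz1 : z ∈ range c := by
      rw [hr]
      change τ z ≤ 1
      linarith [r.coe_nonneg]
    obtain ⟨q, rfl⟩ := hz1
    rw [hτ] at hz
    exact ⟨q, NNReal.coe_lt_coe.1 (by linarith), rfl⟩

lemma isCollar_of_time {Z B : Type*} [TopologicalSpace Z] [TopologicalSpace B] {c : B × ℝ≥0 → Z}
    (hc : IsClosedEmbedding c) {τ : Z → ℝ} (hcont : Continuous τ) (hτ : ∀ q, τ (c q) = 1 - q.2)
    (hr : range c = {z | τ z ≤ 1}) : IsCollar c := by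
  refine ⟨hc, ?_⟩
  rw [image_collar hτ hr]
  exact isOpen_lt hcont continuous_const

lemma mem_range_end {Z B : Type*} {c : B × ℝ≥0 → Z} {τ : Z → ℝ} (hτ : ∀ q, τ (c q) = 1 - q.2)
    (hr : range c = {z | τ z ≤ 1}) {z : Z} : τ z = 0 ↔ ∃ b, c (b, 1) = z := by
  constructor
  · intro hz
    have hz1 : z ∈ range c := by
      rw [hr]
      change τ z ≤ 1
      linarith
    obtain ⟨⟨b, s⟩, rfl⟩ := hz1
    rw [hτ] at hz
    obtain rfl : s = 1 := NNReal.coe_injective (by rw [NNReal.coe_one]; linarith)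
    exact ⟨b, rfl⟩
  · rintro ⟨b, rfl⟩
    rw [hτ]
    norm_num

/-- The mapping torus is compactified by adding one boundary point for each flow line in an
end. -/
theorem Heights.exists_compactification {Γ : Type u} [TopologicalSpace Γ] [T2Space Γ]
    [CWComplex (univ : Set Γ)] {g : Γ → Γ} {Gp Gm : Set Γ} {θ : Γ → Γ} {Np Nm : ℕ}
    {Tp Tm : Γ → ℝ} (h : Heights g Gp Gm θ Np Nm Tp Tm) :
    ∃ (W : Type u) (_ : TopologicalSpace W) (_ : T2Space W) (_ : CWComplex (univ : Set W))
      (Dpos Dneg : RelCWComplex.Subcomplex (univ : Set W)) (Ψ : Flow ℝ≥0 W)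
      (ι : MappingTorus g ≃ₕ W),
      Finite (Σ n, RelCWComplex.cell (univ : Set W) n) ∧
      (∀ n, 3 ≤ n → IsEmpty (RelCWComplex.cell (univ : Set W) n)) ∧
      (∀ n, 2 ≤ n → Dpos.I n = ∅ ∧ Dneg.I n = ∅) ∧
      Disjoint (Dpos : Set W) (Dneg : Set W) ∧
      IsOutwardCooriented Ψ (Dpos : Set W) ∧
      IsInwardCooriented Ψ (Dneg : Set W) ∧
      IsEmbedding ι ∧
      (∀ (t : ℝ≥0) (z : MappingTorus g), ι (suspensionSemiflow g t z) = Ψ t (ι z)) ∧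
      range ι = ((Dpos : Set W) ∪ (Dneg : Set W))ᶜ := by
  have := t2Space h.decomp.continuous
  obtain ⟨cp, hcp, htp, hrp, hfp⟩ := h.exists_collar_left
  obtain ⟨cm, hcm, htm, hrm, hfm⟩ := h.exists_collar_right
  have hc : IsFlowCollars (flow h.decomp.continuous) cp cm := by
    refine ⟨isCollar_of_time hcp h.continuous_exitTime htp hrp,
      isCollar_of_time hcm h.continuous_entryTime htm hrm, fun p q hpq ↦ ?_, hfp, hfm⟩
    have h1 : exitTime g Gp Tp (cp p) < 2 := by
      rw [htp]
      linarith [p.2.coe_nonneg]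
    have h2 := h.entryTime_eq_of_exitTime_lt h1
    rw [hpq, htm] at h2
    linarith [q.2.coe_nonneg]
  -- The collar coordinate is `1` minus the time, so removing coordinates beyond `1` leaves the
  -- points where both times are nonnegative.
  have hregion : truncation (combined cp cm) = h.region := by
    have himage := combined_image cp cm (Ioi 1)
    simp only [mem_Ioi] at himage
    rw [truncation, himage, image_collar htp hrp, image_collar htm hrm]
    ext z
    simp [Heights.region]
  have S : CellSystem (truncation (combined cp cm)) h.Piece h.pieceMap := hregion ▸ h.cellSystem
  have hmem : ∀ w : truncation (combined cp cm), (w : MappingTorus g) ∈ h.region := fun w ↦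
    hregion ▸ w.2
  have hend : ∀ b : {z // exitTime g Gp Tp z = 1},
      (hc.outgoing (b, ∞) : MappingTorus g) = cp (b, 1) := fun b ↦ by
    change cp (b, squeeze ∞) = _
    rw [squeeze_top]
  have hend' : ∀ b : {z // entryTime g Gm Tm z = 1},
      (hc.incoming (b, ∞) : MappingTorus g) = cm (b, 1) := fun b ↦ by
    change cm (b, squeeze ∞) = _
    rw [squeeze_top]
  have hDpos : (range fun b ↦ hc.outgoing (b, ∞)) =
      {w : truncation (combined cp cm) | exitTime g Gp Tp w = 0} := by
    ext w
    refine Iff.trans ?_ (mem_range_end htp hrp).symm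
    exact exists_congr fun b ↦ by rw [← Subtype.coe_inj, hend]
  have hDneg : (range fun b ↦ hc.incoming (b, ∞)) =
      {w : truncation (combined cp cm) | entryTime g Gm Tm w = 0} := by
    ext w
    refine Iff.trans ?_ (mem_range_end htm hrm).symm
    exact exists_congr fun b ↦ by rw [← Subtype.coe_inj, hend']
  have hout := hc.isOutwardCooriented
  have hin := hc.isInwardCooriented
  have hrange := hc.range_inclusion
  rw [hDpos] at hout hrange
  rw [hDneg] at hin hrange
  refine ⟨truncation (combined cp cm), inferInstance, inferInstance, S.cwComplex,
    S.subcomplex {w | exitTime g Gp Tp w = 0}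
      (isClosed_eq (h.continuous_exitTime.comp continuous_subtype_val) continuous_const)
      (fun n ↦ {q | q.1.1.1 = n ∧ q.1.2 = h.rungs q.1.1})
      fun w ↦ h.exitTime_eq_zero_iff (hmem w),
    S.subcomplex {w | entryTime g Gm Tm w = 0}
      (isClosed_eq (h.continuous_entryTime.comp continuous_subtype_val) continuous_const)
      (fun n ↦ {q | q.1.1.1 = n ∧ q.1.2 = 0 ∧ oc q.1.1 ⊆ Gm})
      fun w ↦ h.entryTime_eq_zero_iff (hmem w),
    hc.flow, hc.isCollar.homotopyEquiv, S.finite_sigma, S.isEmpty, fun n hn ↦ ⟨?_, ?_⟩, ?_,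
    hout, hin, hc.isCollar.isEmbedding_inclusion,
    fun t z ↦ (hc.extend_inclusion t z).symm, hrange⟩
  · refine eq_empty_of_forall_notMem fun q hq ↦ ?_
    rcases IsGraph.dim h.isGraph q.1.1 with h' | h' <;> have := hq.1 <;> omega
  · refine eq_empty_of_forall_notMem fun q hq ↦ ?_
    rcases IsGraph.dim h.isGraph q.1.1 with h' | h' <;> have := hq.1 <;> omega
  · refine disjoint_left.2 fun w (hw : exitTime g Gp Tp w = 0)
      (hw' : entryTime g Gm Tm w = 0) ↦ ?_
    have := h.entryTime_eq_of_exitTime_lt (z := w) (by rw [hw]; norm_num)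
    linarith

end GraphCells

theorem mainTheorem2 (Γ : Type u) [TopologicalSpace Γ] [T2Space Γ] [ConnectedSpace Γ]
    [CWComplex (univ : Set Γ)] (hΓ : IsGraph Γ)
    (hinf : Infinite (Σ n, RelCWComplex.cell (univ : Set Γ) n))
    (hends : Finite (SpaceEnd Γ))
    (g : Γ → Γ) (hg : IsEndPeriodic g) :
    ∃ (W : Type u) (_ : TopologicalSpace W) (_ : T2Space W) (_ : CWComplex (univ : Set W))
      (Dpos Dneg : RelCWComplex.Subcomplex (univ : Set W)) (Ψ : Flow ℝ≥0 W)
      (ι : MappingTorus g ≃ₕ W),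
      -- `W` is a finite 2-complex
      Finite (Σ n, RelCWComplex.cell (univ : Set W) n) ∧
      (∀ n, 3 ≤ n → IsEmpty (RelCWComplex.cell (univ : Set W) n)) ∧
      -- the two boundaries are disjoint 1-subcomplexes
      (∀ n, 2 ≤ n → Dpos.I n = ∅ ∧ Dneg.I n = ∅) ∧
      Disjoint (Dpos : Set W) (Dneg : Set W) ∧
      -- they are oppositely cooriented relative to the semiflow
      IsOutwardCooriented Ψ (Dpos : Set W) ∧
      IsInwardCooriented Ψ (Dneg : Set W) ∧
      -- the homotopy equivalence is a flow-preserving embedding onto their complement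
      IsEmbedding ι ∧
      (∀ (t : ℝ≥0) (z : MappingTorus g), ι (suspensionSemiflow g t z) = Ψ t (ι z)) ∧
      range ι = ((Dpos : Set W) ∪ (Dneg : Set W))ᶜ := by
  obtain ⟨Gp, Gm, θ, hdec⟩ := GraphCells.exists_endDecomposition hΓ hg
  obtain ⟨Np, Nm, Tp, Tm, h⟩ := hdec.exists_heights hΓ
  exact h.exists_compactification
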